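/- **Setting.** $M\ge 1$ agents act synchronously, each with $K\ge 1$ actions. At every time step agent $m$ receives an independent context and reward vector $(x,r)\sim\mathcal D_m$ with $r\in[0,1]^K$, picks an action $a$ and observes $r(a)$. Mean rewards are linear, $\mu_m(x,a)=\mathbb E[r(a)\mid x]=\langle\omega_m^*,\phi_m(x,a)\rangle$, where $\phi_m(x,a)\in\mathbb R^{d^\alpha+d^\beta_m}$ is known, $\|\phi_m(x,a)\|_2\le 1$, $\|\omega_m^*\|_2\le 1$, and $\omega^*_m=[\omega^{\alpha,*},\omega^{\beta,*}_m]$ with a block $\omega^{\alpha,*}\in\mathbb R^{d^\alpha}$ shared by all agents and an agent-specific block $\omega_m^{\beta,*}\in\mathbb R^{d^\beta_m}$. Put $\tilde d=d^\alpha+\sum_m d^\beta_m$, and let $\tilde\phi_m(x,a)\in\mathbb R^{\tilde d}$ be $\phi_m(x,a)$ padded by zeros in the blocks of the other agents. The regret is $\mathrm{Reg}(T)=\mathbb E\big[\sum_{m}\sum_{t\le T}(\max_a\mu_m(x_{m,t},a)-\mu_m(x_{m,t},a_{m,t}))\big]$. **Algorithm (FedIGW with distributed AGD).** Epoch $l\ge1$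 consists of the times $\tau^{l-1}<t\le\tau^l$, where $\tau^0=0$ and $\tau^l=2^l$ for $l\ge 1$; let $n_l=M(\tau^l-\tau^{l-1})$ be its number of samples. In epoch $l$ agent $m$ uses $\hat f^l_m(x,a)=\langle\hat\omega^l,\tilde\phi_m(x,a)\rangle$ and inverse gap weighting: with $\hat a$ maximizing $\hat f^l_m(x,\cdot)$, each $a\ne\hat a$ is played with probability $1/(K+\gamma^l(\hat f^l_m(x,\hat a)-\hat f^l_m(x,a)))$, and $\hat a$ with the remaining probability. Here $\hat\omega^1=0$, and $\hat\omega^{l+1}$ is the result of $\rho^l$ steps, started at $0$, of Nesterov's accelerated gradient descent with constant step size (general scheme with $\gamma_0=L$) on the ridge regression objective $$\frac1{n_l}\sum_{m}\sum_{i}\big(\langle\omega,\tilde\phi_m(x_m^i,a_m^i)\rangle-r_m^i\big)^2+\frac1{n_l}\|\omega\|_2^2,\qquad \omega\in\mathbb R^{\tilde d},$$ of the data of epoch $l$. It is executed in a distributed way: agent $m$ stores only the shared block and her own block; in each round every agent sends the shared block of her local gradient ($d^\alpha$ reals) to the server, which sends their sum ($d^\alpha$ reals) to every agent. The tuning is $\gamma^l=c_\gamma\sqrt{Kn_{l-1}/\tilde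 d}$ and $\rho^l=\lceil c_\rho\sqrt{n_l}\,\log\max(d^\alpha,2)\rceil$, with constants $c_\gamma,c_\rho>0$. **Claim.** For all $c_\gamma,c_\rho>0$ there are $C>0$ and $p\in\mathbb N$, depending on nothing else, such that for all $M,K,d^\alpha,(d^\beta_m)_m$, all such environments and every measurable tie-breaking rule for $\hat a$: (0) after each round the blocks stored by the agents are exactly the corresponding blocks of the AGD iterate in $\mathbb R^{\tilde d}$; (1) for every $T$ with $M\le K\tilde dT$, $$\mathrm{Reg}(T)\le C\,\log^p(2+MK\tilde dT)\,\sqrt{MK\tilde dT},$$ i.e. $\mathrm{Reg}(T)=\tilde O(\sqrt{MK\tilde dT})$; (2) for every $T$, the number of real numbers communicated up to time $T$ is at most $C\,d^\alpha\log(\max(d^\alpha,2))\sqrt{M^3T}$. -/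

import Mathlib

open MeasureTheory ProbabilityTheory
open scoped ENNReal

noncomputable section

namespace FedIGW

/-! ### The environment -/

/-- A federated contextual bandit with `M` synchronous agents and `K` actions per agent.
Agent `m` has contexts in `X m`, and her parameter lives in `ℝ ^ (d + b m)`, indexed by
`Fin d ⊕ Fin (b m)`: the first `d` coordinates are shared by all agents, the last `b m` are
her own.  A context is drawn from `ctx m` and a reward vector from `rew m x` given the context
`x` (so the joint law of context and rewards is `ctx m ⊗ₘ rew m`).  Rewards lie in `[0, 1]`,
features and true parameters have Euclidean norm at most one, and the mean reward is linear. -/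
structure Env (M K d : ℕ) (b : Fin M → ℕ) (X : Fin M → Type*) [∀ m, MeasurableSpace (X m)] where
  ctx : ∀ m, Measure (X m)
  ctx_prob : ∀ m, IsProbabilityMeasure (ctx m)
  rew : ∀ m, Kernel (X m) (Fin K → ℝ)
  rew_markov : ∀ m, IsMarkovKernel (rew m)
  rew_mem : ∀ m x, ∀ᵐ r ∂(rew m x), ∀ a, r a ∈ Set.Icc (0 : ℝ) 1
  /-- the known feature map of agent `m` -/
  φ : ∀ m, X m → Fin K → EuclideanSpace ℝ (Fin d ⊕ Fin (b m))
  φ_meas : ∀ m a, Measurable fun x => φ m x a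
  φ_norm : ∀ m x a, ‖φ m x a‖ ≤ 1
  /-- the true parameter of agent `m` -/
  θ : ∀ m, EuclideanSpace ℝ (Fin d ⊕ Fin (b m))
  θ_shared : ∀ m m' (i : Fin d), θ m (Sum.inl i) = θ m' (Sum.inl i)
  θ_norm : ∀ m, ‖θ m‖ ≤ 1
  realizable : ∀ m x a, ∫ r, r a ∂(rew m x) = inner ℝ (θ m) (φ m x a)

/-- The coordinates of the reformulated problem: the shared block, then one block per agent. -/
abbrev Coord {M : ℕ} (d : ℕ) (b : Fin M → ℕ) : Type := Fin d ⊕ (Σ m : Fin M, Fin (b m))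

/-- The dimension of the reformulated problem. -/
def dTilde {M : ℕ} (d : ℕ) (b : Fin M → ℕ) : ℕ := d + ∑ m, b m

/-- What happens in one time step: for each agent a context, a reward vector and an action. -/
abbrev Step {M : ℕ} (K : ℕ) (X : Fin M → Type*) : Type _ := ∀ m, X m × (Fin K → ℝ) × Fin K

/-- A data set with `E` samples `(context, action, observed reward)` per agent. -/
abbrev Data {M : ℕ} (K E : ℕ) (X : Fin M → Type*) : Type _ := ∀ m, Fin E → X m × Fin K × ℝ

/-! ### Nesterov's accelerated gradient descent (constant step size) -/

/-- The positive root `x` of `x ^ 2 = (1 - x) * a ^ 2 + q * x`. -/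
def nextAlpha (q a : ℝ) : ℝ := ((q - a ^ 2) + √((q - a ^ 2) ^ 2 + 4 * a ^ 2)) / 2

/-- Nesterov's sequence `α₀, α₁, …`, where `q = μ / L` is the inverse condition number. -/
def agdAlpha (q : ℝ) : ℕ → ℝ
  | 0 => nextAlpha q 1
  | k + 1 => nextAlpha q (agdAlpha q k)

def momentum (q : ℝ) (k : ℕ) : ℝ :=
  agdAlpha q k * (1 - agdAlpha q k) / (agdAlpha q k ^ 2 + agdAlpha q (k + 1))

/-- Accelerated gradient descent for an `L`-smooth, `q * L`-strongly convex `f`, started at `0`: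
the pair of the `k`-th iterate `x_k` and the `k`-th extrapolated point `y_k`. -/
def agd {H : Type*} [NormedAddCommGroup H] [InnerProductSpace ℝ H] [CompleteSpace H]
    (L q : ℝ) (f : H → ℝ) : ℕ → H × H
  | 0 => (0, 0)
  | k + 1 =>
    let x := (agd L q f k).1
    let y := (agd L q f k).2
    let x' := y - (1 / L) • gradient f y
    (x', x' + momentum q k • (x' - x))

/-- Inverse gap weighting: the probability of action `a` when the estimated rewards are `v`,
`sel v` is a greedy action, and the learning rate is `γ`. -/
def igw {K : ℕ} (sel : (Fin K → ℝ) → Fin K) (γ : ℝ) (v : Fin K → ℝ) (a : Fin K) : ℝ :=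
  if a = sel v then 1 - ∑ a' ∈ Finset.univ.erase (sel v), 1 / (K + γ * (v (sel v) - v a'))
  else 1 / (K + γ * (v (sel v) - v a))

/-! ### Epochs -/

/-- The time at which epoch `l` ends: `τ l = 2 ^ l` for `l ≥ 1`, and `τ 0 = 0`. -/
def τ (l : ℕ) : ℕ := if l = 0 then 0 else 2 ^ l

/-- The length of epoch `l`. -/
def epochLen (l : ℕ) : ℕ := τ l - τ (l - 1)

/-- The epoch of the `t`-th time step, counted from `t = 0`: the least `l ≥ 1` with
`t + 1 ≤ 2 ^ l`. -/
def epochOf (t : ℕ) : ℕ := max 1 (Nat.clog 2 (t + 1))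

namespace Env

variable {M K d : ℕ} {b : Fin M → ℕ} {X : Fin M → Type*} [∀ m, MeasurableSpace (X m)]

/-- The mean reward `μ_m(x, a)`. -/
def mean (env : Env M K d b X) (m : Fin M) (x : X m) (a : Fin K) : ℝ := ∫ r, r a ∂(env.rew m x)

/-- The reformulated feature map: the shared coordinates of `φ`, her own coordinates of `φ` in
the block of agent `m`, and zero in the blocks of the other agents. -/
def featTilde (env : Env M K d b X) (m : Fin M) (x : X m) (a : Fin K) :
    EuclideanSpace ℝ (Coord d b) :=
  WithLp.toLp 2 (Sum.elim (fun i => env.φ m x a (Sum.inl i))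
    (fun p => if h : p.1 = m then env.φ m x a (Sum.inr (h ▸ p.2)) else 0))

/-- The ridge regression objective of the reformulated problem, for `n = M * E` samples. -/
def ridgeLoss (env : Env M K d b X) {E : ℕ} (lam : ℝ) (S : Data K E X)
    (w : EuclideanSpace ℝ (Coord d b)) : ℝ :=
  ∑ m, (1 / ((M * E : ℕ) : ℝ)) *
      ∑ i, (inner ℝ w (env.featTilde m (S m i).1 (S m i).2.1) - (S m i).2.2) ^ 2
    + lam * ‖w‖ ^ 2

/-- The regularization parameter `1 / n`, for `n = M * E` samples. -/
def reg (M E : ℕ) : ℝ := 1 / ((M * E : ℕ) : ℝ)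

/-- The smoothness constant of the ridge objective with regularization parameter `1 / n`. -/
def smooth (M E : ℕ) : ℝ := 2 * (1 + reg M E)

/-- The ratio of its strong convexity constant `2 / n` to its smoothness constant. -/
def invCond (M E : ℕ) : ℝ := 2 * reg M E / smooth M E

/-- The parameter obtained by `k` steps of accelerated gradient descent on the reformulated
ridge regression problem with regularization parameter `1 / n`. -/
def flOutput (env : Env M K d b X) {E : ℕ} (S : Data K E X) (k : ℕ) :
    EuclideanSpace ℝ (Coord d b) :=
  (agd (smooth M E) (invCond M E) (env.ridgeLoss (reg M E) S) k).1

/-! ### The distributed protocol -/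

/-- What is stored in the system during the distributed protocol.  Agent `m` keeps only her copy
of the shared coordinates and her own coordinates of the iterate `x` and of the extrapolated
point `y`.  The field `sent` counts the real numbers communicated so far. -/
structure Net (d : ℕ) (b : Fin M → ℕ) where
  x : ∀ m, Fin d ⊕ Fin (b m) → ℝ
  y : ∀ m, Fin d ⊕ Fin (b m) → ℝ
  sent : ℕ

/-- The gradient, in her own coordinates `d + b m`, of the contribution of the samples of agent
`m` to the objective, computed by agent `m` from her own samples at her own point `y`. -/
def localGrad (env : Env M K d b X) {E : ℕ} (S : Data K E X) (m : Fin M)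
    (y : Fin d ⊕ Fin (b m) → ℝ) (c : Fin d ⊕ Fin (b m)) : ℝ :=
  (2 / ((M * E : ℕ) : ℝ)) * ∑ i,
    (∑ c', y c' * env.φ m (S m i).1 (S m i).2.1 c' - (S m i).2.2) *
      env.φ m (S m i).1 (S m i).2.1 c

/-- The message of agent `m` to the server: the shared coordinates of her local gradient. -/
def uplink (env : Env M K d b X) {E : ℕ} (S : Data K E X) (net : Net d b) (m : Fin M) :
    Fin d → ℝ := fun i => env.localGrad S m (net.y m) (Sum.inl i)

/-- The message of the server to every agent: the sum of the messages received. -/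
def broadcast (env : Env M K d b X) {E : ℕ} (S : Data K E X) (net : Net d b) : Fin d → ℝ :=
  fun i => ∑ m, env.uplink S net m i

/-- The new iterate of agent `m`, from what she stores and the message of the server. -/
def agentStep (env : Env M K d b X) {E : ℕ} (S : Data K E X) (m : Fin M)
    (y : Fin d ⊕ Fin (b m) → ℝ) (msg : Fin d → ℝ) (c : Fin d ⊕ Fin (b m)) : ℝ :=
  y c - (1 / smooth M E) *
    (Sum.elim msg (fun j => env.localGrad S m y (Sum.inr j)) c + 2 * reg M E * y c)

/-- The distributed protocol after `k` rounds.  In each round every agent sends `d` real numbers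
to the server, and the server sends `d` real numbers to every agent. -/
def protocol (env : Env M K d b X) {E : ℕ} (S : Data K E X) : ℕ → Net d b
  | 0 => ⟨fun _ _ => 0, fun _ _ => 0, 0⟩
  | k + 1 =>
    let net := env.protocol S k
    let msg := env.broadcast S net
    { x := fun m c => env.agentStep S m (net.y m) msg c
      y := fun m c => env.agentStep S m (net.y m) msg c +
        momentum (invCond M E) k * (env.agentStep S m (net.y m) msg c - net.x m c)
      sent := net.sent + ∑ _m : Fin M, d + ∑ _m : Fin M, d }

/-- The coordinates of a parameter of the reformulated problem that agent `m` knows. -/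
def view (m : Fin M) (w : EuclideanSpace ℝ (Coord d b)) (c : Fin d ⊕ Fin (b m)) : ℝ :=
  Sum.elim (fun i => w (Sum.inl i)) (fun j => w (Sum.inr ⟨m, j⟩)) c

/-! ### The interaction -/

/-- The learning rate of epoch `l`: `cγ * √(K * n / d̃)`, where `n` is the number of samples of
epoch `l - 1`. -/
def rate (M K d : ℕ) (b : Fin M → ℕ) (cγ : ℝ) (l : ℕ) : ℝ :=
  cγ * √((K : ℝ) * ((M * epochLen (l - 1) : ℕ) : ℝ) / (dTilde d b : ℝ))

/-- The number of rounds at the end of epoch `l`: `⌈cρ * √n * log d⌉`, where `n` is the number of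
samples of epoch `l` (and `d` is replaced by `2` if it is smaller). -/
def rounds (M d : ℕ) (cρ : ℝ) (l : ℕ) : ℕ :=
  ⌈cρ * √((M * epochLen l : ℕ) : ℝ) * Real.log ((max d 2 : ℕ) : ℝ)⌉₊

/-- The data set that the agents collect in epoch `l` along a trajectory `s`. -/
def data (l : ℕ) (s : ℕ → Step K X) : Data K (epochLen l) X := fun m i =>
  let o := s (τ (l - 1) + i) m
  (o.1, o.2.2, o.2.1 o.2.2)

/-- The parameter used in epoch `l`: zero in the first epoch, and later on the output of the
federated learning routine on the data of the previous epoch. -/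
def estimate (env : Env M K d b X) (cρ : ℝ) (l : ℕ) (s : ℕ → Step K X) :
    EuclideanSpace ℝ (Coord d b) :=
  if l ≤ 1 then 0 else env.flOutput (data (l - 1) s) (rounds M d cρ (l - 1))

/-- The law of the context, the reward vector and the action of agent `m` in one time step if
actions are drawn by inverse gap weighting with parameter `w` and learning rate `γ`. -/
def agentLaw (env : Env M K d b X) (sel : (Fin K → ℝ) → Fin K) (γ : ℝ)
    (w : EuclideanSpace ℝ (Coord d b)) (m : Fin M) : Measure (X m × (Fin K → ℝ) × Fin K) :=
  ∑ a : Fin K, ((env.ctx m ⊗ₘ env.rew m).withDensity fun z =>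
    ENNReal.ofReal (igw sel γ (fun a' => inner ℝ w (env.featTilde m z.1 a')) a)).map
      fun z => (z.1, z.2, a)

/-- The law of time step `t` given the past; it depends on the trajectory `s` only through the
time steps before `t`. -/
def stepLaw (env : Env M K d b X) (sel : (Fin K → ℝ) → Fin K) (cγ cρ : ℝ) (t : ℕ)
    (s : ℕ → Step K X) : Measure (Step K X) :=
  Measure.pi fun m => env.agentLaw sel (rate M K d b cγ (epochOf t))
    (env.estimate cρ (epochOf t) s) m

/-- The process `s` is a run of the algorithm in the environment: the conditional law of time
step `t` given the time steps before `t` is `stepLaw`. -/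
structure IsRun (env : Env M K d b X) (sel : (Fin K → ℝ) → Fin K) (cγ cρ : ℝ)
    {Ω : Type*} [MeasurableSpace Ω] (P : Measure Ω) (s : ℕ → Ω → Step K X) : Prop where
  meas : ∀ t, Measurable (s t)
  law : ∀ (t : ℕ) (F : (Fin t → Step K X) × Step K X → ℝ≥0∞), Measurable F →
    ∫⁻ ω, F (fun i => s i ω, s t ω) ∂P =
      ∫⁻ ω, ∫⁻ o, F (fun i => s i ω, o) ∂(env.stepLaw sel cγ cρ t fun j => s j ω) ∂P

/-- The regret of all agents in the first `T` time steps along one trajectory. -/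
def pathRegret (env : Env M K d b X) (T : ℕ) (s : ℕ → Step K X) : ℝ :=
  ∑ m, ∑ t ∈ Finset.range T,
    ((⨆ a, env.mean m (s t m).1 a) - env.mean m (s t m).1 (s t m).2.2)

/-- The number of real numbers communicated in the first `T` time steps along one trajectory:
the protocol is executed at the end of each epoch `l ≥ 1` with `2 ^ l ≤ T`. -/
def totalSent (env : Env M K d b X) (cρ : ℝ) (T : ℕ) (s : ℕ → Step K X) : ℕ :=
  ∑ l ∈ Finset.Icc 1 (Nat.log 2 T), (env.protocol (data l s) (rounds M d cρ l)).sent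

end Env

end FedIGW

end

/-!
Under inverse gap weighting with learning rate `γ`, the regret in a fixed context is controlled by
`K / γ` plus `γ` times the mean squared error of the estimated rewards, *under the policy of the
previous epoch* (`igw_transfer`).  All contexts and agents are averaged afterwards, so that the
regret analysis is linear in the prediction error of the computed parameter, and only the
expectation of that error is needed.  In `gapError` the contribution of each epoch is halved when
passing to the next one, whence the sum over epochs stays of the order of a single term
(`Env.IsRun.lintegral_gapError_le`).

The expected prediction error of an epoch with `n` samples is `O(d̃ log² / n)` per agent, with two
nonnegative supermartingales behind it.  Let `A` be the regularized Gram matrix and `z` the noise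
of the normal equations, so that ridge regression misses the true parameter by `A⁻¹ z`.

* `zᵀ A⁻¹ z - log det A` has nonincreasing expectation, since a new sample `x` adds at most
  `xᵀ A⁻¹ x` (with the new `A`) in expectation, and this is at most the increment of `log det A`
  (`lintegral_ridgePotential_le`).  Hence `𝔼 zᵀ A⁻¹ z = O(d̃ log n)`.
* `tr exp (𝔼 S / 10 - S / 4)` has nonincreasing expectation, where `S` is the sum of the matrices
  `x xᵀ` (`lintegral_trace_exp_le`).  This needs the Golden–Thompson inequality
  (`trace_exp_add_le`), which is proved by way of the Lie product formula and elementary trace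
  inequalities.  Therefore the expected Gram matrix is dominated by the observed one, up to a
  logarithm, outside of an event of small probability.

Both supermartingales are run through the agents of one time step and through the time steps of an
epoch.  Neither needs the samples to be identically distributed.

The optimization error is dealt with along every trajectory: accelerated gradient descent
converges at the rate `4 / (k + 2)²` (`agd_le`), which for `k ≥ c √n` steps makes the error of the
iterate, measured by `A`, as small as the statistical error
(`Env.quadForm_estimate_sub_le`).

The distributed protocol computes these iterates because the padded features of an agent vanish in
the blocks of the others, so that the gradient in the block of an agent only involves her own
samples (`Env.protocol_eq_view`).  The communication bound is a geometric sum.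
-/

set_option linter.unusedSectionVars false

noncomputable section

namespace FedIGW

/-! ### Convergence of accelerated gradient descent -/

lemma nextAlpha_eq (q a : ℝ) :
    nextAlpha q a ^ 2 = (1 - nextAlpha q a) * a ^ 2 + q * nextAlpha q a := by
  have h := Real.sq_sqrt (show 0 ≤ (q - a ^ 2) ^ 2 + 4 * a ^ 2 by positivity)
  unfold nextAlpha
  nlinarith

lemma nextAlpha_pos (q : ℝ) {a : ℝ} (ha : 0 < a) : 0 < nextAlpha q a := by
  have h : |q - a ^ 2| < √((q - a ^ 2) ^ 2 + 4 * a ^ 2) := by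
    apply Real.lt_sqrt_of_sq_lt
    rw [sq_abs]
    nlinarith [sq_pos_of_pos ha]
  have := neg_abs_le (q - a ^ 2)
  unfold nextAlpha
  linarith

lemma nextAlpha_lt_one {q a : ℝ} (hq : q < 1) (ha : 0 < a) : nextAlpha q a < 1 := by
  have h1 := nextAlpha_eq q a
  have h2 := nextAlpha_pos q ha
  by_contra! h
  nlinarith [sq_pos_of_pos ha]

lemma agdAlpha_pos (q : ℝ) (k : ℕ) : 0 < agdAlpha q k := by
  induction k with
  | zero => exact nextAlpha_pos q one_pos
  | succ k ih => exact nextAlpha_pos q ih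

lemma agdAlpha_lt_one {q : ℝ} (hq : q < 1) (k : ℕ) : agdAlpha q k < 1 := by
  cases k with
  | zero => exact nextAlpha_lt_one hq one_pos
  | succ k => exact nextAlpha_lt_one hq (agdAlpha_pos q k)

/-- The contraction factor `∏_{i < k} (1 - α_i)` of the estimate sequence after `k` steps. -/
def agdFactor (q : ℝ) (k : ℕ) : ℝ := ∏ i ∈ Finset.range k, (1 - agdAlpha q i)

lemma agdFactor_succ (q : ℝ) (k : ℕ) :
    agdFactor q (k + 1) = agdFactor q k * (1 - agdAlpha q k) := by
  simp [agdFactor, Finset.prod_range_succ]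

lemma agdFactor_le_sq_agdAlpha {q : ℝ} (h0 : 0 ≤ q) (hq : q < 1) (k : ℕ) :
    agdFactor q (k + 1) ≤ agdAlpha q k ^ 2 := by
  induction k with
  | zero =>
    have h := nextAlpha_eq q 1
    have := agdAlpha_pos q 0
    simp only [agdFactor_succ, agdAlpha] at *
    simp only [agdFactor, Finset.prod_range_zero]
    nlinarith
  | succ k ih =>
    have h := nextAlpha_eq q (agdAlpha q k)
    have h1 := agdAlpha_pos q (k + 1)
    have h2 := agdAlpha_lt_one hq (k + 1)
    rw [agdFactor_succ]
    simp only [agdAlpha] at *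
    nlinarith

lemma agdFactor_le {q : ℝ} (h0 : 0 ≤ q) (hq : q < 1) (k : ℕ) :
    agdFactor q k ≤ 4 / ((k : ℝ) + 2) ^ 2 := by
  induction k with
  | zero => norm_num [agdFactor]
  | succ k ih =>
    by_contra! h
    push_cast at h
    have h1 := agdFactor_le_sq_agdAlpha h0 hq k
    have hα : 2 / ((k : ℝ) + 3) < agdAlpha q k := by
      refine lt_of_pow_lt_pow_left₀ 2 (agdAlpha_pos q k).le (lt_of_lt_of_le ?_ h1)
      refine lt_of_eq_of_lt ?_ h
      rw [div_pow]; norm_num; ring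
    have h2 : agdFactor q (k + 1) ≤ 4 / ((k : ℝ) + 2) ^ 2 * (1 - 2 / ((k : ℝ) + 3)) := by
      rw [agdFactor_succ]
      exact mul_le_mul ih (by linarith) (by linarith [agdAlpha_lt_one hq k]) (by positivity)
    have h3 : 4 / ((k : ℝ) + 2) ^ 2 * (1 - 2 / ((k : ℝ) + 3)) ≤ 4 / ((k : ℝ) + 1 + 2) ^ 2 := by
      have e : 4 / ((k : ℝ) + 2) ^ 2 * (1 - 2 / ((k : ℝ) + 3))
          = 4 * (k + 1) / (((k : ℝ) + 2) ^ 2 * (k + 3)) := by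
        field_simp; ring
      rw [e, div_le_div_iff₀ (by positivity) (by positivity)]
      have : (0 : ℝ) ≤ k := Nat.cast_nonneg k
      nlinarith
    linarith

section
variable {H : Type*} [NormedAddCommGroup H] [InnerProductSpace ℝ H] [CompleteSpace H]

/-- The minimizers `v_k` of the estimate sequence of accelerated gradient descent. -/
def agdCenter (L q : ℝ) (f : H → ℝ) : ℕ → H
  | 0 => 0
  | k + 1 => (agd L q f k).1 + (1 / agdAlpha q k) • ((agd L q f (k + 1)).1 - (agd L q f k).1)

/-- `γ_k / L`, the curvature of the estimate sequence. -/
def agdCurv (q : ℝ) : ℕ → ℝ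
  | 0 => 1
  | k + 1 => agdAlpha q k ^ 2

lemma agdCurv_pos (q : ℝ) (k : ℕ) : 0 < agdCurv q k := by
  cases k with
  | zero => exact one_pos
  | succ k => exact pow_pos (agdAlpha_pos q k) 2

lemma agdCurv_succ (q : ℝ) (k : ℕ) :
    agdCurv q (k + 1) = (1 - agdAlpha q k) * agdCurv q k + q * agdAlpha q k := by
  cases k with
  | zero => simpa [agdCurv, agdAlpha] using nextAlpha_eq q 1
  | succ k => simpa [agdCurv, agdAlpha] using nextAlpha_eq q (agdAlpha q k)

/-- The extrapolated point is the convex combination of the iterate and of the centre that the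
general scheme prescribes. -/
lemma agd_snd_eq {L q : ℝ} (f : H → ℝ) (k : ℕ) :
    (agdCurv q k + q * agdAlpha q k) • (agd L q f k).2 =
      (agdAlpha q k * agdCurv q k) • agdCenter L q f k + agdCurv q (k + 1) • (agd L q f k).1 := by
  cases k with
  | zero => simp [agd, agdCenter]
  | succ k =>
    have e1 : (agd L q f (k + 1)).2 = (agd L q f (k + 1)).1 +
      momentum q k • ((agd L q f (k + 1)).1 - (agd L q f k).1) := rfl
    have ha := agdAlpha_pos q k
    have hb := agdAlpha_pos q (k + 1)
    have hs := agdCurv_succ q (k + 1)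
    have hc : agdCurv q (k + 1) = agdAlpha q k ^ 2 := rfl
    have hd : agdCurv q (k + 2) = agdAlpha q (k + 1) ^ 2 := rfl
    rw [e1, agdCenter]
    generalize (agd L q f (k + 1)).1 = x' at *
    generalize (agd L q f k).1 = x at *
    have key : (agdCurv q (k + 1) + q * agdAlpha q (k + 1)) * momentum q k =
        agdAlpha q (k + 1) * agdCurv q (k + 1) * (1 / agdAlpha q k - 1) := by
      have hm : agdCurv q (k + 1) + q * agdAlpha q (k + 1) =
          agdAlpha q (k + 1) * (agdAlpha q k ^ 2 + agdAlpha q (k + 1)) := by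
        rw [hd, hc] at hs
        rw [hc]
        linear_combination -hs
      rw [hm, hc, momentum]
      field_simp
    have hs' : agdCurv q (k + 1) + q * agdAlpha q (k + 1) =
        agdAlpha q (k + 1) * agdCurv q (k + 1) + agdCurv q (k + 1 + 1) := by linarith
    rw [smul_add, smul_smul, key]
    nth_rewrite 1 [hs']
    module

/-- One step of accelerated gradient descent contracts the potential
`f(x_k) - f(z) + γ_k / 2 * ‖v_k - z‖²` by the factor `1 - α_k`, for every reference point `z`. -/
lemma agd_potential_step {L q : ℝ} (hL : 0 < L) (h0 : 0 ≤ q) (hq : q < 1) {f : H → ℝ}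
    (hlow : ∀ y z, f y + inner ℝ (gradient f y) (z - y) + q * L / 2 * ‖z - y‖ ^ 2 ≤ f z)
    (hup : ∀ y z, f z ≤ f y + inner ℝ (gradient f y) (z - y) + L / 2 * ‖z - y‖ ^ 2)
    (z : H) (k : ℕ) :
    f (agd L q f (k + 1)).1 - f z + L * agdCurv q (k + 1) / 2 * ‖agdCenter L q f (k + 1) - z‖ ^ 2
      ≤ (1 - agdAlpha q k) *
        (f (agd L q f k).1 - f z + L * agdCurv q k / 2 * ‖agdCenter L q f k - z‖ ^ 2) := by
  have hy := agd_snd_eq (L := L) (q := q) f k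
  have hs := agdCurv_succ q k
  have hα := agdAlpha_pos q k
  have hα1 := agdAlpha_lt_one hq k
  have hc := agdCurv_pos q k
  have hd : agdCurv q (k + 1) = agdAlpha q k ^ 2 := rfl
  have hx' : (agd L q f (k + 1)).1 =
      (agd L q f k).2 - (1 / L) • gradient f (agd L q f k).2 := rfl
  have hv' : agdCenter L q f (k + 1) = (agd L q f k).1 +
      (1 / agdAlpha q k) • ((agd L q f (k + 1)).1 - (agd L q f k).1) := rfl
  rw [hx'] at hv' ⊢
  rw [hv']
  clear hv' hx'
  generalize (agd L q f k).1 = x at *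
  generalize (agd L q f k).2 = y at *
  generalize agdCenter L q f k = v at *
  set g := gradient f y with hg
  generalize agdAlpha q k = α at *
  generalize agdCurv q k = γ at *
  rw [hd] at *
  have d1 := hup y (y - (1 / L) • g)
  have d2 := hlow y x
  have d3 := hlow y z
  rw [← hg] at d1 d2 d3
  -- coordinates relative to `y`: `x = y + a`, `z = y + c`, and `v` is determined by `x` and `y`
  obtain ⟨a, rfl⟩ : ∃ a, x = y + a := ⟨x - y, by abel⟩
  obtain ⟨c, rfl⟩ : ∃ c, z = y + c := ⟨z - y, by abel⟩
  obtain ⟨u, rfl⟩ : ∃ u, v = y + u := ⟨v - y, by abel⟩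
  have hu : (α * γ) • u = -(α ^ 2 • a) := by
    have e : γ + q * α = α * γ + α ^ 2 := by linarith
    rw [e] at hy
    have : (α * γ) • u + α ^ 2 • a = (0 : H) := by
      calc (α * γ) • u + α ^ 2 • a
          = (α * γ) • (y + u) + α ^ 2 • (y + a) - (α * γ + α ^ 2) • y := by module
        _ = 0 := by rw [hy, sub_self]
    exact eq_neg_of_add_eq_zero_left this
  have hu' : u = (-(α / γ)) • a := by
    have : u = (1 / (α * γ)) • ((α * γ) • u) := by
      rw [smul_smul, one_div_mul_cancel (by positivity), one_smul]
    calc u = (1 / (α * γ)) • ((α * γ) • u) := this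
      _ = (-(α / γ)) • a := by
        rw [hu, smul_neg, smul_smul, ← neg_smul]
        congr 2
        field_simp
  have e1 : y + a + (1 / α) • (y - (1 / L) • g - (y + a)) - (y + c)
      = (1 - 1 / α) • a - (1 / (α * L)) • g - c := by
    have : (1 : ℝ) / (α * L) = (1 / α) * (1 / L) := by field_simp
    rw [this]; module
  rw [e1]
  have e2 : y + u - (y + c) = (-(α / γ)) • a - c := by rw [hu']; abel
  rw [e2]
  simp only [add_sub_cancel_left, sub_sub_cancel_left] at d1 d2 d3
  have n1 : ‖(1 - 1 / α) • a - (1 / (α * L)) • g - c‖ ^ 2 =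
      (1 - 1 / α) ^ 2 * ‖a‖ ^ 2 + (1 / (α * L)) ^ 2 * ‖g‖ ^ 2 + ‖c‖ ^ 2
      - 2 * (1 - 1 / α) * (1 / (α * L)) * inner ℝ g a - 2 * (1 - 1 / α) * inner ℝ a c
      + 2 * (1 / (α * L)) * inner ℝ g c := by
    simp only [← real_inner_self_eq_norm_sq, inner_sub_left, inner_sub_right, inner_smul_left,
      inner_smul_right, real_inner_comm g a, real_inner_comm c a, real_inner_comm c g]
    simp only [conj_trivial, real_inner_comm a g, real_inner_comm a c]
    ring
  have n2 : ‖(-(α / γ)) • a - c‖ ^ 2 =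
      (α / γ) ^ 2 * ‖a‖ ^ 2 + ‖c‖ ^ 2 + 2 * (α / γ) * inner ℝ a c := by
    simp only [← real_inner_self_eq_norm_sq, inner_sub_left, inner_sub_right, inner_smul_left,
      inner_smul_right]
    simp only [conj_trivial, real_inner_comm a c]
    ring
  rw [n1, n2]
  have m1 : inner ℝ g (-((1 / L) • g)) = -(1 / L) * ‖g‖ ^ 2 := by
    rw [inner_neg_right, inner_smul_right, real_inner_self_eq_norm_sq]; ring
  have m2 : ‖-((1 / L) • g)‖ ^ 2 = (1 / L) ^ 2 * ‖g‖ ^ 2 := by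
    rw [norm_neg, norm_smul, mul_pow, Real.norm_eq_abs, sq_abs]
  rw [m1, m2] at d1
  have d1' : f (y - (1 / L) • g) ≤ f y - 1 / (2 * L) * ‖g‖ ^ 2 := by
    refine d1.trans (le_of_eq ?_)
    field_simp; ring
  generalize f (y - (1 / L) • g) = F1 at *
  generalize f (y + a) = Fa at *
  generalize f (y + c) = Fc at *
  generalize f y = F0 at *
  generalize inner ℝ g a = ga at *
  generalize inner ℝ g c = gc at *
  generalize inner ℝ a c = ac at *
  have pa : 0 ≤ ‖a‖ ^ 2 := by positivity
  generalize ‖a‖ ^ 2 = na at *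
  generalize ‖c‖ ^ 2 = nc at *
  generalize ‖g‖ ^ 2 = ng at *
  have d2' := mul_le_mul_of_nonneg_left d2 (by linarith : 0 ≤ 1 - α)
  have d3' := mul_le_mul_of_nonneg_left d3 hα.le
  -- after the two lower bounds only a nonnegative multiple of `‖a‖²` is left
  have lhs : F1 - Fc + L * α ^ 2 / 2 * ((1 - 1 / α) ^ 2 * na + (1 / (α * L)) ^ 2 * ng + nc
      - 2 * (1 - 1 / α) * (1 / (α * L)) * ga - 2 * (1 - 1 / α) * ac + 2 * (1 / (α * L)) * gc)
      = F1 - Fc + L / 2 * (1 - α) ^ 2 * na + 1 / (2 * L) * ng + L * α ^ 2 / 2 * nc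
        + (1 - α) * ga + L * α * (1 - α) * ac + α * gc := by
    field_simp; ring
  have rhs : (1 - α) * (Fa - Fc + L * γ / 2 * ((α / γ) ^ 2 * na + nc + 2 * (α / γ) * ac))
      = (1 - α) * (Fa - Fc) + (1 - α) * (L / 2) * (α ^ 2 / γ) * na + (1 - α) * L * γ / 2 * nc
        + (1 - α) * L * α * ac := by
    field_simp; ring
  rw [lhs, rhs]
  have hna : (1 - α) ^ 2 ≤ (1 - α) * (α ^ 2 / γ) + (1 - α) * q := by
    have : 1 - α ≤ α ^ 2 / γ := by
      rw [le_div_iff₀ hc]; linarith only [hs, mul_nonneg h0 hα.le]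
    have h1 : 0 ≤ 1 - α := by linarith only [hα1]
    linarith only [mul_le_mul_of_nonneg_left this h1, mul_nonneg h1 h0]
  have hna' := mul_le_mul_of_nonneg_right hna (by positivity : 0 ≤ L / 2 * na)
  have hnc : L * α ^ 2 / 2 * nc = (1 - α) * L * γ / 2 * nc + α * q * L / 2 * nc := by
    rw [hs]; ring
  linarith only [d1', d2', d3', hna', hnc]

/-- Convergence of accelerated gradient descent at the rate `4 / (k + 2)²`, with an arbitrary
reference point in place of a minimizer. -/
theorem agd_le {L q : ℝ} (hL : 0 < L) (h0 : 0 ≤ q) (hq : q < 1) {f : H → ℝ}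
    (hlow : ∀ y z, f y + inner ℝ (gradient f y) (z - y) + q * L / 2 * ‖z - y‖ ^ 2 ≤ f z)
    (hup : ∀ y z, f z ≤ f y + inner ℝ (gradient f y) (z - y) + L / 2 * ‖z - y‖ ^ 2)
    (z : H) (hz : f z ≤ f 0) (k : ℕ) :
    f (agd L q f k).1 - f z ≤ 4 / ((k : ℝ) + 2) ^ 2 * (f 0 - f z + L / 2 * ‖z‖ ^ 2) := by
  have h : f (agd L q f k).1 - f z + L * agdCurv q k / 2 * ‖agdCenter L q f k - z‖ ^ 2 ≤
      agdFactor q k * (f 0 - f z + L / 2 * ‖z‖ ^ 2) := by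
    induction k with
    | zero => simp [agd, agdCenter, agdCurv, agdFactor]
    | succ k ih =>
      refine (agd_potential_step hL h0 hq hlow hup z k).trans ?_
      rw [agdFactor_succ]
      calc _ ≤ (1 - agdAlpha q k) * (agdFactor q k * (f 0 - f z + L / 2 * ‖z‖ ^ 2)) :=
            mul_le_mul_of_nonneg_left ih (by linarith [agdAlpha_lt_one hq k])
        _ = _ := by ring
  have h1 : 0 ≤ L * agdCurv q k / 2 * ‖agdCenter L q f k - z‖ ^ 2 := by
    have := agdCurv_pos q k
    positivity
  have h2 := mul_le_mul_of_nonneg_right (agdFactor_le h0 hq k)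
    (by have : 0 ≤ L / 2 * ‖z‖ ^ 2 := by positivity
        linarith : 0 ≤ f 0 - f z + L / 2 * ‖z‖ ^ 2)
  linarith

end

/-! ### The Golden–Thompson inequality -/

section LieProduct
variable {𝔸 : Type*} [NormedRing 𝔸] [NormedAlgebra ℝ 𝔸] [CompleteSpace 𝔸] [NormOneClass 𝔸]

lemma norm_exp_le_exp_norm (x : 𝔸) : ‖NormedSpace.exp x‖ ≤ Real.exp ‖x‖ := by
  rw [NormedSpace.exp_eq_tsum ℝ]
  have h : HasSum (fun n : ℕ => ‖x‖ ^ n / (n.factorial : ℝ)) (Real.exp ‖x‖) := by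
    rw [Real.exp_eq_exp_ℝ]
    exact NormedSpace.expSeries_div_hasSum_exp ‖x‖
  refine tsum_of_norm_bounded h fun n => ?_
  rw [norm_smul, norm_inv, Real.norm_natCast, div_eq_inv_mul]
  gcongr
  exact norm_pow_le x n

lemma norm_pow_sub_pow_le {x y : 𝔸} {c : ℝ} (hx : ‖x‖ ≤ c) (hy : ‖y‖ ≤ c) (hc : 1 ≤ c) (n : ℕ) :
    ‖x ^ n - y ^ n‖ ≤ n * c ^ n * ‖x - y‖ := by
  induction n with
  | zero => simp
  | succ n ih =>
    have hc0 : 0 ≤ c := by linarith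
    have e : x ^ (n + 1) - y ^ (n + 1) = x ^ n * (x - y) + (x ^ n - y ^ n) * y := by
      rw [pow_succ, pow_succ]; noncomm_ring
    have h1 : ‖x ^ n‖ ≤ c ^ (n + 1) := (norm_pow_le x n).trans
      ((pow_le_pow_left₀ (norm_nonneg _) hx n).trans (pow_le_pow_right₀ hc n.le_succ))
    calc ‖x ^ (n + 1) - y ^ (n + 1)‖
        ≤ ‖x ^ n‖ * ‖x - y‖ + ‖x ^ n - y ^ n‖ * ‖y‖ := by
          rw [e]; exact (norm_add_le _ _).trans (add_le_add (norm_mul_le _ _) (norm_mul_le _ _))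
      _ ≤ c ^ (n + 1) * ‖x - y‖ + n * c ^ n * ‖x - y‖ * c := by gcongr
      _ = _ := by push_cast; ring

/-- The Lie product formula along the powers of two. -/
lemma tendsto_exp_mul_exp_pow (a b : 𝔸) :
    Filter.Tendsto (fun k : ℕ => (NormedSpace.exp (((2 : ℝ) ^ k)⁻¹ • a) *
      NormedSpace.exp (((2 : ℝ) ^ k)⁻¹ • b)) ^ 2 ^ k) Filter.atTop
      (nhds (NormedSpace.exp (a + b))) := by
  let : NormedAlgebra ℚ 𝔸 := .restrictScalars ℚ ℝ 𝔸
  set X : ℝ → 𝔸 := fun t => NormedSpace.exp (t • a) * NormedSpace.exp (t • b)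
  set Y : ℝ → 𝔸 := fun t => NormedSpace.exp (t • (a + b))
  have hd : HasDerivAt (fun t => X t - Y t) 0 0 := by
    have h1 := (hasDerivAt_exp_smul_const (𝕂 := ℝ) a 0).mul
      (hasDerivAt_exp_smul_const (𝕂 := ℝ) b 0)
    have h2 := h1.sub (hasDerivAt_exp_smul_const (𝕂 := ℝ) (a + b) 0)
    refine h2.congr_deriv ?_
    simp [NormedSpace.exp_zero]
  have ht : Filter.Tendsto (fun k : ℕ => ((2 : ℝ) ^ k)⁻¹) Filter.atTop
      (nhdsWithin 0 {0}ᶜ) := by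
    refine tendsto_nhdsWithin_iff.2 ⟨?_, .of_forall fun k => by simp⟩
    simpa [inv_pow] using tendsto_pow_atTop_nhds_zero_of_lt_one (r := (2 : ℝ)⁻¹)
      (by norm_num) (by norm_num)
  have hlim := (hd.tendsto_slope_zero.comp ht).norm
  have hpow (k : ℕ) : Y ((2 : ℝ) ^ k)⁻¹ ^ 2 ^ k = NormedSpace.exp (a + b) := by
    rw [← NormedSpace.exp_nsmul, ← Nat.cast_smul_eq_nsmul ℝ, smul_smul]
    simp
  rw [tendsto_iff_norm_sub_tendsto_zero]
  have hlim' : Filter.Tendsto (fun k : ℕ => Real.exp (‖a‖ + ‖b‖) *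
      ‖(((2 : ℝ) ^ k)⁻¹)⁻¹ • (X (0 + ((2 : ℝ) ^ k)⁻¹) - Y (0 + ((2 : ℝ) ^ k)⁻¹) - (X 0 - Y 0))‖)
      Filter.atTop (nhds 0) := by
    simpa using hlim.const_mul (Real.exp (‖a‖ + ‖b‖))
  refine squeeze_zero (fun _ => norm_nonneg _) (fun k => ?_) hlim'
  have h0 : X 0 - Y 0 = 0 := by simp [X, Y, NormedSpace.exp_zero]
  have hk : (0 : ℝ) < 2 ^ k := by positivity
  rw [← hpow k, h0, sub_zero, zero_add, inv_inv, norm_smul, Real.norm_of_nonneg hk.le]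
  have hn (v : 𝔸) : ‖((2 : ℝ) ^ k)⁻¹ • v‖ = ((2 : ℝ) ^ k)⁻¹ * ‖v‖ := by
    rw [norm_smul, Real.norm_of_nonneg (by positivity)]
  have hX : ‖X ((2 : ℝ) ^ k)⁻¹‖ ≤ Real.exp (((2 : ℝ) ^ k)⁻¹ * (‖a‖ + ‖b‖)) := by
    refine (norm_mul_le _ _).trans ?_
    rw [mul_add, Real.exp_add, ← hn, ← hn]
    exact mul_le_mul (norm_exp_le_exp_norm _) (norm_exp_le_exp_norm _) (norm_nonneg _)
      (Real.exp_nonneg _)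
  have hY : ‖Y ((2 : ℝ) ^ k)⁻¹‖ ≤ Real.exp (((2 : ℝ) ^ k)⁻¹ * (‖a‖ + ‖b‖)) := by
    refine (norm_exp_le_exp_norm _).trans (Real.exp_le_exp.2 ?_)
    rw [hn]
    gcongr
    exact norm_add_le _ _
  refine (norm_pow_sub_pow_le hX hY (Real.one_le_exp (by positivity)) (2 ^ k)).trans
    (le_of_eq ?_)
  rw [← Real.exp_nat_mul]
  push_cast
  rw [mul_inv_cancel_left₀ hk.ne']
  ring

end LieProduct

section
variable {ι : Type*} [Fintype ι] [DecidableEq ι]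

open Matrix

lemma trace_transpose_mul_self_nonneg (A : Matrix ι ι ℝ) : 0 ≤ (Aᵀ * A).trace := by
  simpa [conjTranspose_eq_transpose_of_trivial] using
    (posSemidef_conjTranspose_mul_self A).trace_nonneg

lemma trace_mul_le_add (A B : Matrix ι ι ℝ) :
    (A * B).trace ≤ ((A * Aᵀ).trace + (Bᵀ * B).trace) / 2 := by
  have h := trace_transpose_mul_self_nonneg (Aᵀ - B)
  have h1 : (Bᵀ * Aᵀ).trace = (A * B).trace := by
    rw [← transpose_mul, trace_transpose]
  simp only [transpose_sub, transpose_transpose, sub_mul, mul_sub, trace_sub] at h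
  linarith

lemma trace_pow_mul_comm (A B : Matrix ι ι ℝ) (n : ℕ) :
    ((A * B) ^ n).trace = ((B * A) ^ n).trace := by
  cases n with
  | zero => simp
  | succ n =>
    have h (k : ℕ) : (A * B) ^ k * A = A * (B * A) ^ k := by
      induction k with
      | zero => simp
      | succ k ih =>
        rw [pow_succ, Matrix.mul_assoc, Matrix.mul_assoc A B A, ← Matrix.mul_assoc _ A, ih,
          Matrix.mul_assoc, ← pow_succ]
    rw [pow_succ, ← Matrix.mul_assoc, h, trace_mul_comm, ← Matrix.mul_assoc, ← pow_succ']

/-- Two trace inequalities that are proved by a simultaneous induction: taking `Z` to `Zᵀ Z`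
increases the trace of a power, and so does collecting the factors of a power of a product. -/
lemma trace_pow_two_pow_le (j : ℕ) :
    (∀ Z : Matrix ι ι ℝ, (Z ^ 2 ^ (j + 1)).trace ≤ ((Zᵀ * Z) ^ 2 ^ j).trace) ∧
    (∀ P Q : Matrix ι ι ℝ, Pᵀ = P → Qᵀ = Q →
      ((P * Q) ^ 2 ^ j).trace ≤ (P ^ 2 ^ j * Q ^ 2 ^ j).trace) := by
  induction j with
  | zero =>
    refine ⟨fun Z => ?_, fun P Q _ _ => by simp⟩
    have h := trace_mul_le_add Z Z
    rw [trace_mul_comm Z Zᵀ] at h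
    simp only [zero_add, pow_one, pow_zero, sq]
    linarith
  | succ j ih =>
    obtain ⟨hT, hU⟩ := ih
    refine ⟨fun Z => ?_, fun P Q hP hQ => ?_⟩
    · have e : ((Z ^ 2)ᵀ * Z ^ 2) = Zᵀ * ((Zᵀ * Z) * Z) := by
        rw [transpose_pow, sq, sq]; noncomm_ring
      have e' : (Zᵀ * Z * (Z * Zᵀ)) = (Zᵀ * Z * Z) * Zᵀ := by noncomm_ring
      have h1 := hT (Z ^ 2)
      rw [← pow_mul, ← pow_succ', e, trace_pow_mul_comm, ← e'] at h1
      have h2 := hU (Zᵀ * Z) (Z * Zᵀ) (by simp) (by simp)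
      have h3 := trace_mul_le_add ((Zᵀ * Z) ^ 2 ^ j) ((Z * Zᵀ) ^ 2 ^ j)
      simp only [transpose_pow, transpose_mul, transpose_transpose] at h3
      rw [← pow_add, ← pow_add, ← two_mul, ← pow_succ', trace_pow_mul_comm Z Zᵀ] at h3
      linarith
    · have h1 := hT (P * Q)
      have e : (P * Q)ᵀ * (P * Q) = Q * (P ^ 2 * Q) := by
        rw [transpose_mul, hP, hQ, sq]; noncomm_ring
      have e' : P ^ 2 * Q * Q = P ^ 2 * Q ^ 2 := by rw [sq Q, Matrix.mul_assoc]
      rw [e, trace_pow_mul_comm Q, e'] at h1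
      have h2 := hU (P ^ 2) (Q ^ 2) (by rw [transpose_pow, hP]) (by rw [transpose_pow, hQ])
      rw [← pow_mul, ← pow_mul, ← pow_succ'] at h2
      linarith

open scoped Matrix.Norms.Operator in
/-- The **Golden–Thompson inequality** for real symmetric matrices. -/
theorem trace_exp_add_le {A B : Matrix ι ι ℝ} (hA : Aᵀ = A) (hB : Bᵀ = B) :
    (NormedSpace.exp (A + B)).trace ≤ (NormedSpace.exp A * NormedSpace.exp B).trace := by
  cases isEmpty_or_nonempty ι with
  | inl h => simp [Matrix.trace]
  | inr h =>
    have hlim := tendsto_exp_mul_exp_pow A B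
    have hlim' := ((continuous_id (X := Matrix ι ι ℝ)).matrix_trace.tendsto _).comp hlim
    refine le_of_tendsto hlim' (.of_forall fun k => ?_)
    have hpow (C : Matrix ι ι ℝ) :
        NormedSpace.exp (((2 : ℝ) ^ k)⁻¹ • C) ^ 2 ^ k = NormedSpace.exp C := by
      rw [← Matrix.exp_nsmul, ← Nat.cast_smul_eq_nsmul ℝ, smul_smul]
      simp
    have := (trace_pow_two_pow_le k).2 (NormedSpace.exp (((2 : ℝ) ^ k)⁻¹ • A))
      (NormedSpace.exp (((2 : ℝ) ^ k)⁻¹ • B))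
      (by rw [← Matrix.exp_transpose, transpose_smul, hA])
      (by rw [← Matrix.exp_transpose, transpose_smul, hB])
    rw [hpow, hpow] at this
    exact this

end

/-! ### Exponentials of symmetric matrices -/

section
variable {ι : Type*} [Fintype ι] [DecidableEq ι]

open Matrix

lemma isHermitian_of_transpose_eq {A : Matrix ι ι ℝ} (hA : Aᵀ = A) : A.IsHermitian := by
  rw [IsHermitian, conjTranspose_eq_transpose_of_trivial, hA]

/-- Orthogonal diagonalization of a real symmetric matrix together with its exponential. -/
lemma exists_diagonalization {A : Matrix ι ι ℝ} (hA : Aᵀ = A) :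
    ∃ (U : Matrix ι ι ℝ) (l : ι → ℝ), U * Uᵀ = 1 ∧ Uᵀ * U = 1 ∧ A = U * diagonal l * Uᵀ ∧
      NormedSpace.exp A = U * diagonal (fun i => Real.exp (l i)) * Uᵀ := by
  have hH := isHermitian_of_transpose_eq hA
  set U : Matrix ι ι ℝ := (hH.eigenvectorUnitary : Matrix ι ι ℝ) with hU
  have h1 : U * Uᵀ = 1 := by
    have := Unitary.mul_star_self_of_mem hH.eigenvectorUnitary.2
    rwa [star_eq_conjTranspose, conjTranspose_eq_transpose_of_trivial] at this
  have h2 : Uᵀ * U = 1 := by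
    have := Unitary.star_mul_self_of_mem hH.eigenvectorUnitary.2
    rwa [star_eq_conjTranspose, conjTranspose_eq_transpose_of_trivial] at this
  have h3 : A = U * diagonal hH.eigenvalues * Uᵀ := by
    have := hH.spectral_theorem
    rw [Unitary.conjStarAlgAut_apply, star_eq_conjTranspose,
      conjTranspose_eq_transpose_of_trivial] at this
    exact this
  refine ⟨U, hH.eigenvalues, h1, h2, h3, ?_⟩
  have hinv : U⁻¹ = Uᵀ := inv_eq_right_inv h1
  have hunit : IsUnit U := ⟨⟨U, Uᵀ, h1, h2⟩, rfl⟩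
  have := exp_conj U (diagonal hH.eigenvalues) hunit
  rw [hinv, ← h3, exp_diagonal, Pi.exp_def] at this
  simpa [Real.exp_eq_exp_ℝ] using this

lemma dotProduct_conj_diagonal (U : Matrix ι ι ℝ) (l v : ι → ℝ) :
    v ⬝ᵥ (U * diagonal l * Uᵀ) *ᵥ v = ∑ i, l i * (Uᵀ *ᵥ v) i ^ 2 := by
  rw [← mulVec_mulVec, ← mulVec_mulVec, dotProduct_mulVec, ← mulVec_transpose]
  simp only [dotProduct, mulVec_diagonal]
  exact Finset.sum_congr rfl fun i _ => by ring

lemma dotProduct_self_conj {U : Matrix ι ι ℝ} (hU : U * Uᵀ = 1) (v : ι → ℝ) :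
    v ⬝ᵥ v = ∑ i, (Uᵀ *ᵥ v) i ^ 2 := by
  have h := dotProduct_conj_diagonal U (fun _ => 1) v
  have e : diagonal (fun _ : ι => (1 : ℝ)) = 1 := diagonal_one
  rw [e, Matrix.mul_one, hU, one_mulVec] at h
  simpa using h

lemma dotProduct_exp_mulVec_nonneg {A : Matrix ι ι ℝ} (hA : Aᵀ = A) (v : ι → ℝ) :
    0 ≤ v ⬝ᵥ NormedSpace.exp A *ᵥ v := by
  obtain ⟨U, l, -, -, -, h⟩ := exists_diagonalization hA
  rw [h, dotProduct_conj_diagonal]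
  exact Finset.sum_nonneg fun i _ => mul_nonneg (Real.exp_nonneg _) (sq_nonneg _)

lemma trace_exp_pos [Nonempty ι] {A : Matrix ι ι ℝ} (hA : Aᵀ = A) :
    0 < (NormedSpace.exp A).trace := by
  obtain ⟨U, l, -, hU, -, h⟩ := exists_diagonalization hA
  rw [h, trace_mul_comm, ← Matrix.mul_assoc, hU, Matrix.one_mul, trace_diagonal]
  exact Finset.sum_pos (fun i _ => Real.exp_pos _) Finset.univ_nonempty

/-- The largest eigenvalue of a symmetric matrix is at most the logarithm of the trace of its
exponential. -/
lemma dotProduct_mulVec_le_log_trace_exp {A : Matrix ι ι ℝ} (hA : Aᵀ = A) (v : ι → ℝ) :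
    v ⬝ᵥ A *ᵥ v ≤ Real.log (NormedSpace.exp A).trace * (v ⬝ᵥ v) := by
  obtain ⟨U, l, hU', hU, h0, h⟩ := exists_diagonalization hA
  rw [h, trace_mul_comm, ← Matrix.mul_assoc, hU, Matrix.one_mul, trace_diagonal,
    dotProduct_self_conj hU' v]
  nth_rewrite 1 [h0]
  rw [dotProduct_conj_diagonal, Finset.mul_sum]
  refine Finset.sum_le_sum fun i _ => mul_le_mul_of_nonneg_right ?_ (sq_nonneg _)
  rw [← Real.log_exp (l i)]
  exact Real.log_le_log (Real.exp_pos _)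
    (Finset.single_le_sum (f := fun j => Real.exp (l j)) (fun j _ => Real.exp_nonneg _)
      (Finset.mem_univ i))

/-- `e^Y ≤ 1 + Y + Y²` for a symmetric matrix `Y` with `-1 ≤ Y ≤ 1`. -/
lemma dotProduct_exp_mulVec_le {Y : Matrix ι ι ℝ} (hY : Yᵀ = Y)
    (h1 : ∀ v, |v ⬝ᵥ Y *ᵥ v| ≤ v ⬝ᵥ v) (v : ι → ℝ) :
    v ⬝ᵥ NormedSpace.exp Y *ᵥ v ≤ v ⬝ᵥ (1 + Y + Y * Y) *ᵥ v := by
  obtain ⟨U, l, hU', hU, h0, h⟩ := exists_diagonalization hY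
  have hl (i : ι) : |l i| ≤ 1 := by
    have e : Uᵀ *ᵥ (U *ᵥ Pi.single i 1) = Pi.single i 1 := by
      rw [mulVec_mulVec, hU, one_mulVec]
    have := h1 (U *ᵥ Pi.single i 1)
    rw [dotProduct_self_conj hU', h0, dotProduct_conj_diagonal, e] at this
    simpa [Pi.single_apply, ite_pow] using this
  have hYY : Y * Y = U * diagonal (fun i => l i * l i) * Uᵀ := by
    have : Y * Y = U * (diagonal l * (Uᵀ * U) * diagonal l) * Uᵀ := by
      rw [h0]; noncomm_ring
    rw [this, hU, Matrix.mul_one, diagonal_mul_diagonal]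
  rw [add_mulVec, add_mulVec, dotProduct_add, dotProduct_add, one_mulVec, hYY, h,
    dotProduct_self_conj hU']
  rw [show v ⬝ᵥ Y *ᵥ v = v ⬝ᵥ (U * diagonal l * Uᵀ) *ᵥ v by rw [← h0]]
  rw [dotProduct_conj_diagonal, dotProduct_conj_diagonal, dotProduct_conj_diagonal,
    ← Finset.sum_add_distrib, ← Finset.sum_add_distrib]
  refine Finset.sum_le_sum fun i _ => ?_
  have := Real.abs_exp_sub_one_sub_id_le (hl i)
  have h2 := (abs_le.1 this).2
  nlinarith [sq_nonneg ((Uᵀ *ᵥ v) i)]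

omit [DecidableEq ι] in
lemma trace_mul_vecMulVec (G : Matrix ι ι ℝ) (x : ι → ℝ) :
    (G * vecMulVec x x).trace = x ⬝ᵥ G *ᵥ x := by
  rw [mul_vecMulVec, trace_vecMulVec, dotProduct_comm]

/-- The trace of the product with an exponential is monotone. -/
lemma trace_exp_mul_mono {H M N : Matrix ι ι ℝ} (hH : Hᵀ = H)
    (h : ∀ v, v ⬝ᵥ M *ᵥ v ≤ v ⬝ᵥ N *ᵥ v) :
    (NormedSpace.exp H * M).trace ≤ (NormedSpace.exp H * N).trace := by
  obtain ⟨U, l, -, -, -, h0⟩ := exists_diagonalization hH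
  have key (M : Matrix ι ι ℝ) : (NormedSpace.exp H * M).trace =
      ∑ i, Real.exp (l i) * (U *ᵥ Pi.single i 1 ⬝ᵥ M *ᵥ (U *ᵥ Pi.single i 1)) := by
    rw [h0, Matrix.mul_assoc, Matrix.mul_assoc, trace_mul_comm, Matrix.mul_assoc]
    simp only [Matrix.trace, diag_apply, diagonal_mul]
    refine Finset.sum_congr rfl fun i _ => ?_
    congr 1
    rw [mulVec_single_one, Matrix.mul_assoc, mul_apply']
    rfl
  rw [key, key]
  exact Finset.sum_le_sum fun i _ => mul_le_mul_of_nonneg_left (h _) (Real.exp_nonneg _)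

end

/-! ### A matrix Chernoff bound for independent rank-one matrices -/

section
variable {ι : Type*} [Fintype ι]

open Matrix

lemma dotProduct_vecMulVec_mulVec (v x : ι → ℝ) :
    v ⬝ᵥ vecMulVec x x *ᵥ v = (x ⬝ᵥ v) ^ 2 := by
  rw [vecMulVec_mulVec, dotProduct_smul]
  simp [dotProduct_comm v x, sq]

lemma dotProduct_sq_le (x v : ι → ℝ) : (x ⬝ᵥ v) ^ 2 ≤ (x ⬝ᵥ x) * (v ⬝ᵥ v) := by
  have := Finset.sum_mul_sq_le_sq_mul_sq Finset.univ x v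
  simpa [dotProduct, sq] using this

lemma abs_apply_le_one {x : ι → ℝ} (hx : x ⬝ᵥ x ≤ 1) (i : ι) : |x i| ≤ 1 := by
  refine abs_le_one_iff_mul_self_le_one.2 (le_trans ?_ hx)
  exact Finset.single_le_sum (f := fun j => x j * x j) (fun j _ => mul_self_nonneg _)
    (Finset.mem_univ i)

section cov
variable {O : Type*} [MeasurableSpace O]

/-- The uncentred second moment matrix `𝔼 ξ ξᵀ` of a random vector `ξ`. -/
def secondMoment (ν : Measure O) (ξ : O → ι → ℝ) : Matrix ι ι ℝ :=
  Matrix.of fun i j => ∫ o, ξ o i * ξ o j ∂ν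

omit [Fintype ι] in
lemma secondMoment_transpose (ν : Measure O) (ξ : O → ι → ℝ) :
    (secondMoment ν ξ)ᵀ = secondMoment ν ξ := by
  ext i j
  simp [secondMoment, mul_comm]

variable {ν : Measure O} [IsProbabilityMeasure ν] {ξ : O → ι → ℝ}

lemma integrable_mul_apply (hξ : Measurable ξ) (hb : ∀ o, ξ o ⬝ᵥ ξ o ≤ 1) (i j : ι) :
    Integrable (fun o => ξ o i * ξ o j) ν := by
  refine Integrable.of_bound (C := 1)
    (((measurable_pi_apply i).comp hξ).mul ((measurable_pi_apply j).comp hξ)).aestronglyMeasurable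
    (.of_forall fun o => ?_)
  rw [Real.norm_eq_abs, abs_mul]
  exact mul_le_one₀ (abs_apply_le_one (hb o) i) (abs_nonneg _) (abs_apply_le_one (hb o) j)

lemma integrable_dotProduct_mulVec (hξ : Measurable ξ) (hb : ∀ o, ξ o ⬝ᵥ ξ o ≤ 1)
    (G : Matrix ι ι ℝ) : Integrable (fun o => ξ o ⬝ᵥ G *ᵥ ξ o) ν := by
  simp only [dotProduct, mulVec, Finset.mul_sum]
  refine integrable_finsetSum _ fun i _ => integrable_finsetSum _ fun j _ => ?_
  refine ((integrable_mul_apply (ν := ν) hξ hb i j).const_mul (G i j)).congr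
    (.of_forall fun o => ?_)
  simp only
  ring

lemma integral_dotProduct_mulVec (hξ : Measurable ξ) (hb : ∀ o, ξ o ⬝ᵥ ξ o ≤ 1)
    (G : Matrix ι ι ℝ) :
    ∫ o, ξ o ⬝ᵥ G *ᵥ ξ o ∂ν = (G * secondMoment ν ξ).trace := by
  have h (i j : ι) := (integrable_mul_apply (ν := ν) hξ hb i j).const_mul (G i j)
  have e (o : O) : ξ o ⬝ᵥ G *ᵥ ξ o = ∑ i, ∑ j, G i j * (ξ o i * ξ o j) := by
    simp only [dotProduct, mulVec, Finset.mul_sum]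
    exact Finset.sum_congr rfl fun i _ => Finset.sum_congr rfl fun j _ => by ring
  simp only [e]
  rw [integral_finsetSum _ fun i _ => integrable_finsetSum _ fun j _ => h i j]
  simp only [Matrix.trace, diag_apply, Matrix.mul_apply]
  refine Finset.sum_congr rfl fun i _ => ?_
  rw [integral_finsetSum _ fun j _ => h i j]
  refine Finset.sum_congr rfl fun j _ => ?_
  rw [integral_const_mul, secondMoment, of_apply]
  simp [mul_comm]

lemma dotProduct_secondMoment_mulVec (hξ : Measurable ξ) (hb : ∀ o, ξ o ⬝ᵥ ξ o ≤ 1) (v : ι → ℝ) :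
    v ⬝ᵥ secondMoment ν ξ *ᵥ v = ∫ o, (ξ o ⬝ᵥ v) ^ 2 ∂ν := by
  have h := integral_dotProduct_mulVec (ν := ν) hξ hb (vecMulVec v v)
  rw [trace_mul_comm, trace_mul_vecMulVec] at h
  rw [← h]
  refine integral_congr_ae (.of_forall fun o => ?_)
  simp only [dotProduct_vecMulVec_mulVec, dotProduct_comm]

lemma dotProduct_secondMoment_mulVec_nonneg (hξ : Measurable ξ) (hb : ∀ o, ξ o ⬝ᵥ ξ o ≤ 1)
    (v : ι → ℝ) : 0 ≤ v ⬝ᵥ secondMoment ν ξ *ᵥ v := by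
  rw [dotProduct_secondMoment_mulVec hξ hb]
  exact integral_nonneg fun o => sq_nonneg _

lemma dotProduct_secondMoment_mulVec_le (hξ : Measurable ξ) (hb : ∀ o, ξ o ⬝ᵥ ξ o ≤ 1)
    (v : ι → ℝ) : v ⬝ᵥ secondMoment ν ξ *ᵥ v ≤ v ⬝ᵥ v := by
  rw [dotProduct_secondMoment_mulVec hξ hb]
  have h0 : 0 ≤ v ⬝ᵥ v := Finset.sum_nonneg fun i _ => mul_self_nonneg _
  calc ∫ o, (ξ o ⬝ᵥ v) ^ 2 ∂ν ≤ ∫ _o, v ⬝ᵥ v ∂ν := by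
        refine integral_mono_of_nonneg (.of_forall fun o => sq_nonneg _) (integrable_const _)
          (.of_forall fun o => ?_)
        exact (dotProduct_sq_le _ _).trans (mul_le_of_le_one_left h0 (hb o))
    _ = v ⬝ᵥ v := by simp

/-- One sample of the matrix Chernoff bound: adding `𝔼 ξ ξᵀ / 10 - ξ ξᵀ / 4` to the exponent does
not increase the expectation of the trace exponential. -/
lemma lintegral_trace_exp_le [DecidableEq ι] (hξ : Measurable ξ) (hb : ∀ o, ξ o ⬝ᵥ ξ o ≤ 1)
    {H : Matrix ι ι ℝ} (hH : Hᵀ = H) :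
    ∫⁻ o, ENNReal.ofReal (NormedSpace.exp (H + ((1 / 10 : ℝ) • secondMoment ν ξ -
        (1 / 4 : ℝ) • vecMulVec (ξ o) (ξ o)))).trace ∂ν ≤
      ENNReal.ofReal (NormedSpace.exp H).trace := by
  set E := secondMoment ν ξ with hE
  have hEt : Eᵀ = E := secondMoment_transpose ν ξ
  have hE0 : ∀ v, 0 ≤ v ⬝ᵥ E *ᵥ v := dotProduct_secondMoment_mulVec_nonneg hξ hb
  have hE1 : ∀ v, v ⬝ᵥ E *ᵥ v ≤ v ⬝ᵥ v := dotProduct_secondMoment_mulVec_le hξ hb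
  have hsymm (u v : ι → ℝ) : u ⬝ᵥ E *ᵥ v = E *ᵥ u ⬝ᵥ v := by
    rw [dotProduct_mulVec, ← mulVec_transpose, hEt]
  have hEE (v : ι → ℝ) : E *ᵥ v ⬝ᵥ E *ᵥ v ≤ v ⬝ᵥ E *ᵥ v := by
    have h1 := hE0 (v - E *ᵥ v)
    have h2 := hE1 (E *ᵥ v)
    rw [mulVec_sub, dotProduct_sub, sub_dotProduct, sub_dotProduct, hsymm v (E *ᵥ v)] at h1
    linarith
  -- The pointwise bound, with a right-hand side that is affine in `ξ ξᵀ`.  For `Y = c E - η ξ ξᵀ`,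
  -- `1 + Y + Y²` is at most `1 + (c + 2 c²) E - (η - 2 η²) ξ ξᵀ`, and `c + 2 c² ≤ η - 2 η²`.
  have key (o : O) : (NormedSpace.exp (H + ((1 / 10 : ℝ) • E -
      (1 / 4 : ℝ) • vecMulVec (ξ o) (ξ o)))).trace ≤
      (NormedSpace.exp H).trace + 12 / 100 * (NormedSpace.exp H * E).trace
        - 1 / 8 * (ξ o ⬝ᵥ NormedSpace.exp H *ᵥ ξ o) := by
    set x := ξ o with hx
    have hX : (vecMulVec x x)ᵀ = vecMulVec x x := by rw [transpose_vecMulVec]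
    set Y := (1 / 10 : ℝ) • E - (1 / 4 : ℝ) • vecMulVec x x with hY
    have hYt : Yᵀ = Y := by rw [hY, transpose_sub, transpose_smul, transpose_smul, hEt, hX]
    have hxv (v : ι → ℝ) : (x ⬝ᵥ v) ^ 2 ≤ v ⬝ᵥ v :=
      (dotProduct_sq_le _ _).trans (mul_le_of_le_one_left
        (Finset.sum_nonneg fun i _ => mul_self_nonneg _) (hb o))
    have hYv (v : ι → ℝ) : v ⬝ᵥ Y *ᵥ v = 1 / 10 * (v ⬝ᵥ E *ᵥ v) - 1 / 4 * (x ⬝ᵥ v) ^ 2 := by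
      rw [hY, sub_mulVec, smul_mulVec, smul_mulVec, dotProduct_sub, dotProduct_smul,
        dotProduct_smul, dotProduct_vecMulVec_mulVec, smul_eq_mul, smul_eq_mul]
    have hY1 (v : ι → ℝ) : |v ⬝ᵥ Y *ᵥ v| ≤ v ⬝ᵥ v := by
      have := hE0 v; have := hE1 v; have := hxv v; have := sq_nonneg (x ⬝ᵥ v)
      rw [hYv, abs_le]
      constructor <;> linarith
    have hYY (v : ι → ℝ) : v ⬝ᵥ (Y * Y) *ᵥ v ≤
        2 / 100 * (v ⬝ᵥ E *ᵥ v) + 1 / 8 * (x ⬝ᵥ v) ^ 2 := by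
      have e : v ⬝ᵥ (Y * Y) *ᵥ v = Y *ᵥ v ⬝ᵥ Y *ᵥ v := by
        rw [← mulVec_mulVec, dotProduct_mulVec, ← mulVec_transpose, hYt]
      have e2 : Y *ᵥ v = (1 / 10 : ℝ) • E *ᵥ v - ((1 / 4 : ℝ) * (x ⬝ᵥ v)) • x := by
        rw [hY, sub_mulVec, smul_mulVec, smul_mulVec, vecMulVec_mulVec]
        simp [smul_smul]
      have h1 := hEE v
      have h2 : 0 ≤ ((1 / 10 : ℝ) • E *ᵥ v + ((1 / 4 : ℝ) * (x ⬝ᵥ v)) • x) ⬝ᵥ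
          ((1 / 10 : ℝ) • E *ᵥ v + ((1 / 4 : ℝ) * (x ⬝ᵥ v)) • x) :=
        Finset.sum_nonneg fun i _ => mul_self_nonneg _
      have h3 : (x ⬝ᵥ v) ^ 2 * (x ⬝ᵥ x) ≤ (x ⬝ᵥ v) ^ 2 :=
        mul_le_of_le_one_right (sq_nonneg _) (hb o)
      rw [e, e2]
      simp only [add_dotProduct, dotProduct_add, sub_dotProduct, dotProduct_sub, smul_dotProduct,
        dotProduct_smul, smul_eq_mul] at h2 ⊢
      rw [dotProduct_comm (E *ᵥ v) x] at h2 ⊢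
      nlinarith
    calc (NormedSpace.exp (H + Y)).trace ≤ (NormedSpace.exp H * NormedSpace.exp Y).trace :=
          trace_exp_add_le hH hYt
      _ ≤ (NormedSpace.exp H * (1 + Y + Y * Y)).trace :=
          trace_exp_mul_mono hH (dotProduct_exp_mulVec_le hYt hY1)
      _ ≤ (NormedSpace.exp H * (1 + (12 / 100 : ℝ) • E - (1 / 8 : ℝ) • vecMulVec x x)).trace := by
          refine trace_exp_mul_mono hH fun v => ?_
          have := hYY v
          rw [add_mulVec, add_mulVec, dotProduct_add, dotProduct_add, hYv, sub_mulVec,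
            add_mulVec, dotProduct_sub, dotProduct_add, smul_mulVec, smul_mulVec,
            dotProduct_smul, dotProduct_smul, dotProduct_vecMulVec_mulVec, smul_eq_mul,
            smul_eq_mul]
          linarith
      _ = _ := by
          rw [Matrix.mul_sub, Matrix.mul_add, Matrix.mul_one, Matrix.mul_smul, Matrix.mul_smul,
            trace_sub, trace_add, trace_smul, trace_smul, trace_mul_vecMulVec, smul_eq_mul,
            smul_eq_mul]
  have hexp (B : Matrix ι ι ℝ) (hB : Bᵀ = B) : 0 ≤ (NormedSpace.exp B).trace := by
    cases isEmpty_or_nonempty ι with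
    | inl h => simp [Matrix.trace]
    | inr h => exact (trace_exp_pos hB).le
  have hint := integrable_dotProduct_mulVec (ν := ν) hξ hb (NormedSpace.exp H)
  have hint' : Integrable (fun o => (NormedSpace.exp H).trace +
      12 / 100 * (NormedSpace.exp H * E).trace - 1 / 8 * (ξ o ⬝ᵥ NormedSpace.exp H *ᵥ ξ o)) ν :=
    (integrable_const _).sub (hint.const_mul _)
  have hEpos : 0 ≤ (NormedSpace.exp H * E).trace := by
    rw [hE, ← integral_dotProduct_mulVec hξ hb]
    exact integral_nonneg fun o => dotProduct_exp_mulVec_nonneg hH _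
  calc _ ≤ ∫⁻ o, ENNReal.ofReal ((NormedSpace.exp H).trace +
        12 / 100 * (NormedSpace.exp H * E).trace
        - 1 / 8 * (ξ o ⬝ᵥ NormedSpace.exp H *ᵥ ξ o)) ∂ν :=
        lintegral_mono fun o => ENNReal.ofReal_le_ofReal (key o)
    _ = ENNReal.ofReal (∫ o, ((NormedSpace.exp H).trace +
        12 / 100 * (NormedSpace.exp H * E).trace
        - 1 / 8 * (ξ o ⬝ᵥ NormedSpace.exp H *ᵥ ξ o)) ∂ν) := by
        refine (ofReal_integral_eq_lintegral_ofReal hint' (.of_forall fun o => ?_)).symm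
        refine le_trans (hexp _ ?_) (key o)
        simp [hH, hEt, transpose_vecMulVec]
    _ ≤ _ := by
        refine ENNReal.ofReal_le_ofReal ?_
        rw [integral_sub (integrable_const _) (hint.const_mul _), integral_const_mul,
          integral_dotProduct_mulVec hξ hb, ← hE]
        simp
        linarith

end cov

end

/-- Integration over a product measure one coordinate at a time: if `f (insert i s)` integrated
over the `i`-th coordinate is at most `f s`, then the integral of `f univ` is at most `f ∅`. -/
lemma lintegral_pi_le_of_insert {κ : Type*} [Fintype κ] [DecidableEq κ] {O : κ → Type*}
    [∀ i, MeasurableSpace (O i)] (ν : ∀ i, Measure (O i)) [∀ i, SigmaFinite (ν i)]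
    (f : Finset κ → (∀ i, O i) → ℝ≥0∞) (hf : ∀ s, Measurable (f s))
    (h : ∀ s i, i ∉ s → ∀ o, ∫⁻ x, f (insert i s) (Function.update o i x) ∂ν i ≤ f s o)
    (o : ∀ i, O i) : ∫⁻ o, f Finset.univ o ∂Measure.pi ν ≤ f ∅ o := by
  have key (s : Finset κ) : (∫⋯∫⁻_s, f s ∂ν) ≤ f ∅ := by
    induction s using Finset.induction_on with
    | empty => simp
    | insert i s hi ih =>
      rw [lmarginal_insert' _ (hf _) hi]
      exact (lmarginal_mono fun o => h s i hi o).trans ih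
  have := key Finset.univ o
  rwa [lmarginal_univ] at this

/-! ### Regularized least squares: the self-normalized potential -/

section
variable {ι : Type*} [Fintype ι] [DecidableEq ι]

open Matrix

lemma dotProduct_mulVec_symm {A : Matrix ι ι ℝ} (hA : Aᵀ = A) (u v : ι → ℝ) :
    u ⬝ᵥ A *ᵥ v = v ⬝ᵥ A *ᵥ u := by
  rw [dotProduct_mulVec, ← mulVec_transpose, hA, dotProduct_comm]

/-- A real symmetric matrix that dominates the identity. -/
structure DominatesOne (A : Matrix ι ι ℝ) : Prop where
  symm : Aᵀ = A
  le : ∀ v : ι → ℝ, v ⬝ᵥ v ≤ v ⬝ᵥ A *ᵥ v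

lemma dominatesOne_add {A B : Matrix ι ι ℝ} (hA : DominatesOne A) (hB : Bᵀ = B)
    (hB0 : ∀ v, 0 ≤ v ⬝ᵥ B *ᵥ v) : DominatesOne (A + B) :=
  ⟨by rw [transpose_add, hA.symm, hB], fun v => by
    rw [add_mulVec, dotProduct_add]; linarith [hA.le v, hB0 v]⟩

lemma DominatesOne.add_vecMulVec {A : Matrix ι ι ℝ} (hA : DominatesOne A) (x : ι → ℝ) :
    DominatesOne (A + vecMulVec x x) :=
  dominatesOne_add hA (transpose_vecMulVec x x) fun v => by
    rw [dotProduct_vecMulVec_mulVec]; exact sq_nonneg _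

lemma DominatesOne.posDef {A : Matrix ι ι ℝ} (hA : DominatesOne A) : A.PosDef := by
  refine PosDef.of_dotProduct_mulVec_pos (isHermitian_of_transpose_eq hA.symm) fun {v} hv => ?_
  rw [star_trivial]
  have h : 0 < v ⬝ᵥ v := by
    obtain ⟨i, hi⟩ := Function.ne_iff.1 hv
    exact Finset.sum_pos' (fun i _ => mul_self_nonneg _)
      ⟨i, Finset.mem_univ i, mul_self_pos.2 hi⟩
  exact h.trans_le (hA.le v)

lemma DominatesOne.det_pos {A : Matrix ι ι ℝ} (hA : DominatesOne A) : 0 < A.det :=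
  hA.posDef.det_pos

lemma DominatesOne.mulVec_inv_mulVec {A : Matrix ι ι ℝ} (hA : DominatesOne A) (z : ι → ℝ) :
    A *ᵥ (A⁻¹ *ᵥ z) = z := by
  rw [mulVec_mulVec, mul_nonsing_inv _ hA.det_pos.ne'.isUnit, one_mulVec]

lemma DominatesOne.inv_transpose {A : Matrix ι ι ℝ} (hA : DominatesOne A) : A⁻¹ᵀ = A⁻¹ := by
  rw [transpose_nonsing_inv, hA.symm]

/-- Completing the square: the difference of the two sides is the quadratic form of `A` at
`u - A⁻¹ z`. -/
lemma DominatesOne.quadratic_eq {A : Matrix ι ι ℝ} (hA : DominatesOne A) (z u : ι → ℝ) :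
    u ⬝ᵥ A *ᵥ u - 2 * (z ⬝ᵥ u) = (u - A⁻¹ *ᵥ z) ⬝ᵥ A *ᵥ (u - A⁻¹ *ᵥ z) - z ⬝ᵥ A⁻¹ *ᵥ z := by
  rw [mulVec_sub, hA.mulVec_inv_mulVec, dotProduct_sub, sub_dotProduct, sub_dotProduct,
    dotProduct_mulVec_symm hA.symm (A⁻¹ *ᵥ z) u, hA.mulVec_inv_mulVec, dotProduct_comm u z,
    dotProduct_comm (A⁻¹ *ᵥ z) z]
  ring

lemma DominatesOne.dotProduct_mulVec_nonneg {A : Matrix ι ι ℝ} (hA : DominatesOne A)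
    (u : ι → ℝ) : 0 ≤ u ⬝ᵥ A *ᵥ u :=
  le_trans (Finset.sum_nonneg fun _ _ => mul_self_nonneg _) (hA.le u)

lemma DominatesOne.le_dotProduct_inv {A : Matrix ι ι ℝ} (hA : DominatesOne A) (z u : ι → ℝ) :
    2 * (z ⬝ᵥ u) - u ⬝ᵥ A *ᵥ u ≤ z ⬝ᵥ A⁻¹ *ᵥ z := by
  linarith [hA.quadratic_eq z u, hA.dotProduct_mulVec_nonneg (u - A⁻¹ *ᵥ z)]

lemma DominatesOne.dotProduct_inv_nonneg {A : Matrix ι ι ℝ} (hA : DominatesOne A) (z : ι → ℝ) :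
    0 ≤ z ⬝ᵥ A⁻¹ *ᵥ z := by
  simpa using hA.le_dotProduct_inv z 0

lemma DominatesOne.dotProduct_inv_add_le {A : Matrix ι ι ℝ} (hA : DominatesOne A)
    (x z : ι → ℝ) : z ⬝ᵥ (A + vecMulVec x x)⁻¹ *ᵥ z ≤ z ⬝ᵥ A⁻¹ *ᵥ z := by
  have hA' := hA.add_vecMulVec x
  set u := (A + vecMulVec x x)⁻¹ *ᵥ z with hu
  have h1 : u ⬝ᵥ (A + vecMulVec x x) *ᵥ u = z ⬝ᵥ u := by
    rw [hu, hA'.mulVec_inv_mulVec, dotProduct_comm]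
  have h2 := hA.le_dotProduct_inv z u
  rw [add_mulVec, dotProduct_add, dotProduct_vecMulVec_mulVec] at h1
  linarith [sq_nonneg (x ⬝ᵥ u)]

/-- The leverage of a new sample is at most the increment of the log-determinant. -/
lemma DominatesOne.log_det_add_le {A : Matrix ι ι ℝ} (hA : DominatesOne A) (x : ι → ℝ) :
    Real.log A.det + x ⬝ᵥ (A + vecMulVec x x)⁻¹ *ᵥ x ≤ Real.log (A + vecMulVec x x).det := by
  have hA' := hA.add_vecMulVec x
  set B := A + vecMulVec x x with hB
  have hdet : A.det = B.det * (1 - x ⬝ᵥ B⁻¹ *ᵥ x) := by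
    have e : A = B + replicateCol Unit (-x) * replicateRow Unit x := by
      rw [hB, ← vecMulVec_eq, neg_vecMulVec]; abel
    rw [e, det_add_replicateCol_mul_replicateRow hA'.det_pos.ne'.isUnit]
    congr 1
    rw [det_unique, Matrix.add_apply, Matrix.mul_assoc, Matrix.mul_apply']
    simp only [one_apply_eq, sub_eq_add_neg]
    congr 1
    rw [← dotProduct_neg, ← mulVec_neg]
    rfl
  have hpos : 0 < 1 - x ⬝ᵥ B⁻¹ *ᵥ x := by
    have := hA.det_pos
    rw [hdet] at this
    exact pos_of_mul_pos_right this hA'.det_pos.le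
  rw [hdet, Real.log_mul hA'.det_pos.ne' hpos.ne']
  linarith [Real.log_le_sub_one_of_pos hpos]

lemma DominatesOne.log_det_le {A : Matrix ι ι ℝ} (hA : DominatesOne A) {c : ℝ}
    (hc : ∀ v : ι → ℝ, v ⬝ᵥ A *ᵥ v ≤ c * (v ⬝ᵥ v)) :
    Real.log A.det ≤ Fintype.card ι * Real.log c := by
  obtain ⟨U, l, hU', hU, h0, -⟩ := exists_diagonalization hA.symm
  have hdet : A.det = ∏ i, l i := by
    rw [h0, det_mul, det_mul, mul_right_comm, ← det_mul, hU', det_one, one_mul, det_diagonal]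
  have hl (i : ι) : 1 ≤ l i ∧ l i ≤ c := by
    have e : Uᵀ *ᵥ (U *ᵥ Pi.single i 1) = Pi.single i 1 := by
      rw [mulVec_mulVec, hU, one_mulVec]
    have e1 : U *ᵥ Pi.single i 1 ⬝ᵥ A *ᵥ (U *ᵥ Pi.single i 1) = l i := by
      rw [h0, dotProduct_conj_diagonal, e]
      simp [Pi.single_apply, ite_pow]
    have e2 : U *ᵥ Pi.single i 1 ⬝ᵥ U *ᵥ Pi.single i 1 = 1 := by
      rw [dotProduct_self_conj hU', e]
      simp [Pi.single_apply, ite_pow]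
    have h1 := hA.le (U *ᵥ Pi.single i 1)
    have h2 := hc (U *ᵥ Pi.single i 1)
    rw [e1, e2] at h1 h2
    exact ⟨h1, by linarith⟩
  rw [hdet, Real.log_prod fun i _ => (by linarith [(hl i).1] : l i ≠ 0)]
  calc ∑ i, Real.log (l i) ≤ ∑ _i : ι, Real.log c :=
        Finset.sum_le_sum fun i _ => Real.log_le_log (by linarith [(hl i).1]) (hl i).2
    _ = _ := by simp

/-- The self-normalized potential `zᵀ A⁻¹ z - log det A`, shifted by a constant `D`.  Here `A` is
the regularized Gram matrix, and `z` is the noise of the normal equations. -/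
def ridgePotential (D : ℝ) (A : Matrix ι ι ℝ) (z : ι → ℝ) : ℝ :=
  z ⬝ᵥ A⁻¹ *ᵥ z + (D - Real.log A.det)

/-- A new sample does not increase the expectation of the self-normalized potential. -/
lemma lintegral_ridgePotential_le {R : Type*} [MeasurableSpace R] {κ : Measure R}
    [IsProbabilityMeasure κ] {ε : R → ℝ} (hε : Measurable ε) (hε1 : ∀ᵐ r ∂κ, |ε r| ≤ 1)
    (hε0 : ∫ r, ε r ∂κ = 0) {A : Matrix ι ι ℝ} (hA : DominatesOne A) (x z : ι → ℝ) {D : ℝ}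
    (hD : Real.log (A + vecMulVec x x).det ≤ D) :
    ∫⁻ r, ENNReal.ofReal (ridgePotential D (A + vecMulVec x x) (z + ε r • x)) ∂κ ≤
      ENNReal.ofReal (ridgePotential D A z) := by
  have hA' := hA.add_vecMulVec x
  set B := A + vecMulVec x x with hB
  set h := x ⬝ᵥ B⁻¹ *ᵥ x with hh
  have hh0 : 0 ≤ h := hA'.dotProduct_inv_nonneg x
  have hexp (r : R) : ridgePotential D B (z + ε r • x) =
      (z ⬝ᵥ B⁻¹ *ᵥ z + (D - Real.log B.det)) + 2 * (x ⬝ᵥ B⁻¹ *ᵥ z) * ε r + h * ε r ^ 2 := by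
    rw [ridgePotential, mulVec_add, mulVec_smul, dotProduct_add, add_dotProduct, add_dotProduct,
      smul_dotProduct, smul_dotProduct, dotProduct_smul, dotProduct_smul,
      dotProduct_mulVec_symm hA'.inv_transpose z x]
    simp only [smul_eq_mul]
    ring
  have hεi : Integrable ε κ := Integrable.of_bound (C := 1) hε.aestronglyMeasurable
    (hε1.mono fun r hr => by rwa [Real.norm_eq_abs])
  calc _ ≤ ∫⁻ r, ENNReal.ofReal ((z ⬝ᵥ B⁻¹ *ᵥ z + (D - Real.log B.det)) + h +
        2 * (x ⬝ᵥ B⁻¹ *ᵥ z) * ε r) ∂κ := by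
        refine lintegral_mono_ae (hε1.mono fun r hr => ENNReal.ofReal_le_ofReal ?_)
        rw [hexp]
        have : ε r ^ 2 ≤ 1 := by rw [← sq_abs]; exact pow_le_one₀ (abs_nonneg _) hr
        nlinarith
    _ = ENNReal.ofReal (∫ r, ((z ⬝ᵥ B⁻¹ *ᵥ z + (D - Real.log B.det)) + h +
        2 * (x ⬝ᵥ B⁻¹ *ᵥ z) * ε r) ∂κ) := by
        refine (ofReal_integral_eq_lintegral_ofReal ((integrable_const _).add (hεi.const_mul _))
          (hε1.mono fun r hr => ?_)).symm
        have h1 := hexp r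
        have h2 : 0 ≤ ridgePotential D B (z + ε r • x) :=
          add_nonneg (hA'.dotProduct_inv_nonneg _) (by linarith)
        have : ε r ^ 2 ≤ 1 := by rw [← sq_abs]; exact pow_le_one₀ (abs_nonneg _) hr
        simp only [Pi.zero_apply, Pi.add_apply]
        nlinarith
    _ ≤ _ := by
        refine ENNReal.ofReal_le_ofReal ?_
        rw [integral_add (integrable_const _) (hεi.const_mul _), integral_const_mul, hε0,
          ridgePotential]
        have h1 := hA.log_det_add_le x
        have h2 := hA.dotProduct_inv_add_le x z
        simp
        linarith

end

/-! ### The reformulated ridge regression problem and the distributed protocol -/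

lemma hasGradientAt_of_quadratic {H : Type*} [NormedAddCommGroup H] [InnerProductSpace ℝ H]
    [CompleteSpace H] {f : H → ℝ} {g w : H} {C : ℝ}
    (h : ∀ z, |f z - f w - inner ℝ g (z - w)| ≤ C * ‖z - w‖ ^ 2) : HasGradientAt f g w := by
  rw [hasGradientAt_iff_isLittleO]
  have h1 : (fun z => f z - f w - inner ℝ g (z - w)) =O[nhds w] fun z => ‖z - w‖ ^ 2 :=
    Asymptotics.IsBigO.of_bound C (.of_forall fun z => by
      rw [Real.norm_eq_abs, Real.norm_of_nonneg (by positivity)]; exact h z)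
  exact h1.trans_isLittleO (Asymptotics.isLittleO_pow_sub_sub w one_lt_two)

namespace Env

variable {M K d : ℕ} {b : Fin M → ℕ} {X : Fin M → Type*} [∀ m, MeasurableSpace (X m)]

lemma view_featTilde (env : Env M K d b X) (m : Fin M) (x : X m) (a : Fin K) :
    view m (env.featTilde m x a) = env.φ m x a := by
  ext c
  rcases c with i | j <;> simp [view, featTilde]

lemma inner_featTilde (env : Env M K d b X) (m : Fin M) (x : X m) (a : Fin K)
    (w : EuclideanSpace ℝ (Coord d b)) :
    inner ℝ w (env.featTilde m x a) = ∑ c, view m w c * env.φ m x a c := by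
  rw [PiLp.inner_apply, Fintype.sum_sum_type, Fintype.sum_sum_type, Fintype.sum_sigma]
  congr 1
  · exact Finset.sum_congr rfl fun i _ => by simp [view, featTilde, mul_comm]
  · rw [Finset.sum_eq_single m]
    · exact Finset.sum_congr rfl fun i _ => by simp [view, featTilde, mul_comm]
    · intro m' _ hm'
      exact Finset.sum_eq_zero fun i _ => by simp [featTilde, hm']
    · simp

lemma norm_featTilde_le (env : Env M K d b X) (m : Fin M) (x : X m) (a : Fin K) :
    ‖env.featTilde m x a‖ ≤ 1 := by
  have h := inner_featTilde env m x a (env.featTilde m x a)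
  rw [view_featTilde, real_inner_self_eq_norm_sq] at h
  have h2 : ‖env.φ m x a‖ ^ 2 = ∑ c, env.φ m x a c * env.φ m x a c := by
    rw [EuclideanSpace.real_norm_sq_eq]
    exact Finset.sum_congr rfl fun c _ => sq _
  rw [← h2] at h
  have := env.φ_norm m x a
  nlinarith [norm_nonneg (env.featTilde m x a), norm_nonneg (env.φ m x a)]

/-- The true parameter of the reformulated problem. -/
def trueParam (env : Env M K d b X) : EuclideanSpace ℝ (Coord d b) :=
  WithLp.toLp 2 (Sum.elim
    (fun i => if h : 0 < M then env.θ ⟨0, h⟩ (Sum.inl i) else 0)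
    (fun p => env.θ p.1 (Sum.inr p.2)))

lemma view_trueParam (env : Env M K d b X) (m : Fin M) : view m env.trueParam = env.θ m := by
  ext c
  rcases c with i | j
  · have hM : 0 < M := m.pos
    simp [view, trueParam, hM, env.θ_shared ⟨0, hM⟩ m i]
  · simp [view, trueParam]

lemma inner_trueParam (env : Env M K d b X) (m : Fin M) (x : X m) (a : Fin K) :
    inner ℝ env.trueParam (env.featTilde m x a) = env.mean m x a := by
  rw [inner_featTilde, view_trueParam, mean, env.realizable, PiLp.inner_apply]
  exact Finset.sum_congr rfl fun c _ => by simp [mul_comm]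

lemma card_coord : Fintype.card (Coord d b) = dTilde d b := by simp [dTilde]

lemma norm_trueParam_sq_le (env : Env M K d b X) : ‖env.trueParam‖ ^ 2 ≤ dTilde d b := by
  have hθ (m : Fin M) (c : Fin d ⊕ Fin (b m)) : env.θ m c ^ 2 ≤ 1 := by
    have h1 : ‖env.θ m c‖ ≤ ‖env.θ m‖ := PiLp.norm_apply_le _ _
    have h2 := h1.trans (env.θ_norm m)
    rw [← sq_abs]
    exact pow_le_one₀ (abs_nonneg _) h2
  rw [EuclideanSpace.real_norm_sq_eq, ← card_coord]
  calc ∑ c, env.trueParam c ^ 2 ≤ ∑ _c : Coord d b, (1 : ℝ) := by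
        refine Finset.sum_le_sum fun c _ => ?_
        rcases c with i | p
        · simp only [trueParam, Sum.elim_inl]
          split_ifs
          · exact hθ _ _
          · norm_num
        · exact hθ _ _
    _ = _ := by simp

/-- The gradient of the ridge regression objective. -/
def ridgeGrad (env : Env M K d b X) {E : ℕ} (lam : ℝ) (S : Data K E X)
    (w : EuclideanSpace ℝ (Coord d b)) : EuclideanSpace ℝ (Coord d b) :=
  ∑ m, (2 / ((M * E : ℕ) : ℝ)) •
      ∑ i, (inner ℝ w (env.featTilde m (S m i).1 (S m i).2.1) - (S m i).2.2) •
        env.featTilde m (S m i).1 (S m i).2.1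
    + (2 * lam) • w

/-- The quadratic part of the ridge regression objective. -/
def ridgeQuad (env : Env M K d b X) {E : ℕ} (lam : ℝ) (S : Data K E X)
    (w : EuclideanSpace ℝ (Coord d b)) : ℝ :=
  ∑ m, (1 / ((M * E : ℕ) : ℝ)) *
      ∑ i, (inner ℝ w (env.featTilde m (S m i).1 (S m i).2.1)) ^ 2 + lam * ‖w‖ ^ 2

lemma ridgeLoss_expand (env : Env M K d b X) {E : ℕ} (lam : ℝ) (S : Data K E X)
    (w z : EuclideanSpace ℝ (Coord d b)) :
    env.ridgeLoss lam S z = env.ridgeLoss lam S w + inner ℝ (env.ridgeGrad lam S w) (z - w)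
      + env.ridgeQuad lam S (z - w) := by
  obtain ⟨δ, rfl⟩ : ∃ δ, z = w + δ := ⟨z - w, by abel⟩
  have hn : ‖w + δ‖ ^ 2 = ‖w‖ ^ 2 + 2 * inner ℝ w δ + ‖δ‖ ^ 2 := norm_add_sq_real w δ
  simp only [ridgeLoss, ridgeGrad, ridgeQuad, add_sub_cancel_left, inner_add_left, sum_inner,
    inner_smul_left, hn, conj_trivial]
  have h (m : Fin M) : (1 / ((M * E : ℕ) : ℝ)) * ∑ i,
      (inner ℝ w (env.featTilde m (S m i).1 (S m i).2.1)
        + inner ℝ δ (env.featTilde m (S m i).1 (S m i).2.1) - (S m i).2.2) ^ 2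
      = (1 / ((M * E : ℕ) : ℝ)) * ∑ i,
        (inner ℝ w (env.featTilde m (S m i).1 (S m i).2.1) - (S m i).2.2) ^ 2
      + 2 / ((M * E : ℕ) : ℝ) * ∑ i,
        (inner ℝ w (env.featTilde m (S m i).1 (S m i).2.1) - (S m i).2.2) *
          inner ℝ (env.featTilde m (S m i).1 (S m i).2.1) δ
      + (1 / ((M * E : ℕ) : ℝ)) * ∑ i,
        (inner ℝ δ (env.featTilde m (S m i).1 (S m i).2.1)) ^ 2 := by
    simp only [Finset.mul_sum, ← Finset.sum_add_distrib]
    refine Finset.sum_congr rfl fun i _ => ?_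
    rw [real_inner_comm δ]
    ring
  rw [Finset.sum_congr rfl fun m _ => h m, Finset.sum_add_distrib, Finset.sum_add_distrib]
  ring

lemma ridgeQuad_le (env : Env M K d b X) {E : ℕ} (lam : ℝ) (S : Data K E X)
    (w : EuclideanSpace ℝ (Coord d b)) : env.ridgeQuad lam S w ≤ (1 + lam) * ‖w‖ ^ 2 := by
  have h1 (m : Fin M) (i : Fin E) :
      (inner ℝ w (env.featTilde m (S m i).1 (S m i).2.1)) ^ 2 ≤ ‖w‖ ^ 2 := by
    rw [← sq_abs]
    refine pow_le_pow_left₀ (abs_nonneg _) ((abs_real_inner_le_norm _ _).trans ?_) 2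
    exact mul_le_of_le_one_right (norm_nonneg _) (env.norm_featTilde_le _ _ _)
  have h2 : ∑ m : Fin M, (1 / ((M * E : ℕ) : ℝ)) *
      ∑ i : Fin E, (inner ℝ w (env.featTilde m (S m i).1 (S m i).2.1)) ^ 2 ≤ ‖w‖ ^ 2 := by
    calc _ ≤ ∑ _m : Fin M, (1 / ((M * E : ℕ) : ℝ)) * ∑ _i : Fin E, ‖w‖ ^ 2 := by
          refine Finset.sum_le_sum fun m _ => mul_le_mul_of_nonneg_left
            (Finset.sum_le_sum fun i _ => h1 m i) (by positivity)
      _ = (M * E : ℕ) * (1 / ((M * E : ℕ) : ℝ)) * ‖w‖ ^ 2 := by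
          simp; ring
      _ ≤ 1 * ‖w‖ ^ 2 := by
          gcongr
          rw [mul_one_div]
          exact div_self_le_one _
      _ = _ := one_mul _
  unfold ridgeQuad
  linarith

lemma le_ridgeQuad (env : Env M K d b X) {E : ℕ} (lam : ℝ) (S : Data K E X)
    (w : EuclideanSpace ℝ (Coord d b)) : lam * ‖w‖ ^ 2 ≤ env.ridgeQuad lam S w := by
  unfold ridgeQuad
  have : 0 ≤ ∑ m : Fin M, (1 / ((M * E : ℕ) : ℝ)) *
      ∑ i : Fin E, (inner ℝ w (env.featTilde m (S m i).1 (S m i).2.1)) ^ 2 := by positivity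
  linarith

lemma gradient_ridgeLoss (env : Env M K d b X) {E : ℕ} {lam : ℝ} (hlam : 0 ≤ lam)
    (S : Data K E X) (w : EuclideanSpace ℝ (Coord d b)) :
    gradient (env.ridgeLoss lam S) w = env.ridgeGrad lam S w := by
  refine (hasGradientAt_of_quadratic (C := 1 + lam) fun z => ?_).gradient
  have h1 := env.ridgeQuad_le lam S (z - w)
  have h2 := env.le_ridgeQuad lam S (z - w)
  have h3 : 0 ≤ lam * ‖z - w‖ ^ 2 := by positivity
  rw [env.ridgeLoss_expand lam S w z, abs_le]
  constructor <;> nlinarith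

lemma reg_nonneg (M E : ℕ) : 0 ≤ reg M E := by unfold reg; positivity

lemma smooth_pos (M E : ℕ) : 0 < smooth M E := by
  have := reg_nonneg M E
  unfold smooth
  linarith

lemma view_add (m : Fin M) (v w : EuclideanSpace ℝ (Coord d b)) (c : Fin d ⊕ Fin (b m)) :
    view m (v + w) c = view m v c + view m w c := by
  rcases c with i | j <;> simp [view]

lemma view_smul (m : Fin M) (r : ℝ) (w : EuclideanSpace ℝ (Coord d b)) (c : Fin d ⊕ Fin (b m)) :
    view m (r • w) c = r * view m w c := by
  rcases c with i | j <;> simp [view]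

lemma view_sub (m : Fin M) (v w : EuclideanSpace ℝ (Coord d b)) (c : Fin d ⊕ Fin (b m)) :
    view m (v - w) c = view m v c - view m w c := by
  rcases c with i | j <;> simp [view]

/-- The coordinates of the gradient that agent `m` stores: for the shared coordinates the local
gradients of all agents are added up, for her own ones her local gradient suffices. -/
lemma view_ridgeGrad (env : Env M K d b X) {E : ℕ} (lam : ℝ) (S : Data K E X)
    (w : EuclideanSpace ℝ (Coord d b)) (m : Fin M) (c : Fin d ⊕ Fin (b m)) :
    view m (env.ridgeGrad lam S w) c =
      Sum.elim (fun i => ∑ m', env.localGrad S m' (view m' w) (Sum.inl i))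
        (fun j => env.localGrad S m (view m w) (Sum.inr j)) c + 2 * lam * view m w c := by
  rw [ridgeGrad, view_add, view_smul]
  congr 1
  rcases c with i | j
  · simp only [view, localGrad, inner_featTilde, Sum.elim_inl, WithLp.ofLp_sum, Finset.sum_apply]
    simp [featTilde]
  · simp only [view, localGrad, inner_featTilde, Sum.elim_inr, WithLp.ofLp_sum, Finset.sum_apply]
    rw [Finset.sum_eq_single m]
    · simp [featTilde]
    · intro m' _ hm'
      simp [featTilde, Ne.symm hm']
    · simp

/-- After every round, the agents store the blocks of the iterates of accelerated gradient
descent on the reformulated problem. -/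
lemma protocol_eq_view (env : Env M K d b X) {E : ℕ} (S : Data K E X) (k : ℕ) (m : Fin M) :
    (env.protocol S k).x m =
        view m (agd (smooth M E) (invCond M E) (env.ridgeLoss (reg M E) S) k).1 ∧
      (env.protocol S k).y m =
        view m (agd (smooth M E) (invCond M E) (env.ridgeLoss (reg M E) S) k).2 := by
  induction k generalizing m with
  | zero =>
    constructor <;>
    · ext c
      rcases c with i | j <;> simp [protocol, agd, view]
  | succ k ih =>
    set w := agd (smooth M E) (invCond M E) (env.ridgeLoss (reg M E) S) k with hw
    have hstep (c : Fin d ⊕ Fin (b m)) :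
        env.agentStep S m ((env.protocol S k).y m) (env.broadcast S (env.protocol S k)) c =
          view m (w.2 - (1 / smooth M E) • gradient (env.ridgeLoss (reg M E) S) w.2) c := by
      rw [gradient_ridgeLoss env (reg_nonneg M E), view_sub, view_smul, view_ridgeGrad,
        agentStep, (ih m).2]
      congr 3
      rcases c with i | j
      · simp only [Sum.elim_inl, broadcast, uplink]
        exact Finset.sum_congr rfl fun m' _ => by rw [(ih m').2]
      · rfl
    constructor
    · ext c
      exact hstep c
    · ext c
      have e : (agd (smooth M E) (invCond M E) (env.ridgeLoss (reg M E) S) (k + 1)).2 =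
          (w.2 - (1 / smooth M E) • gradient (env.ridgeLoss (reg M E) S) w.2) +
          momentum (invCond M E) k •
            ((w.2 - (1 / smooth M E) • gradient (env.ridgeLoss (reg M E) S) w.2) - w.1) := rfl
      rw [e, view_add, view_smul, view_sub m _ w.1, ← hstep, ← (ih m).1]
      rfl

/-! ### The communication cost -/

lemma protocol_sent (env : Env M K d b X) {E : ℕ} (S : Data K E X) (k : ℕ) :
    (env.protocol S k).sent = k * (2 * M * d) := by
  induction k with
  | zero => simp [protocol]
  | succ k ih =>
    simp only [protocol, ih]
    simp
    ring

lemma epochLen_le (l : ℕ) : epochLen l ≤ 2 ^ l := by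
  refine (Nat.sub_le _ _).trans ?_
  unfold τ
  split_ifs
  · exact Nat.zero_le _
  · exact le_rfl

lemma sum_sqrt_two_pow_le (n : ℕ) :
    ∑ l ∈ Finset.Icc 1 n, √((2 : ℝ) ^ l) ≤ 4 * √((2 : ℝ) ^ n) := by
  induction n with
  | zero => simp
  | succ n ih =>
    rw [Finset.sum_Icc_succ_top (by omega)]
    have h : √((2 : ℝ) ^ (n + 1)) = √((2 : ℝ) ^ n) * √2 := by
      rw [pow_succ, Real.sqrt_mul (by positivity)]
    have h2 : (4 / 3 : ℝ) ≤ √2 := Real.le_sqrt_of_sq_le (by norm_num)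
    rw [h] at *
    nlinarith [Real.sqrt_nonneg ((2 : ℝ) ^ n)]

lemma totalSent_le (env : Env M K d b X) {cρ : ℝ} (hρ : 0 < cρ) (hM : 1 ≤ M) (T : ℕ)
    (s : ℕ → Step K X) :
    (env.totalSent cρ T s : ℝ) ≤
      (8 * cρ + 16) * d * Real.log ((max d 2 : ℕ) : ℝ) * √((M : ℝ) ^ 3 * T) := by
  rcases Nat.eq_zero_or_pos T with rfl | hT
  · simp [totalSent]
  set Ld := Real.log ((max d 2 : ℕ) : ℝ) with hLd
  have hL : 1 / 2 ≤ Ld := by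
    have h1 : Real.log 2 ≤ Ld := Real.log_le_log (by norm_num) (by exact_mod_cast le_max_right d 2)
    linarith [Real.log_two_gt_d9]
  have hM' : (1 : ℝ) ≤ M := by exact_mod_cast hM
  have hpow : (2 : ℝ) ^ Nat.log 2 T ≤ T := by exact_mod_cast Nat.pow_log_le_self 2 hT.ne'
  have hrounds (l : ℕ) : (rounds M d cρ l : ℝ) ≤ (cρ + 2) * Ld * (√M * √((2 : ℝ) ^ l)) := by
    have h1 : √((M * epochLen l : ℕ) : ℝ) ≤ √M * √((2 : ℝ) ^ l) := by
      rw [← Real.sqrt_mul (by positivity)]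
      refine Real.sqrt_le_sqrt ?_
      push_cast
      gcongr
      exact_mod_cast epochLen_le l
    have h2 : (1 : ℝ) ≤ √M * √((2 : ℝ) ^ l) := by
      rw [← Real.sqrt_mul (by positivity), Real.one_le_sqrt]
      exact one_le_mul_of_one_le_of_one_le hM' (one_le_pow₀ (by norm_num))
    have h3 := (Nat.ceil_lt_add_one (a := cρ * √((M * epochLen l : ℕ) : ℝ) * Ld)
      (by positivity)).le
    have h4 : cρ * √((M * epochLen l : ℕ) : ℝ) * Ld ≤ cρ * (√M * √((2 : ℝ) ^ l)) * Ld := by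
      gcongr
    have h5 : 1 ≤ 2 * Ld * (√M * √((2 : ℝ) ^ l)) := by nlinarith
    unfold rounds
    rw [← hLd]
    nlinarith
  have hsum : (env.totalSent cρ T s : ℝ) ≤
      ∑ l ∈ Finset.Icc 1 (Nat.log 2 T), (cρ + 2) * Ld * √M * (2 * M * d) * √((2 : ℝ) ^ l) := by
    unfold totalSent
    push_cast [protocol_sent]
    refine Finset.sum_le_sum fun l _ => ?_
    calc _ ≤ (cρ + 2) * Ld * (√M * √((2 : ℝ) ^ l)) * (2 * M * d) := by
          gcongr
          exact hrounds l
      _ = _ := by ring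
  refine hsum.trans ?_
  rw [← Finset.mul_sum]
  have hsq : √((M : ℝ) ^ 3 * T) = M * √M * √T := by
    rw [Real.sqrt_mul (by positivity), pow_succ, Real.sqrt_mul (by positivity),
      Real.sqrt_sq (by positivity)]
  rw [hsq]
  calc _ ≤ (cρ + 2) * Ld * √M * (2 * M * d) * (4 * √((2 : ℝ) ^ Nat.log 2 T)) := by
        gcongr
        exact sum_sqrt_two_pow_le _
    _ ≤ (cρ + 2) * Ld * √M * (2 * M * d) * (4 * √T) := by gcongr
    _ = _ := by ring

end Env

/-! ### Inverse gap weighting -/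

section
variable {K : ℕ} {sel : (Fin K → ℝ) → Fin K}

lemma igw_le_inv_mul (hsel : ∀ (v : Fin K → ℝ) (a : Fin K), v a ≤ v (sel v))
    {γ : ℝ} (hγ : 0 ≤ γ) (v : Fin K → ℝ)
    (a : Fin K) : 1 ≤ igw sel γ v a * (K + γ * (v (sel v) - v a)) := by
  have hK : (0 : ℝ) < K := by exact_mod_cast a.pos
  have hg (a' : Fin K) : 0 ≤ γ * (v (sel v) - v a') := mul_nonneg hγ (sub_nonneg.2 (hsel v a'))
  unfold igw
  split_ifs with h
  · rw [h, sub_self, mul_zero, add_zero]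
    have h1 : ∑ a' ∈ Finset.univ.erase (sel v), 1 / (K + γ * (v (sel v) - v a')) ≤
        ∑ _a' ∈ Finset.univ.erase (sel v), 1 / (K : ℝ) :=
      Finset.sum_le_sum fun a' _ => one_div_le_one_div_of_le hK (by linarith [hg a'])
    rw [Finset.sum_const, Finset.card_erase_of_mem (Finset.mem_univ _), Finset.card_univ,
      Fintype.card_fin, nsmul_eq_mul, Nat.cast_sub (by exact_mod_cast a.pos)] at h1
    push_cast at h1
    have h2 : ((K : ℝ) - 1) * (1 / K) = 1 - 1 / K := by field_simp
    have h3 : (1 : ℝ) / K * K = 1 := by field_simp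
    nlinarith
  · rw [one_div_mul_cancel (by linarith [hg a])]

lemma igw_pos (hsel : ∀ (v : Fin K → ℝ) (a : Fin K), v a ≤ v (sel v))
    {γ : ℝ} (hγ : 0 ≤ γ) (v : Fin K → ℝ)
    (a : Fin K) : 0 < igw sel γ v a := by
  have hK : (0 : ℝ) < K := by exact_mod_cast a.pos
  have h := igw_le_inv_mul hsel hγ v a
  have hg : 0 ≤ γ * (v (sel v) - v a) := mul_nonneg hγ (sub_nonneg.2 (hsel v a))
  by_contra! hn
  nlinarith [mul_nonneg_of_nonpos_of_nonpos hn (by linarith : -(K + γ * (v (sel v) - v a)) ≤ 0)]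

lemma sum_igw (γ : ℝ) (v : Fin K → ℝ) : ∑ a, igw sel γ v a = 1 := by
  rw [← Finset.add_sum_erase _ _ (Finset.mem_univ (sel v))]
  have h : ∑ a ∈ Finset.univ.erase (sel v), igw sel γ v a =
      ∑ a ∈ Finset.univ.erase (sel v), 1 / (K + γ * (v (sel v) - v a)) :=
    Finset.sum_congr rfl fun a ha => by rw [igw, if_neg (Finset.ne_of_mem_erase ha)]
  rw [h, igw, if_pos rfl]
  ring

/-- The estimated regret of inverse gap weighting is at most `K / γ`. -/
lemma sum_igw_mul_gap_le (hsel : ∀ (v : Fin K → ℝ) (a : Fin K), v a ≤ v (sel v))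
    {γ : ℝ} (hγ : 0 ≤ γ)
    (v : Fin K → ℝ) : ∑ a, igw sel γ v a * (γ * (v (sel v) - v a)) ≤ K := by
  calc ∑ a, igw sel γ v a * (γ * (v (sel v) - v a)) ≤ ∑ _a : Fin K, (1 : ℝ) := by
        refine Finset.sum_le_sum fun a _ => ?_
        have hK : (0 : ℝ) < K := by exact_mod_cast a.pos
        have hg : 0 ≤ γ * (v (sel v) - v a) := mul_nonneg hγ (sub_nonneg.2 (hsel v a))
        unfold igw
        split_ifs with h
        · rw [h]; simp
        · rw [one_div_mul_eq_div, div_le_one (by linarith)]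
          linarith
    _ = K := by simp

/-- One epoch of the comparison of true and estimated regret.  If the estimated regret of every
action under `f` is controlled by its true regret, then the same holds, in both directions, for
any new estimate `f'`, with an error that involves the mean squared error of `f'` under inverse
gap weighting with `f`.  Everything is multiplied by the learning rates. -/
lemma igw_transfer (hsel : ∀ (v : Fin K → ℝ) (a : Fin K), v a ≤ v (sel v))
    {γ γ' B : ℝ} (hγ : 0 ≤ γ) (hγ' : γ ≤ γ')
    {μ f : Fin K → ℝ} (f' : Fin K → ℝ) (hB : 0 ≤ B)
    (h : ∀ a, γ * (f (sel f) - f a) ≤ 2 * (γ * ((⨆ a, μ a) - μ a)) + B) (a : Fin K) :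
    γ' * (f' (sel f') - f' a) ≤ 2 * (γ' * ((⨆ a, μ a) - μ a)) +
        (B / 2 + K / 2 + 8 * γ' ^ 2 * ∑ a, igw sel γ f a * (f' a - μ a) ^ 2) ∧
      γ' * ((⨆ a, μ a) - μ a) ≤ 2 * (γ' * (f' (sel f') - f' a)) +
        (B / 2 + K / 2 + 8 * γ' ^ 2 * ∑ a, igw sel γ f a * (f' a - μ a) ^ 2) := by
  have : Nonempty (Fin K) := ⟨a⟩
  obtain ⟨b, hb⟩ := exists_eq_ciSup_of_finite (f := μ)
  rw [← hb] at h ⊢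
  have hμ (a : Fin K) : μ a ≤ μ b := hb ▸ le_ciSup (Finite.bddAbove_range μ) a
  have hγ'0 : 0 ≤ γ' := hγ.trans hγ'
  set W := ∑ a, igw sel γ f a * (f' a - μ a) ^ 2 with hW
  have he (a : Fin K) : γ' * |f' a - μ a| ≤
      γ' * (μ b - μ a) / 4 + (K / 8 + B / 8 + 2 * γ' ^ 2 * W) := by
    set p := igw sel γ f a with hp
    have hp0 : 0 < p := igw_pos hsel hγ f a
    have h1 : 1 ≤ p * (K + γ * (f (sel f) - f a)) := igw_le_inv_mul hsel hγ f a
    have h2 : p * (f' a - μ a) ^ 2 ≤ W :=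
      Finset.single_le_sum (f := fun a => igw sel γ f a * (f' a - μ a) ^ 2)
        (fun a _ => mul_nonneg (igw_pos hsel hγ f a).le (sq_nonneg _)) (Finset.mem_univ a)
    have h3 : 1 / p ≤ K + γ * (f (sel f) - f a) := by
      rw [div_le_iff₀ hp0]; linarith
    -- the arithmetic-geometric mean inequality
    have h4 : γ' * |f' a - μ a| ≤ 1 / p / 8 + 2 * γ' ^ 2 * (p * (f' a - μ a) ^ 2) := by
      rw [← sq_abs (f' a - μ a)]
      have h5 : 1 / p / 8 + 2 * γ' ^ 2 * (p * |f' a - μ a| ^ 2) - γ' * |f' a - μ a| =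
          (1 / (8 * p)) * (1 - 4 * γ' * p * |f' a - μ a|) ^ 2 := by
        field_simp; ring
      have h6 : 0 ≤ (1 / (8 * p)) * (1 - 4 * γ' * p * |f' a - μ a|) ^ 2 := by positivity
      linarith
    have h7 : 2 * γ' ^ 2 * (p * (f' a - μ a) ^ 2) ≤ 2 * γ' ^ 2 * W := by gcongr
    have h8 := h a
    have h9 : γ * (μ b - μ a) ≤ γ' * (μ b - μ a) :=
      mul_le_mul_of_nonneg_right hγ' (sub_nonneg.2 (hμ a))
    linarith
  have he1 (a : Fin K) := mul_le_mul_of_nonneg_left (le_abs_self (f' a - μ a)) hγ'0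
  have he2 (a : Fin K) := mul_le_mul_of_nonneg_left (neg_abs_le (f' a - μ a)) hγ'0
  have hs := mul_le_mul_of_nonneg_left (hsel f' a) hγ'0
  have hs' := mul_le_mul_of_nonneg_left (hsel f' b) hγ'0
  have hma := mul_le_mul_of_nonneg_left (hμ a) hγ'0
  have hms := mul_le_mul_of_nonneg_left (hμ (sel f')) hγ'0
  have hea := he a
  have heb := he b
  have hes := he (sel f')
  have e1a := he1 a
  have e1s := he1 (sel f')
  have e2a := he2 a
  have e2b := he2 b
  have hR : 0 ≤ K / 8 + B / 8 + 2 * γ' ^ 2 * W := by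
    have : 0 ≤ W := Finset.sum_nonneg fun a _ =>
      mul_nonneg (igw_pos hsel hγ f a).le (sq_nonneg _)
    positivity
  rw [sub_self, mul_zero, zero_div, zero_add] at heb
  constructor <;> linarith

end

/-! ### Measurability -/

section
variable {ι : Type*} [Fintype ι] [DecidableEq ι] {Ω : Type*} [MeasurableSpace Ω]

open Matrix

lemma measurable_of_continuous_matrix {g : Matrix ι ι ℝ → ℝ} (hg : Continuous g)
    {A : Ω → Matrix ι ι ℝ} (hA : ∀ i j, Measurable fun ω => A ω i j) :
    Measurable fun ω => g (A ω) := by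
  have h : Continuous (fun B : ι → ι → ℝ => g (Matrix.of B)) := hg
  exact h.measurable.comp
    (measurable_pi_lambda _ fun i => measurable_pi_lambda _ fun j => hA i j)

open scoped Matrix.Norms.Operator in
lemma continuous_trace_exp :
    Continuous fun B : Matrix ι ι ℝ => (NormedSpace.exp B).trace := by
  let : NormedAlgebra ℚ (Matrix ι ι ℝ) := .restrictScalars ℚ ℝ _
  exact (NormedSpace.exp_continuous (𝔸 := Matrix ι ι ℝ)).matrix_trace

lemma measurable_inv_apply {A : Ω → Matrix ι ι ℝ} (hA : ∀ i j, Measurable fun ω => A ω i j)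
    (i j : ι) : Measurable fun ω => (A ω)⁻¹ i j := by
  have h1 : Measurable fun ω => (A ω).det :=
    measurable_of_continuous_matrix continuous_id.matrix_det hA
  have h2 : Measurable fun ω => (A ω).adjugate i j :=
    measurable_of_continuous_matrix (g := fun B => B.adjugate i j)
      (continuous_id.matrix_adjugate.matrix_elem i j) hA
  have e : (fun ω => (A ω)⁻¹ i j) = fun ω => (A ω).det⁻¹ * (A ω).adjugate i j := by
    funext ω
    simp [Matrix.inv_def]
  rw [e]
  exact h1.inv.mul h2

lemma measurable_dotProduct_mulVec {A : Ω → Matrix ι ι ℝ}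
    (hA : ∀ i j, Measurable fun ω => A ω i j) {u v : Ω → ι → ℝ} (hu : Measurable u)
    (hv : Measurable v) : Measurable fun ω => u ω ⬝ᵥ A ω *ᵥ v ω := by
  simp only [dotProduct, Matrix.mulVec]
  exact Finset.measurable_fun_sum _ fun i _ => (hu.eval).mul
    (Finset.measurable_fun_sum _ fun j _ => (hA i j).mul hv.eval)

lemma measurable_ridgePotential (D : ℝ) {A : Ω → Matrix ι ι ℝ}
    (hA : ∀ i j, Measurable fun ω => A ω i j) {z : Ω → ι → ℝ} (hz : Measurable z) :
    Measurable fun ω => ridgePotential D (A ω) (z ω) := by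
  unfold ridgePotential
  exact (measurable_dotProduct_mulVec (measurable_inv_apply hA) hz hz).add
    (measurable_const.sub
      (Real.measurable_log.comp (measurable_of_continuous_matrix continuous_id.matrix_det hA)))

lemma measurable_igw {K : ℕ} {sel : (Fin K → ℝ) → Fin K} (hsel : Measurable sel) (γ : ℝ)
    (a : Fin K) : Measurable fun v => igw sel γ v a := by
  have h1 : Measurable fun v : Fin K → ℝ => v (sel v) := by
    have : Measurable fun p : Fin K × (Fin K → ℝ) => p.2 p.1 :=
      measurable_from_prod_countable_right fun i => measurable_pi_apply i
    exact this.comp (hsel.prodMk measurable_id)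
  have h2 (a' : Fin K) : Measurable fun v : Fin K → ℝ => 1 / (K + γ * (v (sel v) - v a')) :=
    measurable_const.div (measurable_const.add
      (measurable_const.mul (h1.sub (measurable_pi_apply a'))))
  have e : (fun v => igw sel γ v a) = fun v => if sel v = a then
      1 - ∑ a', if sel v = a' then 0 else 1 / (K + γ * (v (sel v) - v a'))
      else 1 / (K + γ * (v (sel v) - v a)) := by
    funext v
    rw [igw]
    simp only [eq_comm (a := a)]
    congr 2
    rw [← Finset.add_sum_erase _ _ (Finset.mem_univ (sel v))]
    rw [if_pos rfl, zero_add]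
    exact Finset.sum_congr rfl fun a' ha' => by rw [if_neg (Finset.ne_of_mem_erase ha').symm]
  rw [e]
  refine Measurable.ite (hsel (measurableSet_singleton a)) ?_ (h2 a)
  exact measurable_const.sub (Finset.measurable_fun_sum _ fun a' _ =>
    Measurable.ite (hsel (measurableSet_singleton a')) measurable_const (h2 a'))

end

namespace Env

variable {M K d : ℕ} {b : Fin M → ℕ} {X : Fin M → Type*} [∀ m, MeasurableSpace (X m)]

/-! ### The law of one time step -/

instance (env : Env M K d b X) (m : Fin M) : IsProbabilityMeasure (env.ctx m) := env.ctx_prob m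

instance (env : Env M K d b X) (m : Fin M) : IsMarkovKernel (env.rew m) := env.rew_markov m

/-- The probability with which agent `m` plays the action `a` in the context `x`. -/
def policy (env : Env M K d b X) (sel : (Fin K → ℝ) → Fin K) (γ : ℝ)
    (w : EuclideanSpace ℝ (Coord d b)) (m : Fin M) (x : X m) (a : Fin K) : ℝ :=
  igw sel γ (fun a' => inner ℝ w (env.featTilde m x a')) a

lemma measurable_featTilde (env : Env M K d b X) (m : Fin M) (a : Fin K) :
    Measurable fun x => env.featTilde m x a := by
  refine (WithLp.measurable_toLp 2 _).comp (measurable_pi_lambda _ fun c => ?_)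
  have h (c : Fin d ⊕ Fin (b m)) : Measurable fun x => env.φ m x a c :=
    (measurable_pi_apply c).comp ((WithLp.measurable_ofLp 2 _).comp (env.φ_meas m a))
  rcases c with i | p
  · exact h _
  · simp only [Sum.elim_inr]
    split_ifs
    · exact h _
    · exact measurable_const

lemma measurable_policy (env : Env M K d b X) {sel : (Fin K → ℝ) → Fin K} (hsel : Measurable sel)
    (γ : ℝ) (m : Fin M) (a : Fin K) :
    Measurable fun p : EuclideanSpace ℝ (Coord d b) × X m => env.policy sel γ p.1 m p.2 a :=
  (measurable_igw hsel γ a).comp (measurable_pi_lambda _ fun a' =>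
    measurable_fst.inner ((env.measurable_featTilde m a').comp measurable_snd))

lemma measurable_policy_right (env : Env M K d b X) {sel : (Fin K → ℝ) → Fin K}
    (hsel : Measurable sel) (γ : ℝ) (w : EuclideanSpace ℝ (Coord d b)) (m : Fin M) (a : Fin K) :
    Measurable fun x => env.policy sel γ w m x a :=
  (measurable_igw hsel γ a).comp (measurable_pi_lambda _ fun a' =>
    measurable_const.inner (env.measurable_featTilde m a'))

lemma sum_policy (env : Env M K d b X) (sel : (Fin K → ℝ) → Fin K) (γ : ℝ)
    (w : EuclideanSpace ℝ (Coord d b)) (m : Fin M) (x : X m) :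
    ∑ a, env.policy sel γ w m x a = 1 := sum_igw _ _

lemma policy_nonneg (env : Env M K d b X) {sel : (Fin K → ℝ) → Fin K}
    (hsel : ∀ (v : Fin K → ℝ) (a : Fin K), v a ≤ v (sel v)) {γ : ℝ} (hγ : 0 ≤ γ)
    (w : EuclideanSpace ℝ (Coord d b)) (m : Fin M) (x : X m) (a : Fin K) :
    0 ≤ env.policy sel γ w m x a := (igw_pos hsel hγ _ _).le

lemma lintegral_agentLaw (env : Env M K d b X) {sel : (Fin K → ℝ) → Fin K}
    (hsel : Measurable sel) (γ : ℝ) (w : EuclideanSpace ℝ (Coord d b)) (m : Fin M)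
    {F : X m × (Fin K → ℝ) × Fin K → ℝ≥0∞} (hF : Measurable F) :
    ∫⁻ o, F o ∂(env.agentLaw sel γ w m) =
      ∫⁻ x, ∑ a, ENNReal.ofReal (env.policy sel γ w m x a) *
        ∫⁻ r, F (x, r, a) ∂(env.rew m x) ∂(env.ctx m) := by
  have hFa (a : Fin K) : Measurable fun z : X m × (Fin K → ℝ) => F (z.1, z.2, a) :=
    hF.comp (measurable_fst.prodMk (measurable_snd.prodMk measurable_const))
  have hp (a : Fin K) : Measurable fun x => ENNReal.ofReal (env.policy sel γ w m x a) :=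
    (env.measurable_policy_right hsel γ w m a).ennreal_ofReal
  have hi (a : Fin K) : Measurable fun x => ∫⁻ r, F (x, r, a) ∂(env.rew m x) :=
    (hFa a).lintegral_kernel_prod_right'
  rw [lintegral_finsetSum (f := fun a x => ENNReal.ofReal (env.policy sel γ w m x a) *
    ∫⁻ r, F (x, r, a) ∂(env.rew m x)) _ fun a _ => (hp a).mul (hi a), agentLaw,
    lintegral_finsetSum_measure]
  refine Finset.sum_congr rfl fun a _ => ?_
  have hmap : Measurable fun z : X m × (Fin K → ℝ) => (z.1, z.2, a) :=
    measurable_fst.prodMk (measurable_snd.prodMk measurable_const)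
  have hd : Measurable fun z : X m × (Fin K → ℝ) =>
      ENNReal.ofReal (env.policy sel γ w m z.1 a) := (hp a).comp measurable_fst
  rw [lintegral_map hF hmap]
  change ∫⁻ z, F (z.1, z.2, a) ∂((env.ctx m ⊗ₘ env.rew m).withDensity
    fun z => ENNReal.ofReal (env.policy sel γ w m z.1 a)) = _
  rw [lintegral_withDensity_eq_lintegral_mul _ hd (hFa a),
    Measure.lintegral_compProd (hd.mul (hFa a))]
  refine lintegral_congr fun x => ?_
  simp only [Pi.mul_apply]
  rw [lintegral_const_mul]
  exact (hFa a).comp measurable_prodMk_left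

lemma lintegral_agentLaw_le (env : Env M K d b X) {sel : (Fin K → ℝ) → Fin K}
    (hsel : Measurable sel) (hmax : ∀ (v : Fin K → ℝ) (a : Fin K), v a ≤ v (sel v))
    {γ : ℝ} (hγ : 0 ≤ γ) (w : EuclideanSpace ℝ (Coord d b)) (m : Fin M)
    {F : X m × (Fin K → ℝ) × Fin K → ℝ≥0∞} (hF : Measurable F) {C : ℝ≥0∞}
    (h : ∀ x a, ∫⁻ r, F (x, r, a) ∂(env.rew m x) ≤ C) :
    ∫⁻ o, F o ∂(env.agentLaw sel γ w m) ≤ C := by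
  rw [env.lintegral_agentLaw hsel γ w m hF]
  calc _ ≤ ∫⁻ _x, C ∂(env.ctx m) := by
        refine lintegral_mono fun x => ?_
        calc _ ≤ ∑ a, ENNReal.ofReal (env.policy sel γ w m x a) * C := by
              gcongr with a _
              exact h x a
          _ = C := by
              rw [← Finset.sum_mul, ← ENNReal.ofReal_sum_of_nonneg fun a _ =>
                env.policy_nonneg hmax hγ w m x a, sum_policy, ENNReal.ofReal_one, one_mul]
    _ = C := by simp

lemma isProbabilityMeasure_agentLaw (env : Env M K d b X) {sel : (Fin K → ℝ) → Fin K}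
    (hsel : Measurable sel) (hmax : ∀ (v : Fin K → ℝ) (a : Fin K), v a ≤ v (sel v))
    {γ : ℝ} (hγ : 0 ≤ γ) (w : EuclideanSpace ℝ (Coord d b)) (m : Fin M) :
    IsProbabilityMeasure (env.agentLaw sel γ w m) := by
  constructor
  rw [← lintegral_one, env.lintegral_agentLaw hsel γ w m measurable_const]
  simp only [lintegral_one, measure_univ, mul_one]
  calc _ = ∫⁻ _x, 1 ∂(env.ctx m) := lintegral_congr fun x => by
        rw [← ENNReal.ofReal_sum_of_nonneg fun a _ => env.policy_nonneg hmax hγ w m x a,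
          sum_policy, ENNReal.ofReal_one]
    _ = 1 := by simp

/-- The feature vector of the action that agent `m` plays. -/
def outFeat (env : Env M K d b X) (m : Fin M) (o : X m × (Fin K → ℝ) × Fin K) : Coord d b → ℝ :=
  (env.featTilde m o.1 o.2.2).ofLp

/-- The noise of the reward that agent `m` observes. -/
def outNoise (env : Env M K d b X) (m : Fin M) (o : X m × (Fin K → ℝ) × Fin K) : ℝ :=
  o.2.1 o.2.2 - env.mean m o.1 o.2.2

lemma measurable_outcome {β : Type*} [MeasurableSpace β] {m : Fin M}
    {g : X m → (Fin K → ℝ) → Fin K → β}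
    (hg : ∀ a, Measurable fun z : X m × (Fin K → ℝ) => g z.1 z.2 a) :
    Measurable fun o : X m × (Fin K → ℝ) × Fin K => g o.1 o.2.1 o.2.2 := by
  have h : Measurable fun p : (X m × (Fin K → ℝ)) × Fin K => g p.1.1 p.1.2 p.2 :=
    measurable_from_prod_countable_left hg
  exact h.comp ((measurable_fst.prodMk (measurable_fst.comp measurable_snd)).prodMk
    (measurable_snd.comp measurable_snd))

lemma measurable_outFeat (env : Env M K d b X) (m : Fin M) : Measurable (env.outFeat m) :=
  measurable_outcome (g := fun x _ a => (env.featTilde m x a).ofLp) fun a =>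
    (WithLp.measurable_ofLp 2 _).comp ((env.measurable_featTilde m a).comp measurable_fst)

lemma measurable_mean (env : Env M K d b X) (m : Fin M) (a : Fin K) :
    Measurable fun x => env.mean m x a := by
  simp only [← inner_trueParam]
  exact measurable_const.inner (env.measurable_featTilde m a)

lemma measurable_outNoise (env : Env M K d b X) (m : Fin M) : Measurable (env.outNoise m) :=
  measurable_outcome (g := fun x r a => r a - env.mean m x a) fun a =>
    ((measurable_pi_apply a).comp measurable_snd).sub ((env.measurable_mean m a).comp measurable_fst)

lemma outFeat_dotProduct_self_le (env : Env M K d b X) (m : Fin M)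
    (o : X m × (Fin K → ℝ) × Fin K) : env.outFeat m o ⬝ᵥ env.outFeat m o ≤ 1 := by
  have h := env.norm_featTilde_le m o.1 o.2.2
  have h2 : env.outFeat m o ⬝ᵥ env.outFeat m o = ‖env.featTilde m o.1 o.2.2‖ ^ 2 := by
    rw [EuclideanSpace.real_norm_sq_eq]
    exact Finset.sum_congr rfl fun c _ => (sq _).symm
  rw [h2]
  exact pow_le_one₀ (norm_nonneg _) h

lemma ae_abs_outNoise_le (env : Env M K d b X) (m : Fin M) (x : X m) (a : Fin K) :
    ∀ᵐ r ∂(env.rew m x), |env.outNoise m (x, r, a)| ≤ 1 := by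
  have h0 : ∀ᵐ r ∂(env.rew m x), (0 : ℝ) ≤ r a :=
    (env.rew_mem m x).mono fun r hr => (hr a).1
  have h1 : ∀ᵐ r ∂(env.rew m x), r a ≤ (1 : ℝ) :=
    (env.rew_mem m x).mono fun r hr => (hr a).2
  have hm0 : 0 ≤ env.mean m x a := integral_nonneg_of_ae h0
  have hm1 : env.mean m x a ≤ 1 := by
    calc env.mean m x a ≤ ∫ _r, (1 : ℝ) ∂(env.rew m x) :=
          integral_mono_of_nonneg h0 (integrable_const _) h1
      _ = 1 := by simp
  filter_upwards [h0, h1] with r hr0 hr1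
  rw [outNoise, abs_le]
  constructor <;> simp only <;> linarith

lemma mean_mem (env : Env M K d b X) (m : Fin M) (x : X m) (a : Fin K) :
    env.mean m x a ∈ Set.Icc (0 : ℝ) 1 := by
  have h0 : ∀ᵐ r ∂(env.rew m x), (0 : ℝ) ≤ r a :=
    (env.rew_mem m x).mono fun r hr => (hr a).1
  have h1 : ∀ᵐ r ∂(env.rew m x), r a ≤ (1 : ℝ) :=
    (env.rew_mem m x).mono fun r hr => (hr a).2
  refine ⟨integral_nonneg_of_ae h0, ?_⟩
  calc env.mean m x a ≤ ∫ _r, (1 : ℝ) ∂(env.rew m x) :=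
        integral_mono_of_nonneg h0 (integrable_const _) h1
    _ = 1 := by simp

lemma integral_outNoise (env : Env M K d b X) (m : Fin M) (x : X m) (a : Fin K) :
    ∫ r, env.outNoise m (x, r, a) ∂(env.rew m x) = 0 := by
  have hi : Integrable (fun r : Fin K → ℝ => r a) (env.rew m x) :=
    Integrable.of_bound (C := 1) (measurable_pi_apply a).aestronglyMeasurable
      ((env.rew_mem m x).mono fun r hr => by
        rw [Real.norm_eq_abs, abs_le]; constructor <;> linarith [(hr a).1, (hr a).2])
  simp only [outNoise]
  rw [integral_sub hi (integrable_const _)]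
  simp [mean]

end Env

namespace Env

variable {M K d : ℕ} {b : Fin M → ℕ} {X : Fin M → Type*} [∀ m, MeasurableSpace (X m)]

open Matrix

/-! ### One time step of all agents -/

/-- The sum of `ξ ξᵀ` over the feature vectors `ξ` of all agents in one time step. -/
def obsGram (env : Env M K d b X) (o : Step K X) : Matrix (Coord d b) (Coord d b) ℝ :=
  ∑ m, vecMulVec (env.outFeat m (o m)) (env.outFeat m (o m))

/-- The sum of the feature vectors of all agents in one time step, weighted with the noise. -/
def obsNoise (env : Env M K d b X) (o : Step K X) : Coord d b → ℝ :=
  ∑ m, env.outNoise m (o m) • env.outFeat m (o m)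

/-- The expectation of `obsGram` if actions are drawn by inverse gap weighting. -/
def popGram (env : Env M K d b X) (sel : (Fin K → ℝ) → Fin K) (γ : ℝ)
    (w : EuclideanSpace ℝ (Coord d b)) : Matrix (Coord d b) (Coord d b) ℝ :=
  ∑ m, secondMoment (env.agentLaw sel γ w m) (env.outFeat m)

lemma measurable_vecMulVec_outFeat (env : Env M K d b X) (m : Fin M) (i j : Coord d b) :
    Measurable fun o => vecMulVec (env.outFeat m o) (env.outFeat m o) i j := by
  simp only [vecMulVec_apply]
  exact (env.measurable_outFeat m).eval.mul (env.measurable_outFeat m).eval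

lemma measurable_obsGram (env : Env M K d b X) (i j : Coord d b) :
    Measurable fun o : Step K X => env.obsGram o i j := by
  simp only [obsGram, Matrix.sum_apply]
  exact Finset.measurable_fun_sum _ fun m _ =>
    (env.measurable_vecMulVec_outFeat m i j).comp (measurable_pi_apply m)

lemma measurable_obsNoise (env : Env M K d b X) :
    Measurable fun o : Step K X => env.obsNoise o := by
  unfold obsNoise
  exact Finset.measurable_fun_sum _ fun m _ =>
    ((env.measurable_outNoise m).comp (measurable_pi_apply m)).smul
      ((env.measurable_outFeat m).comp (measurable_pi_apply m))

lemma transpose_obsGram (env : Env M K d b X) (o : Step K X) :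
    (env.obsGram o)ᵀ = env.obsGram o := by
  simp [obsGram, transpose_sum, transpose_vecMulVec]

lemma transpose_popGram (env : Env M K d b X) (sel : (Fin K → ℝ) → Fin K) (γ : ℝ)
    (w : EuclideanSpace ℝ (Coord d b)) : (env.popGram sel γ w)ᵀ = env.popGram sel γ w := by
  simp [popGram, transpose_sum, secondMoment_transpose]

lemma dotProduct_sum_mulVec {ι κ : Type*} [Fintype ι] (s : Finset κ) (A : κ → Matrix ι ι ℝ)
    (v : ι → ℝ) :
    v ⬝ᵥ (∑ k ∈ s, A k) *ᵥ v = ∑ k ∈ s, v ⬝ᵥ A k *ᵥ v := by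
  rw [sum_mulVec, dotProduct_sum]

lemma dotProduct_obsGram_mulVec (env : Env M K d b X) (o : Step K X) (v : Coord d b → ℝ) :
    v ⬝ᵥ env.obsGram o *ᵥ v = ∑ m, (env.outFeat m (o m) ⬝ᵥ v) ^ 2 := by
  rw [obsGram, dotProduct_sum_mulVec]
  exact Finset.sum_congr rfl fun m _ => dotProduct_vecMulVec_mulVec _ _

lemma outFeat_dotProduct_sq_le (env : Env M K d b X) (m : Fin M)
    (o : X m × (Fin K → ℝ) × Fin K) (v : Coord d b → ℝ) :
    (env.outFeat m o ⬝ᵥ v) ^ 2 ≤ v ⬝ᵥ v :=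
  (dotProduct_sq_le _ _).trans (mul_le_of_le_one_left
    (Finset.sum_nonneg fun _ _ => mul_self_nonneg _) (env.outFeat_dotProduct_self_le m o))

section step
variable (env : Env M K d b X) {sel : (Fin K → ℝ) → Fin K} (hsel : Measurable sel)
  (hmax : ∀ (v : Fin K → ℝ) (a : Fin K), v a ≤ v (sel v)) {γ : ℝ} (hγ : 0 ≤ γ)
  (w : EuclideanSpace ℝ (Coord d b))

include hsel hmax hγ

lemma lintegral_pi_trace_exp_le {H : Matrix (Coord d b) (Coord d b) ℝ} (hH : Hᵀ = H)
    [Nonempty (Step K X)] :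
    ∫⁻ o, ENNReal.ofReal (NormedSpace.exp (H + ((1 / 10 : ℝ) • env.popGram sel γ w -
        (1 / 4 : ℝ) • env.obsGram o))).trace ∂(Measure.pi fun m => env.agentLaw sel γ w m) ≤
      ENNReal.ofReal (NormedSpace.exp H).trace := by
  have hp (m : Fin M) : IsProbabilityMeasure (env.agentLaw sel γ w m) :=
    env.isProbabilityMeasure_agentLaw hsel hmax hγ w m
  set Y : ∀ m, X m × (Fin K → ℝ) × Fin K → Matrix (Coord d b) (Coord d b) ℝ := fun m o =>
    (1 / 10 : ℝ) • secondMoment (env.agentLaw sel γ w m) (env.outFeat m) -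
      (1 / 4 : ℝ) • vecMulVec (env.outFeat m o) (env.outFeat m o) with hY
  have hYt (m : Fin M) (o) : (Y m o)ᵀ = Y m o := by
    simp [hY, secondMoment_transpose, transpose_vecMulVec]
  have hYm (m : Fin M) (i j : Coord d b) : Measurable fun o => Y m o i j := by
    simp only [hY, Matrix.sub_apply, Matrix.smul_apply]
    exact measurable_const.sub ((env.measurable_vecMulVec_outFeat m i j).const_smul (1 / 4 : ℝ))
  have e (o : Step K X) : (1 / 10 : ℝ) • env.popGram sel γ w - (1 / 4 : ℝ) • env.obsGram o =
      ∑ m, Y m (o m) := by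
    simp only [hY, popGram, obsGram, Finset.sum_sub_distrib, Finset.smul_sum]
  simp only [e]
  have key := lintegral_pi_le_of_insert (fun m => env.agentLaw sel γ w m)
    (fun s o => ENNReal.ofReal (NormedSpace.exp (H + ∑ m ∈ s, Y m (o m))).trace)
    (fun s => (measurable_of_continuous_matrix continuous_trace_exp fun i j => by
      simp only [Matrix.add_apply, Matrix.sum_apply]
      exact measurable_const.add (Finset.measurable_fun_sum _ fun m _ =>
        (hYm m i j).comp (measurable_pi_apply m))).ennreal_ofReal)
    (fun s i hi o => by
      have e2 (x : X i × (Fin K → ℝ) × Fin K) :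
          H + ∑ m ∈ insert i s, Y m (Function.update o i x m) =
            (H + ∑ m ∈ s, Y m (o m)) + Y i x := by
        rw [Finset.sum_insert hi, Function.update_self]
        have : ∑ m ∈ s, Y m (Function.update o i x m) = ∑ m ∈ s, Y m (o m) :=
          Finset.sum_congr rfl fun m hm => by
            rw [Function.update_of_ne (ne_of_mem_of_not_mem hm hi)]
        rw [this]
        abel
      simp only [e2]
      exact lintegral_trace_exp_le (env.measurable_outFeat i)
        (env.outFeat_dotProduct_self_le i) (by
          rw [transpose_add, transpose_sum, hH]
          exact congrArg _ (Finset.sum_congr rfl fun m _ => hYt m _)))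
    (Classical.arbitrary _)
  simpa using key

lemma lintegral_pi_ridgePotential_le {A : Matrix (Coord d b) (Coord d b) ℝ} (hA : DominatesOne A)
    {a : ℝ} (ha : ∀ v : Coord d b → ℝ, v ⬝ᵥ A *ᵥ v ≤ a * (v ⬝ᵥ v)) (z : Coord d b → ℝ) {D : ℝ}
    (hD : Fintype.card (Coord d b) * Real.log (a + M) ≤ D) [Nonempty (Step K X)] :
    ∫⁻ o, ENNReal.ofReal (ridgePotential D (A + env.obsGram o) (z + env.obsNoise o))
        ∂(Measure.pi fun m => env.agentLaw sel γ w m) ≤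
      ENNReal.ofReal (ridgePotential D A z) := by
  have hp (m : Fin M) : IsProbabilityMeasure (env.agentLaw sel γ w m) :=
    env.isProbabilityMeasure_agentLaw hsel hmax hγ w m
  set V : ∀ m, X m × (Fin K → ℝ) × Fin K → Matrix (Coord d b) (Coord d b) ℝ := fun m o =>
    vecMulVec (env.outFeat m o) (env.outFeat m o) with hV
  have hdom (s : Finset (Fin M)) (o : Step K X) : DominatesOne (A + ∑ m ∈ s, V m (o m)) := by
    refine dominatesOne_add hA ?_ fun v => ?_
    · simp [hV, transpose_sum, transpose_vecMulVec]
    · rw [dotProduct_sum_mulVec]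
      exact Finset.sum_nonneg fun m _ => by
        rw [dotProduct_vecMulVec_mulVec]; exact sq_nonneg _
  have hdet (s : Finset (Fin M)) (o : Step K X) :
      Real.log (A + ∑ m ∈ s, V m (o m)).det ≤ D := by
    refine ((hdom s o).log_det_le fun v => ?_).trans hD
    rw [add_mulVec, dotProduct_add, dotProduct_sum_mulVec, add_mul]
    refine add_le_add (ha v) ?_
    have hv : 0 ≤ v ⬝ᵥ v := Finset.sum_nonneg fun _ _ => mul_self_nonneg _
    calc ∑ m ∈ s, v ⬝ᵥ V m (o m) *ᵥ v ≤ ∑ _m ∈ s, v ⬝ᵥ v :=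
          Finset.sum_le_sum fun m _ => by
            rw [dotProduct_vecMulVec_mulVec]; exact env.outFeat_dotProduct_sq_le m _ v
      _ = (s.card : ℝ) * (v ⬝ᵥ v) := by simp
      _ ≤ M * (v ⬝ᵥ v) := by
          gcongr
          simpa using Finset.card_le_univ s
  have hmeas (s : Finset (Fin M)) : Measurable fun o : Step K X =>
      ENNReal.ofReal (ridgePotential D (A + ∑ m ∈ s, V m (o m))
        (z + ∑ m ∈ s, env.outNoise m (o m) • env.outFeat m (o m))) := by
    refine (measurable_ridgePotential D (fun i j => ?_) ?_).ennreal_ofReal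
    · simp only [Matrix.add_apply, Matrix.sum_apply]
      exact measurable_const.add (Finset.measurable_fun_sum _ fun m _ =>
        (env.measurable_vecMulVec_outFeat m i j).comp (measurable_pi_apply m))
    · exact measurable_const.add (Finset.measurable_fun_sum _ fun m _ =>
        ((env.measurable_outNoise m).comp (measurable_pi_apply m)).smul
          ((env.measurable_outFeat m).comp (measurable_pi_apply m)))
  have key := lintegral_pi_le_of_insert (fun m => env.agentLaw sel γ w m)
    (fun s o => ENNReal.ofReal (ridgePotential D (A + ∑ m ∈ s, V m (o m))
        (z + ∑ m ∈ s, env.outNoise m (o m) • env.outFeat m (o m))))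
    hmeas
    (fun s i hi o => by
      have e1 (x : X i × (Fin K → ℝ) × Fin K) :
          A + ∑ m ∈ insert i s, V m (Function.update o i x m) =
            (A + ∑ m ∈ s, V m (o m)) + V i x := by
        rw [Finset.sum_insert hi, Function.update_self]
        have : ∑ m ∈ s, V m (Function.update o i x m) = ∑ m ∈ s, V m (o m) :=
          Finset.sum_congr rfl fun m hm => by
            rw [Function.update_of_ne (ne_of_mem_of_not_mem hm hi)]
        rw [this]
        abel
      have e2 (x : X i × (Fin K → ℝ) × Fin K) :
          z + ∑ m ∈ insert i s, env.outNoise m (Function.update o i x m) •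
              env.outFeat m (Function.update o i x m) =
            (z + ∑ m ∈ s, env.outNoise m (o m) • env.outFeat m (o m)) +
              env.outNoise i x • env.outFeat i x := by
        rw [Finset.sum_insert hi, Function.update_self]
        have : ∑ m ∈ s, env.outNoise m (Function.update o i x m) •
              env.outFeat m (Function.update o i x m) =
            ∑ m ∈ s, env.outNoise m (o m) • env.outFeat m (o m) :=
          Finset.sum_congr rfl fun m hm => by
            rw [Function.update_of_ne (ne_of_mem_of_not_mem hm hi)]
        rw [this]
        abel
      refine env.lintegral_agentLaw_le hsel hmax hγ w i
        ((hmeas (insert i s)).comp (measurable_update o)) fun x a => ?_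
      have hb := hdet (insert i s) (Function.update o i (x, 0, a))
      rw [e1] at hb
      refine le_trans (le_of_eq (lintegral_congr fun r => ?_))
        (lintegral_ridgePotential_le (ε := fun r => env.outNoise i (x, r, a))
        ((env.measurable_outNoise i).comp
          (measurable_const.prodMk (measurable_id.prodMk measurable_const)))
        (env.ae_abs_outNoise_le i x a) (env.integral_outNoise i x a) (hdom s o) _ _ hb)
      exact congrArg ENNReal.ofReal (congrArg₂ (ridgePotential D) (e1 (x, r, a)) (e2 (x, r, a))))
    (Classical.arbitrary _)
  simp only [Finset.sum_empty, add_zero] at key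
  exact key

end step

end Env

/-! ### Epochs along a trajectory -/

lemma τ_mono {l l' : ℕ} (h : l ≤ l') : τ l ≤ τ l' := by
  unfold τ
  split_ifs with h1 h2
  · exact le_rfl
  · exact Nat.zero_le _
  · omega
  · exact Nat.pow_le_pow_right (by norm_num) h

lemma τ_pred_add_epochLen (l : ℕ) : τ (l - 1) + epochLen l = τ l := by
  have := τ_mono (Nat.sub_le l 1)
  unfold epochLen
  omega

lemma epochOf_eq {l t : ℕ} (hl : 1 ≤ l) (h1 : τ (l - 1) ≤ t) (h2 : t < τ l) : epochOf t = l := by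
  have hl0 : l ≠ 0 := by omega
  unfold τ at h1 h2
  rw [if_neg hl0] at h2
  unfold epochOf
  split_ifs at h1 with h
  · have hl1 : l = 1 := by omega
    subst hl1
    have : t = 0 ∨ t = 1 := by omega
    rcases this with rfl | rfl
    · rfl
    · have : Nat.clog 2 (1 + 1) = 1 := Nat.clog_pow 2 1 (by norm_num)
      rw [this]; rfl
  · have e : Nat.clog 2 (t + 1) = l := by
      apply le_antisymm
      · have h3 : t + 1 ≤ 2 ^ l := by omega
        exact (Nat.clog_le_iff_le_pow (by norm_num)).2 h3
      · have h3 : 2 ^ (l - 1) < t + 1 := by omega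
        have h4 := (Nat.lt_clog_iff_pow_lt (by norm_num)).2 h3
        omega
    rw [e]; omega

section
variable {H : Type*} [NormedAddCommGroup H] [InnerProductSpace ℝ H] [CompleteSpace H]
  [MeasurableSpace H] [BorelSpace H] [SecondCountableTopology H] {Ω : Type*} [MeasurableSpace Ω]

lemma measurable_agd (L q : ℝ) {f : Ω → H → ℝ}
    (hf : ∀ w : Ω → H, Measurable w → Measurable fun ω => gradient (f ω) (w ω)) (k : ℕ) :
    (Measurable fun ω => (agd L q (f ω) k).1) ∧ Measurable fun ω => (agd L q (f ω) k).2 := by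
  induction k with
  | zero => exact ⟨measurable_const, measurable_const⟩
  | succ k ih =>
    have hx : Measurable fun ω => (agd L q (f ω) (k + 1)).1 :=
      ih.2.sub ((hf _ ih.2).const_smul (1 / L))
    exact ⟨hx, hx.add ((hx.sub ih.1).const_smul (momentum q k))⟩

lemma measurable_leastSquares_grad {κ κ' : Type*} [Fintype κ] [Fintype κ'] (c c' : ℝ)
    {φ : Ω → κ → κ' → H} (hφ : ∀ m i, Measurable fun ω => φ ω m i)
    {r : Ω → κ → κ' → ℝ} (hr : ∀ m i, Measurable fun ω => r ω m i) {w : Ω → H}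
    (hw : Measurable w) : Measurable fun ω =>
      ∑ m, c • ∑ i, (inner ℝ (w ω) (φ ω m i) - r ω m i) • φ ω m i + c' • w ω := by
  have h1 (m : κ) (i : κ') :
      Measurable fun ω => (inner ℝ (w ω) (φ ω m i) - r ω m i) • φ ω m i :=
    ((hw.inner (hφ m i)).sub (hr m i)).smul (hφ m i)
  exact (Finset.measurable_fun_sum _ fun m _ =>
    (Finset.measurable_fun_sum _ fun i _ => h1 m i).const_smul c).add (hw.const_smul c')

end

namespace Env

variable {M K d : ℕ} {b : Fin M → ℕ} {X : Fin M → Type*} [∀ m, MeasurableSpace (X m)]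

open Matrix

/-- The regularized Gram matrix of the first `k` time steps of epoch `l`. -/
def gramUpTo (env : Env M K d b X) (l k : ℕ) (s : ℕ → Step K X) :
    Matrix (Coord d b) (Coord d b) ℝ :=
  1 + ∑ i ∈ Finset.range k, env.obsGram (s (τ (l - 1) + i))

/-- The noise of the normal equations of the first `k` time steps of epoch `l`, relative to the
true parameter; its initial value accounts for the bias of the regularization. -/
def noiseUpTo (env : Env M K d b X) (l k : ℕ) (s : ℕ → Step K X) : Coord d b → ℝ :=
  -env.trueParam.ofLp + ∑ i ∈ Finset.range k, env.obsNoise (s (τ (l - 1) + i))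

/-- The exponent of the matrix Chernoff bound for the first `k` time steps of epoch `l`. -/
def chernoffUpTo (env : Env M K d b X) (sel : (Fin K → ℝ) → Fin K) (cγ cρ : ℝ) (l k : ℕ)
    (s : ℕ → Step K X) : Matrix (Coord d b) (Coord d b) ℝ :=
  ∑ i ∈ Finset.range k, ((1 / 10 : ℝ) •
      env.popGram sel (rate M K d b cγ l) (env.estimate cρ l s) -
    (1 / 4 : ℝ) • env.obsGram (s (τ (l - 1) + i)))

lemma rate_nonneg {cγ : ℝ} (hγ : 0 < cγ) (l : ℕ) : 0 ≤ rate M K d b cγ l := by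
  unfold rate; positivity

lemma estimate_congr (env : Env M K d b X) (cρ : ℝ) {l : ℕ} {s s' : ℕ → Step K X}
    (h : ∀ i < τ (l - 1), s i = s' i) : env.estimate cρ l s = env.estimate cρ l s' := by
  unfold estimate
  split_ifs with hl
  · rfl
  · have e : (data (l - 1) s : Data K (epochLen (l - 1)) X) = data (l - 1) s' := by
      funext m i
      have := τ_pred_add_epochLen (l - 1)
      simp only [data, h _ (by omega : τ (l - 1 - 1) + i < τ (l - 1))]
    rw [e]

/-! ### Measurability along a trajectory -/

lemma measurable_ridgeGrad (env : Env M K d b X) {E : ℕ} (lam : ℝ) {Ω : Type*}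
    [MeasurableSpace Ω] {S : Ω → Data K E X} (hS : ∀ m i, Measurable fun ω => S ω m i)
    {w : Ω → EuclideanSpace ℝ (Coord d b)} (hw : Measurable w) :
    Measurable fun ω => env.ridgeGrad lam (S ω) (w ω) := by
  have hf (m : Fin M) (i : Fin E) :
      Measurable fun ω => env.featTilde m (S ω m i).1 (S ω m i).2.1 := by
    have h : Measurable fun p : X m × Fin K => env.featTilde m p.1 p.2 :=
      measurable_from_prod_countable_left fun a => env.measurable_featTilde m a
    exact h.comp (((measurable_fst).comp (hS m i)).prodMk
      ((measurable_fst.comp measurable_snd).comp (hS m i)))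
  have hr (m : Fin M) (i : Fin E) : Measurable fun ω => (S ω m i).2.2 :=
    (measurable_snd.comp measurable_snd).comp (hS m i)
  exact measurable_leastSquares_grad (2 / ((M * E : ℕ) : ℝ)) (2 * lam)
    (φ := fun ω m i => env.featTilde m (S ω m i).1 (S ω m i).2.1)
    (r := fun ω m i => (S ω m i).2.2) hf hr hw

lemma measurable_flOutput (env : Env M K d b X) {E : ℕ} {Ω : Type*}
    [MeasurableSpace Ω] {S : Ω → Data K E X} (hS : ∀ m i, Measurable fun ω => S ω m i) (k : ℕ) :
    Measurable fun ω => env.flOutput (S ω) k := by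
  refine (measurable_agd _ _ (f := fun ω => env.ridgeLoss (reg M E) (S ω))
    (fun w hw => ?_) k).1
  simp only [env.gradient_ridgeLoss (reg_nonneg M E)]
  exact env.measurable_ridgeGrad _ hS hw

lemma measurable_estimate (env : Env M K d b X) (cρ : ℝ) (l : ℕ) :
    Measurable fun s : ℕ → Step K X => env.estimate cρ l s := by
  unfold estimate
  split_ifs
  · exact measurable_const
  · refine env.measurable_flOutput (fun m i => ?_) _
    have ho : Measurable fun s : ℕ → Step K X => s (τ (l - 1 - 1) + i) m :=
      (measurable_pi_apply m).comp (measurable_pi_apply _)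
    have hg : Measurable fun o : X m × (Fin K → ℝ) × Fin K => (o.1, o.2.2, o.2.1 o.2.2) :=
      measurable_outcome (g := fun x r a => (x, a, r a)) fun a =>
        measurable_fst.prodMk (measurable_const.prodMk
          ((measurable_pi_apply a).comp measurable_snd))
    exact hg.comp ho

section pop
variable (env : Env M K d b X) {sel : (Fin K → ℝ) → Fin K} (hsel : Measurable sel)
  (hmax : ∀ (v : Fin K → ℝ) (a : Fin K), v a ≤ v (sel v)) {γ : ℝ} (hγ : 0 ≤ γ)

include hsel hmax hγ

/-- The integral of a nonnegative function of context and action under `agentLaw`. -/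
lemma lintegral_agentLaw_of_nonneg (w : EuclideanSpace ℝ (Coord d b)) (m : Fin M)
    {g : X m → Fin K → ℝ} (hg : ∀ a, Measurable fun x => g x a) (hg0 : ∀ x a, 0 ≤ g x a) :
    ∫⁻ o, ENNReal.ofReal (g o.1 o.2.2) ∂(env.agentLaw sel γ w m) =
      ∫⁻ x, ENNReal.ofReal (∑ a, env.policy sel γ w m x a * g x a) ∂(env.ctx m) := by
  rw [env.lintegral_agentLaw hsel γ w m
    (measurable_outcome (g := fun x _ a => g x a) fun a =>
      (hg a).comp measurable_fst).ennreal_ofReal]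
  refine lintegral_congr fun x => ?_
  rw [ENNReal.ofReal_sum_of_nonneg fun a _ =>
    mul_nonneg (env.policy_nonneg hmax hγ w m x a) (hg0 x a)]
  refine Finset.sum_congr rfl fun a _ => ?_
  rw [ENNReal.ofReal_mul (env.policy_nonneg hmax hγ w m x a)]
  simp

lemma dotProduct_popGram_mulVec (w : EuclideanSpace ℝ (Coord d b)) (v : Coord d b → ℝ) :
    ENNReal.ofReal (v ⬝ᵥ env.popGram sel γ w *ᵥ v) =
      ∑ m, ∫⁻ x, ENNReal.ofReal (∑ a, env.policy sel γ w m x a *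
        ((env.featTilde m x a).ofLp ⬝ᵥ v) ^ 2) ∂(env.ctx m) := by
  have hp (m : Fin M) : IsProbabilityMeasure (env.agentLaw sel γ w m) :=
    env.isProbabilityMeasure_agentLaw hsel hmax hγ w m
  rw [popGram, dotProduct_sum_mulVec, ENNReal.ofReal_sum_of_nonneg fun m _ =>
    dotProduct_secondMoment_mulVec_nonneg (env.measurable_outFeat m)
      (env.outFeat_dotProduct_self_le m) v]
  refine Finset.sum_congr rfl fun m _ => ?_
  have hm (a : Fin K) : Measurable fun x => ((env.featTilde m x a).ofLp ⬝ᵥ v) ^ 2 :=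
    (Finset.measurable_fun_sum _ fun c _ => (((WithLp.measurable_ofLp 2 _).comp
      (env.measurable_featTilde m a)).eval.mul measurable_const)).pow_const 2
  rw [dotProduct_secondMoment_mulVec (env.measurable_outFeat m)
    (env.outFeat_dotProduct_self_le m),
    ← env.lintegral_agentLaw_of_nonneg hsel hmax hγ w m hm fun x a => sq_nonneg _]
  refine ofReal_integral_eq_lintegral_ofReal ?_ (.of_forall fun o => sq_nonneg _)
  have := integrable_dotProduct_mulVec (ν := env.agentLaw sel γ w m) (env.measurable_outFeat m)
      (env.outFeat_dotProduct_self_le m) (vecMulVec v v)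
  refine this.congr (.of_forall fun o => ?_)
  simp only [dotProduct_vecMulVec_mulVec, dotProduct_comm]

lemma measurable_popGram (i j : Coord d b) :
    Measurable fun w : EuclideanSpace ℝ (Coord d b) => env.popGram sel γ w i j := by
  simp only [popGram, Matrix.sum_apply]
  refine Finset.measurable_fun_sum _ fun m _ => ?_
  -- the integrand is shifted by one to make it nonnegative
  have h (w : EuclideanSpace ℝ (Coord d b)) :
      secondMoment (env.agentLaw sel γ w m) (env.outFeat m) i j =
        (∫⁻ x, ENNReal.ofReal (∑ a, env.policy sel γ w m x a *
          (env.featTilde m x a i * env.featTilde m x a j + 1)) ∂(env.ctx m)).toReal - 1 := by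
    have hp := env.isProbabilityMeasure_agentLaw hsel hmax hγ w m
    have hb (o : X m × (Fin K → ℝ) × Fin K) :
        |env.outFeat m o i * env.outFeat m o j| ≤ 1 := by
      rw [abs_mul]
      exact mul_le_one₀ (abs_apply_le_one (env.outFeat_dotProduct_self_le m o) i)
        (abs_nonneg _) (abs_apply_le_one (env.outFeat_dotProduct_self_le m o) j)
    have hint := integrable_mul_apply (ν := env.agentLaw sel γ w m) (env.measurable_outFeat m)
      (env.outFeat_dotProduct_self_le m) i j
    have hm (a : Fin K) : Measurable fun x =>
        env.featTilde m x a i * env.featTilde m x a j + 1 := by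
      have hc (c : Coord d b) : Measurable fun x => env.featTilde m x a c :=
        ((WithLp.measurable_ofLp 2 _).comp (env.measurable_featTilde m a)).eval
      exact ((hc i).mul (hc j)).add measurable_const
    have hG0 (x : X m) (a : Fin K) : 0 ≤ env.featTilde m x a i * env.featTilde m x a j + 1 := by
      have h1 : -1 ≤ env.featTilde m x a i * env.featTilde m x a j := (abs_le.1 (hb (x, 0, a))).1
      linarith
    have hint' : Integrable (fun o : X m × (Fin K → ℝ) × Fin K =>
        env.featTilde m o.1 o.2.2 i * env.featTilde m o.1 o.2.2 j + 1)
        (env.agentLaw sel γ w m) := hint.add (integrable_const 1)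
    have h0 := integral_eq_lintegral_of_nonneg_ae
      (.of_forall fun o : X m × (Fin K → ℝ) × Fin K => hG0 o.1 o.2.2) hint'.aestronglyMeasurable
    rw [← env.lintegral_agentLaw_of_nonneg hsel hmax hγ w m hm hG0, ← h0]
    have : ∫ o, (env.featTilde m o.1 o.2.2 i * env.featTilde m o.1 o.2.2 j + 1)
        ∂(env.agentLaw sel γ w m) = ∫ o, env.outFeat m o i * env.outFeat m o j
        ∂(env.agentLaw sel γ w m) + 1 := by
      have := integral_add hint (integrable_const (μ := env.agentLaw sel γ w m) (1 : ℝ))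
      simp only [integral_const, probReal_univ, smul_eq_mul, mul_one] at this
      exact this
    rw [this, secondMoment, of_apply]
    ring
  simp only [h]
  refine Measurable.sub_const (Measurable.ennreal_toReal ?_) 1
  refine Measurable.lintegral_prod_right' (f := fun p : EuclideanSpace ℝ (Coord d b) × X m =>
    ENNReal.ofReal (∑ a, env.policy sel γ p.1 m p.2 a *
          (env.featTilde m p.2 a i * env.featTilde m p.2 a j + 1))) ?_
  refine (Finset.measurable_fun_sum _ fun a _ =>
    (env.measurable_policy hsel γ m a).mul ?_).ennreal_ofReal
  have hc (c : Coord d b) : Measurable fun x => env.featTilde m x a c :=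
    ((WithLp.measurable_ofLp 2 _).comp (env.measurable_featTilde m a)).eval
  exact (((hc i).mul (hc j)).add measurable_const).comp measurable_snd

end pop

lemma measurable_gramUpTo (env : Env M K d b X) (l k : ℕ) (i j : Coord d b) :
    Measurable fun s : ℕ → Step K X => env.gramUpTo l k s i j := by
  simp only [gramUpTo, Matrix.add_apply, Matrix.sum_apply]
  exact measurable_const.add (Finset.measurable_fun_sum _ fun _ _ =>
    (env.measurable_obsGram i j).comp (measurable_pi_apply _))

lemma measurable_noiseUpTo (env : Env M K d b X) (l k : ℕ) :
    Measurable fun s : ℕ → Step K X => env.noiseUpTo l k s :=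
  measurable_const.add (Finset.measurable_fun_sum _ fun _ _ =>
    env.measurable_obsNoise.comp (measurable_pi_apply _))

lemma measurable_chernoffUpTo (env : Env M K d b X) {sel : (Fin K → ℝ) → Fin K}
    (hsel : Measurable sel) (hmax : ∀ (v : Fin K → ℝ) (a : Fin K), v a ≤ v (sel v)) {cγ : ℝ}
    (hγ : 0 < cγ) (cρ : ℝ) (l k : ℕ) (i j : Coord d b) :
    Measurable fun s : ℕ → Step K X => env.chernoffUpTo sel cγ cρ l k s i j := by
  simp only [chernoffUpTo, Matrix.sum_apply, Matrix.sub_apply, Matrix.smul_apply]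
  exact Finset.measurable_fun_sum _ fun n _ =>
    (((env.measurable_popGram hsel hmax (rate_nonneg hγ l) i j).comp
      (env.measurable_estimate cρ l)).const_smul (1 / 10 : ℝ)).sub
    (((env.measurable_obsGram i j).comp (measurable_pi_apply _)).const_smul (1 / 4 : ℝ))

end Env

namespace Env

variable {M K d : ℕ} {b : Fin M → ℕ} {X : Fin M → Type*} [∀ m, MeasurableSpace (X m)]

open Matrix

/-! ### The two supermartingales of an epoch -/

lemma dotProduct_gramUpTo_mulVec (env : Env M K d b X) (l k : ℕ) (s : ℕ → Step K X)
    (v : Coord d b → ℝ) : v ⬝ᵥ env.gramUpTo l k s *ᵥ v =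
      v ⬝ᵥ v + ∑ i ∈ Finset.range k, ∑ m, (env.outFeat m (s (τ (l - 1) + i) m) ⬝ᵥ v) ^ 2 := by
  rw [gramUpTo, add_mulVec, dotProduct_add, one_mulVec, dotProduct_sum_mulVec]
  simp only [dotProduct_obsGram_mulVec]

lemma dominatesOne_gramUpTo (env : Env M K d b X) (l k : ℕ) (s : ℕ → Step K X) :
    DominatesOne (env.gramUpTo l k s) where
  symm := by simp [gramUpTo, transpose_sum, transpose_obsGram]
  le v := by
    rw [dotProduct_gramUpTo_mulVec]
    have : 0 ≤ ∑ i ∈ Finset.range k, ∑ m, (env.outFeat m (s (τ (l - 1) + i) m) ⬝ᵥ v) ^ 2 := by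
      positivity
    linarith

lemma gramUpTo_le (env : Env M K d b X) (l k : ℕ) (s : ℕ → Step K X) (v : Coord d b → ℝ) :
    v ⬝ᵥ env.gramUpTo l k s *ᵥ v ≤ (1 + (M * k : ℕ)) * (v ⬝ᵥ v) := by
  rw [dotProduct_gramUpTo_mulVec, add_mul, one_mul]
  gcongr
  calc _ ≤ ∑ _i ∈ Finset.range k, ∑ _m : Fin M, v ⬝ᵥ v :=
        Finset.sum_le_sum fun i _ => Finset.sum_le_sum fun m _ =>
          env.outFeat_dotProduct_sq_le m _ v
    _ = _ := by simp; ring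

lemma transpose_chernoffUpTo (env : Env M K d b X) (sel : (Fin K → ℝ) → Fin K) (cγ cρ : ℝ)
    (l k : ℕ) (s : ℕ → Step K X) :
    (env.chernoffUpTo sel cγ cρ l k s)ᵀ = env.chernoffUpTo sel cγ cρ l k s := by
  rw [chernoffUpTo, transpose_sum]
  exact Finset.sum_congr rfl fun i _ => by
    rw [transpose_sub, transpose_smul, transpose_smul, transpose_obsGram, transpose_popGram]

section run
variable {env : Env M K d b X} {sel : (Fin K → ℝ) → Fin K} (hsel : Measurable sel)
  (hmax : ∀ (v : Fin K → ℝ) (a : Fin K), v a ≤ v (sel v)) {cγ cρ : ℝ} (hγ : 0 < cγ)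
  {Ω : Type*} [MeasurableSpace Ω] {P : Measure Ω} {s : ℕ → Ω → Step K X}

/-- Averaging over time step `t` given the past, for functions of a whole trajectory that depend
only on the time steps up to `t`. -/
lemma IsRun.lintegral_update (h : env.IsRun sel cγ cρ P s) (t : ℕ)
    {W : (ℕ → Step K X) → ℝ≥0∞} (hW : Measurable W)
    (hdep : ∀ u u' : ℕ → Step K X, (∀ i ≤ t, u i = u' i) → W u = W u') :
    ∫⁻ ω, W (fun i => s i ω) ∂P =
      ∫⁻ ω, ∫⁻ o, W (Function.update (fun i => s i ω) t o)
        ∂(env.stepLaw sel cγ cρ t fun i => s i ω) ∂P := by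
  set F : (Fin t → Step K X) × Step K X → ℝ≥0∞ := fun p =>
    W (fun i => if h : i < t then p.1 ⟨i, h⟩ else p.2) with hF
  have hFm : Measurable F := by
    refine hW.comp (measurable_pi_lambda _ fun i => ?_)
    by_cases hi : i < t
    · simp only [hi, dif_pos]
      exact (measurable_pi_apply _).comp measurable_fst
    · simp only [hi, dif_neg, not_false_iff]
      exact measurable_snd
  have key := h.law t F hFm
  have e1 (ω : Ω) : F (fun i => s i ω, s t ω) = W (fun i => s i ω) :=
    hdep _ _ fun i hi => by
      rcases hi.lt_or_eq with hi | rfl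
      · simp [hi]
      · simp
  have e2 (ω : Ω) (o : Step K X) : F (fun i => s i ω, o) =
      W (Function.update (fun i => s i ω) t o) :=
    hdep _ _ fun i hi => by
      rcases hi.lt_or_eq with hi | rfl
      · simp [hi, Function.update_of_ne hi.ne]
      · simp
  simpa only [e1, e2] using key

lemma stepLaw_eq {l k : ℕ} (hl : 1 ≤ l) (hk : k < epochLen l) (u : ℕ → Step K X) :
    env.stepLaw sel cγ cρ (τ (l - 1) + k) u =
      Measure.pi fun m => env.agentLaw sel (rate M K d b cγ l) (env.estimate cρ l u) m := by
  have h := τ_pred_add_epochLen l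
  rw [stepLaw, epochOf_eq hl (Nat.le_add_right _ _) (by omega)]

include hsel hmax hγ

/-- The matrix Chernoff bound for an epoch: the samples of the epoch are independent given the
past of the epoch, and the exponent starts at zero. -/
lemma IsRun.lintegral_trace_exp_chernoff_le [IsProbabilityMeasure P]
    (h : env.IsRun sel cγ cρ P s) {l : ℕ} (hl : 1 ≤ l) {k : ℕ} (hk : k ≤ epochLen l) :
    ∫⁻ ω, ENNReal.ofReal (NormedSpace.exp
      (env.chernoffUpTo sel cγ cρ l k fun i => s i ω)).trace ∂P ≤ dTilde d b := by
  induction k with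
  | zero =>
    simp only [chernoffUpTo, Finset.range_zero, Finset.sum_empty, NormedSpace.exp_zero,
      trace_one, card_coord]
    simp
  | succ k ih =>
    refine le_trans ?_ (ih (by omega))
    rw [h.lintegral_update (τ (l - 1) + k) (W := fun u => ENNReal.ofReal (NormedSpace.exp
      (env.chernoffUpTo sel cγ cρ l (k + 1) u)).trace)
      (measurable_of_continuous_matrix continuous_trace_exp
        (env.measurable_chernoffUpTo hsel hmax hγ cρ l (k + 1))).ennreal_ofReal ?_]
    · refine lintegral_mono fun ω => ?_
      have hne : Nonempty (Step K X) := ⟨s 0 ω⟩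
      have e (o : Step K X) : env.chernoffUpTo sel cγ cρ l (k + 1)
          (Function.update (fun i => s i ω) (τ (l - 1) + k) o) =
          env.chernoffUpTo sel cγ cρ l k (fun i => s i ω) + ((1 / 10 : ℝ) •
            env.popGram sel (rate M K d b cγ l) (env.estimate cρ l fun i => s i ω) -
            (1 / 4 : ℝ) • env.obsGram o) := by
        have e0 : env.estimate cρ l (Function.update (fun i => s i ω) (τ (l - 1) + k) o) =
            env.estimate cρ l fun i => s i ω :=
          env.estimate_congr cρ fun i hi => Function.update_of_ne (by omega) _ _
        rw [chernoffUpTo, Finset.sum_range_succ, Function.update_self, e0, chernoffUpTo]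
        congr 1
        refine Finset.sum_congr rfl fun i hi => ?_
        rw [Function.update_of_ne (by have := Finset.mem_range.1 hi; omega)]
      simp only [e]
      rw [stepLaw_eq hl (by omega)]
      exact env.lintegral_pi_trace_exp_le hsel hmax (rate_nonneg hγ l) _
        (env.transpose_chernoffUpTo sel cγ cρ l k _)
    · intro u u' hu
      have e0 : env.estimate cρ l u = env.estimate cρ l u' :=
        env.estimate_congr cρ fun i hi => hu i (by omega)
      have e1 : env.chernoffUpTo sel cγ cρ l (k + 1) u =
          env.chernoffUpTo sel cγ cρ l (k + 1) u' := by
        rw [chernoffUpTo, chernoffUpTo, e0]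
        refine Finset.sum_congr rfl fun i hi => ?_
        rw [hu _ (by have := Finset.mem_range.1 hi; omega)]
      simp only [e1]

/-- The expected self-normalized potential of an epoch.  The shift `D` dominates the logarithm of
the determinant of every Gram matrix of the epoch, which keeps the potential nonnegative. -/
lemma IsRun.lintegral_ridgePotential_le [IsProbabilityMeasure P]
    (h : env.IsRun sel cγ cρ P s) {l : ℕ} (hl : 1 ≤ l) {k : ℕ} (hk : k ≤ epochLen l) {D : ℝ}
    (hD : dTilde d b * Real.log (1 + (M * epochLen l : ℕ)) ≤ D) :
    ∫⁻ ω, ENNReal.ofReal (ridgePotential D (env.gramUpTo l k fun i => s i ω)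
      (env.noiseUpTo l k fun i => s i ω)) ∂P ≤ ENNReal.ofReal (dTilde d b + D) := by
  induction k with
  | zero =>
    have e : ridgePotential D (1 : Matrix (Coord d b) (Coord d b) ℝ) (-env.trueParam.ofLp) =
        ‖env.trueParam‖ ^ 2 + D := by
      rw [ridgePotential, inv_one, one_mulVec, det_one, Real.log_one,
        EuclideanSpace.real_norm_sq_eq]
      simp [dotProduct, sq]
    simp only [gramUpTo, noiseUpTo, Finset.range_zero, Finset.sum_empty, add_zero, e]
    simp only [lintegral_const, measure_univ, mul_one]
    exact ENNReal.ofReal_le_ofReal (by linarith [env.norm_trueParam_sq_le])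
  | succ k ih =>
    refine le_trans ?_ (ih (by omega))
    rw [h.lintegral_update (τ (l - 1) + k) (W := fun u => ENNReal.ofReal
      (ridgePotential D (env.gramUpTo l (k + 1) u) (env.noiseUpTo l (k + 1) u)))
      (measurable_ridgePotential D (env.measurable_gramUpTo l (k + 1))
        (env.measurable_noiseUpTo l (k + 1))).ennreal_ofReal ?_]
    · refine lintegral_mono fun ω => ?_
      have hne : Nonempty (Step K X) := ⟨s 0 ω⟩
      have e1 (o : Step K X) : env.gramUpTo l (k + 1)
          (Function.update (fun i => s i ω) (τ (l - 1) + k) o) =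
          env.gramUpTo l k (fun i => s i ω) + env.obsGram o := by
        rw [gramUpTo, Finset.sum_range_succ, Function.update_self, gramUpTo, ← add_assoc]
        congr 2
        refine Finset.sum_congr rfl fun i hi => ?_
        rw [Function.update_of_ne (by have := Finset.mem_range.1 hi; omega)]
      have e2 (o : Step K X) : env.noiseUpTo l (k + 1)
          (Function.update (fun i => s i ω) (τ (l - 1) + k) o) =
          env.noiseUpTo l k (fun i => s i ω) + env.obsNoise o := by
        rw [noiseUpTo, Finset.sum_range_succ, Function.update_self, noiseUpTo, ← add_assoc]
        congr 2
        refine Finset.sum_congr rfl fun i hi => ?_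
        rw [Function.update_of_ne (by have := Finset.mem_range.1 hi; omega)]
      simp only [e1, e2]
      rw [stepLaw_eq hl (by omega)]
      refine env.lintegral_pi_ridgePotential_le hsel hmax (rate_nonneg hγ l) _
        (env.dominatesOne_gramUpTo l k _) (env.gramUpTo_le l k _) _ (le_trans ?_ hD)
      rw [card_coord]
      refine mul_le_mul_of_nonneg_left (Real.log_le_log (by positivity) ?_) (Nat.cast_nonneg _)
      push_cast
      have hk' : (k : ℝ) + 1 ≤ epochLen l := by exact_mod_cast hk
      nlinarith [(Nat.cast_nonneg M : (0 : ℝ) ≤ M)]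
    · intro u u' hu
      have e1 : env.gramUpTo l (k + 1) u = env.gramUpTo l (k + 1) u' := by
        rw [gramUpTo, gramUpTo]
        congr 1
        refine Finset.sum_congr rfl fun i hi => ?_
        rw [hu _ (by have := Finset.mem_range.1 hi; omega)]
      have e2 : env.noiseUpTo l (k + 1) u = env.noiseUpTo l (k + 1) u' := by
        rw [noiseUpTo, noiseUpTo]
        congr 1
        refine Finset.sum_congr rfl fun i hi => ?_
        rw [hu _ (by have := Finset.mem_range.1 hi; omega)]
      simp only [e1, e2]

lemma IsRun.ae_abs_outNoise_le (h : env.IsRun sel cγ cρ P s) :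
    ∀ᵐ ω ∂P, ∀ t m, |env.outNoise m (s t ω m)| ≤ 1 := by
  rw [ae_all_iff]
  intro t
  rw [ae_all_iff]
  intro m
  set B : Set (X m × (Fin K → ℝ) × Fin K) := {o | 1 < |env.outNoise m o|} with hB
  have hBm : MeasurableSet B := measurableSet_lt measurable_const (env.measurable_outNoise m).abs
  have key := h.lintegral_update t (W := fun u => B.indicator 1 (u t m))
    ((measurable_one.indicator hBm).comp ((measurable_pi_apply m).comp (measurable_pi_apply t)))
    (fun u u' hu => by simp only [hu t le_rfl])
  have hzero : ∫⁻ ω, B.indicator (1 : X m × (Fin K → ℝ) × Fin K → ℝ≥0∞) (s t ω m) ∂P = 0 := by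
    rw [key]
    refine (lintegral_congr fun ω => ?_).trans lintegral_zero
    simp only [Function.update_self]
    have hp (m : Fin M) := env.isProbabilityMeasure_agentLaw hsel hmax
      (rate_nonneg hγ (epochOf t)) (env.estimate cρ (epochOf t) fun i => s i ω) m
      (K := K) (γ := rate M K d b cγ (epochOf t))
    rw [stepLaw, (measurePreserving_eval (fun m => env.agentLaw sel
      (rate M K d b cγ (epochOf t)) (env.estimate cρ (epochOf t) fun i => s i ω) m)
      m).lintegral_comp (measurable_one.indicator hBm)]
    refine le_antisymm ?_ zero_le
    refine env.lintegral_agentLaw_le hsel hmax (rate_nonneg hγ _) _ m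
      (measurable_one.indicator hBm) fun x a => le_of_eq ?_
    refine (lintegral_congr_ae ((env.ae_abs_outNoise_le m x a).mono fun r hr => ?_)).trans
      lintegral_zero
    exact Set.indicator_of_notMem (by simpa [hB] using hr) _
  have hm : Measurable fun ω => B.indicator (1 : X m × (Fin K → ℝ) × Fin K → ℝ≥0∞) (s t ω m) :=
    (measurable_one.indicator hBm).comp ((measurable_pi_apply m).comp (h.meas t))
  rw [lintegral_eq_zero_iff hm] at hzero
  filter_upwards [hzero] with ω hω
  by_contra! hn
  have : B.indicator (1 : X m × (Fin K → ℝ) × Fin K → ℝ≥0∞) (s t ω m) = 1 :=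
    Set.indicator_of_mem (s := B) hn _
  simp [this] at hω

end run

end Env

/-! ### Accuracy of the computed parameter along a trajectory -/

lemma one_le_epochLen {l : ℕ} (hl : 1 ≤ l) : 1 ≤ epochLen l := by
  unfold epochLen τ
  rw [if_neg (by omega)]
  obtain ⟨j, rfl⟩ : ∃ j, l = j + 1 := ⟨l - 1, by omega⟩
  have h2 : 2 ^ (j + 1) = 2 * 2 ^ j := by ring
  have h3 : 1 ≤ 2 ^ j := Nat.one_le_two_pow
  rw [Nat.add_sub_cancel]
  split_ifs <;> omega

open Matrix in
lemma DominatesOne.quadForm_add_le {ι : Type*} [Fintype ι] [DecidableEq ι] {A : Matrix ι ι ℝ}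
    (hA : DominatesOne A) (u v : ι → ℝ) :
    (u + v) ⬝ᵥ A *ᵥ (u + v) ≤ 2 * (u ⬝ᵥ A *ᵥ u) + 2 * (v ⬝ᵥ A *ᵥ v) := by
  have h := hA.dotProduct_mulVec_nonneg (u - v)
  rw [mulVec_sub, dotProduct_sub, sub_dotProduct, sub_dotProduct] at h
  rw [mulVec_add, dotProduct_add, add_dotProduct, add_dotProduct]
  linarith

namespace Env

variable {M K d : ℕ} {b : Fin M → ℕ} {X : Fin M → Type*} [∀ m, MeasurableSpace (X m)]

open Matrix

/-- The strong convexity and smoothness constants in the definition of `flOutput` are those of the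
ridge objective, so that `agd_le` applies to it. -/
lemma agd_ridgeLoss_le (env : Env M K d b X) {E : ℕ} (S : Data K E X) (k : ℕ)
    (w : EuclideanSpace ℝ (Coord d b))
    (hw : env.ridgeLoss (reg M E) S w ≤ env.ridgeLoss (reg M E) S 0) :
    env.ridgeLoss (reg M E) S (env.flOutput S k) - env.ridgeLoss (reg M E) S w ≤
      4 / ((k : ℝ) + 2) ^ 2 * (env.ridgeLoss (reg M E) S 0 - env.ridgeLoss (reg M E) S w +
        smooth M E / 2 * ‖w‖ ^ 2) := by
  have hr := reg_nonneg M E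
  have hL := smooth_pos M E
  have hq : invCond M E * smooth M E / 2 = reg M E := by
    unfold invCond; field_simp
  refine agd_le hL (by unfold invCond; positivity) ?_ (fun y z => ?_) (fun y z => ?_) w hw k
  · rw [invCond, div_lt_one hL, smooth]; linarith
  · rw [env.gradient_ridgeLoss hr, env.ridgeLoss_expand _ S y z, hq]
    linarith [env.le_ridgeQuad (reg M E) S (z - y)]
  · rw [env.gradient_ridgeLoss hr, env.ridgeLoss_expand _ S y z]
    have := env.ridgeQuad_le (reg M E) S (z - y)
    have h2 : smooth M E / 2 = 1 + reg M E := by unfold smooth; ring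
    rw [h2]
    linarith

/-- The ridge objective of epoch `l` as a quadratic function around the true parameter. -/
lemma mul_ridgeLoss_eq (env : Env M K d b X) {l : ℕ} (hn : M * epochLen l ≠ 0)
    (s : ℕ → Step K X) (w : EuclideanSpace ℝ (Coord d b)) :
    ((M * epochLen l : ℕ) : ℝ) * env.ridgeLoss (reg M (epochLen l)) (data l s) w =
      (∑ i ∈ Finset.range (epochLen l), ∑ m, env.outNoise m (s (τ (l - 1) + i) m) ^ 2 +
        ‖env.trueParam‖ ^ 2) +
      ((w - env.trueParam).ofLp ⬝ᵥ env.gramUpTo l (epochLen l) s *ᵥ (w - env.trueParam).ofLp -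
        2 * (env.noiseUpTo l (epochLen l) s ⬝ᵥ (w - env.trueParam).ofLp)) := by
  obtain ⟨u, rfl⟩ : ∃ u, w = env.trueParam + u := ⟨w - env.trueParam, by abel⟩
  rw [add_sub_cancel_left]
  have hn' : ((M * epochLen l : ℕ) : ℝ) ≠ 0 := by exact_mod_cast hn
  have hin (v w : EuclideanSpace ℝ (Coord d b)) : inner ℝ v w = w.ofLp ⬝ᵥ v.ofLp := by
    rw [PiLp.inner_apply]
    exact Finset.sum_congr rfl fun c _ => rfl
  have hnorm : ‖env.trueParam + u‖ ^ 2 =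
      ‖env.trueParam‖ ^ 2 + 2 * (env.trueParam.ofLp ⬝ᵥ u.ofLp) + u.ofLp ⬝ᵥ u.ofLp := by
    rw [norm_add_sq_real, ← real_inner_self_eq_norm_sq u, hin, hin, dotProduct_comm u.ofLp]
  have hres (m : Fin M) (i : Fin (epochLen l)) :
      (inner ℝ (env.trueParam + u) (env.featTilde m (data l s m i).1 (data l s m i).2.1) -
        (data l s m i).2.2) ^ 2 =
      env.outNoise m (s (τ (l - 1) + i) m) ^ 2 +
        (env.outFeat m (s (τ (l - 1) + i) m) ⬝ᵥ u.ofLp) ^ 2 -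
        2 * (env.outNoise m (s (τ (l - 1) + i) m) *
          (env.outFeat m (s (τ (l - 1) + i) m) ⬝ᵥ u.ofLp)) := by
    rw [inner_add_left, inner_trueParam, hin u]
    simp only [data, outNoise, outFeat]
    ring
  have hz : env.noiseUpTo l (epochLen l) s ⬝ᵥ u.ofLp = -(env.trueParam.ofLp ⬝ᵥ u.ofLp) +
      ∑ m, ∑ i : Fin (epochLen l), env.outNoise m (s (τ (l - 1) + i) m) *
          (env.outFeat m (s (τ (l - 1) + i) m) ⬝ᵥ u.ofLp) := by
    rw [noiseUpTo, add_dotProduct, neg_dotProduct, sum_dotProduct, Finset.sum_range,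
      Finset.sum_comm]
    congr 1
    refine Finset.sum_congr rfl fun i _ => ?_
    rw [obsNoise, sum_dotProduct]
    exact Finset.sum_congr rfl fun m _ => by rw [smul_dotProduct, smul_eq_mul]
  rw [dotProduct_gramUpTo_mulVec, hz, Finset.sum_range, Finset.sum_range, ridgeLoss, hnorm,
    Finset.sum_comm, Finset.sum_comm (s := Finset.univ (α := Fin (epochLen l))), mul_add,
    ← Finset.mul_sum, ← mul_assoc, ← mul_assoc, reg, mul_one_div_cancel hn', one_mul, one_mul]
  simp only [hres, Finset.sum_sub_distrib, Finset.sum_add_distrib, ← Finset.mul_sum]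
  ring

/-- The regularized least squares error is bounded along every trajectory with bounded noise: it is
the amount by which the objective, multiplied by the number of samples, decreases from the true
parameter to the minimizer. -/
lemma noise_inv_gram_le (env : Env M K d b X) {l : ℕ} (hn : M * epochLen l ≠ 0)
    (s : ℕ → Step K X) (hs : ∀ t m, |env.outNoise m (s t m)| ≤ 1) :
    env.noiseUpTo l (epochLen l) s ⬝ᵥ (env.gramUpTo l (epochLen l) s)⁻¹ *ᵥ
      env.noiseUpTo l (epochLen l) s ≤ (M * epochLen l : ℕ) + dTilde d b := by
  set A := env.gramUpTo l (epochLen l) s with hA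
  set z := env.noiseUpTo l (epochLen l) s with hz
  have hdom : DominatesOne A := env.dominatesOne_gramUpTo l _ s
  have h := env.mul_ridgeLoss_eq hn s (env.trueParam + WithLp.toLp 2 (A⁻¹ *ᵥ z))
  rw [add_sub_cancel_left] at h
  simp only [← hA, ← hz] at h
  rw [hdom.quadratic_eq, sub_self, zero_dotProduct, zero_sub] at h
  have h0 : 0 ≤ ((M * epochLen l : ℕ) : ℝ) * env.ridgeLoss (reg M (epochLen l)) (data l s)
      (env.trueParam + WithLp.toLp 2 (A⁻¹ *ᵥ z)) := by
    have := reg_nonneg M (epochLen l)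
    unfold ridgeLoss
    positivity
  have h1 : ∑ i ∈ Finset.range (epochLen l), ∑ m, env.outNoise m (s (τ (l - 1) + i) m) ^ 2 ≤
      (M * epochLen l : ℕ) := by
    calc _ ≤ ∑ _i ∈ Finset.range (epochLen l), ∑ _m : Fin M, (1 : ℝ) :=
          Finset.sum_le_sum fun i _ => Finset.sum_le_sum fun m _ => by
            rw [← sq_abs]; exact pow_le_one₀ (abs_nonneg _) (hs _ _)
      _ = _ := by simp; ring
  linarith [env.norm_trueParam_sq_le]

lemma rounds_sq_ge {cρ : ℝ} (hρ : 0 < cρ) (M d l : ℕ) :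
    cρ ^ 2 * (M * epochLen l : ℕ) ≤ 4 * ((rounds M d cρ l : ℝ) + 2) ^ 2 := by
  have h1 : 1 / 2 ≤ Real.log ((max d 2 : ℕ) : ℝ) := by
    have h1 : Real.log 2 ≤ Real.log ((max d 2 : ℕ) : ℝ) :=
      Real.log_le_log (by norm_num) (by exact_mod_cast le_max_right d 2)
    linarith [Real.log_two_gt_d9]
  set r := √((M * epochLen l : ℕ) : ℝ) with hr
  have h2 : cρ * r * Real.log ((max d 2 : ℕ) : ℝ) ≤ rounds M d cρ l := Nat.le_ceil _
  have h3 : cρ * r * (1 / 2) ≤ cρ * r * Real.log ((max d 2 : ℕ) : ℝ) := by gcongr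
  have h4 : r ^ 2 = (M * epochLen l : ℕ) := Real.sq_sqrt (Nat.cast_nonneg _)
  have h5 : (cρ * r * (1 / 2)) ^ 2 ≤ ((rounds M d cρ l : ℝ) + 2) ^ 2 :=
    pow_le_pow_left₀ (by positivity) (by linarith) 2
  rw [← h4]
  linarith

/-- The error of the computed parameter in the norm of the regularized Gram matrix: the number of
rounds is chosen such that the optimization error is of the order of the statistical error. -/
lemma quadForm_estimate_sub_le (env : Env M K d b X) {cρ : ℝ} (hρ : 0 < cρ) (hM : 1 ≤ M) {l : ℕ}
    (hl : 1 ≤ l) (s : ℕ → Step K X) :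
    (env.estimate cρ (l + 1) s - env.trueParam).ofLp ⬝ᵥ env.gramUpTo l (epochLen l) s *ᵥ
      (env.estimate cρ (l + 1) s - env.trueParam).ofLp ≤
    (2 + 256 / cρ ^ 2) * (env.noiseUpTo l (epochLen l) s ⬝ᵥ
      (env.gramUpTo l (epochLen l) s)⁻¹ *ᵥ env.noiseUpTo l (epochLen l) s + dTilde d b) := by
  have hn1 : 1 ≤ M * epochLen l := Nat.mul_pos hM (one_le_epochLen hl)
  have hn : M * epochLen l ≠ 0 := by omega
  have he : env.estimate cρ (l + 1) s = env.flOutput (data l s) (rounds M d cρ l) := by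
    rw [estimate, if_neg (by omega)]
    rfl
  rw [he]
  have hk := rounds_sq_ge hρ M d l
  set k := rounds M d cρ l
  set A := env.gramUpTo l (epochLen l) s with hA
  set z := env.noiseUpTo l (epochLen l) s with hz
  set f := env.ridgeLoss (reg M (epochLen l)) (data l s) with hf
  set n : ℝ := ((M * epochLen l : ℕ) : ℝ) with hnn
  have hn1' : 1 ≤ n := by rw [hnn]; exact_mod_cast hn1
  have hdom : DominatesOne A := env.dominatesOne_gramUpTo l _ s
  set u : EuclideanSpace ℝ (Coord d b) := WithLp.toLp 2 (A⁻¹ *ᵥ z) with hu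
  set Ψ := z ⬝ᵥ A⁻¹ *ᵥ z with hΨ
  have hΨ0 : 0 ≤ Ψ := hdom.dotProduct_inv_nonneg z
  have hAu : u.ofLp ⬝ᵥ A *ᵥ u.ofLp = Ψ := by
    rw [hu, hdom.mulVec_inv_mulVec, dotProduct_comm]
  set w' := env.trueParam + u with hw'
  -- `w'` is the minimizer of the objective
  have hdiff (w : EuclideanSpace ℝ (Coord d b)) :
      n * (f w - f w') = (w - w').ofLp ⬝ᵥ A *ᵥ (w - w').ofLp := by
    have h1 := env.mul_ridgeLoss_eq hn s w
    have h2 := env.mul_ridgeLoss_eq hn s w'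
    have h3 : w' - env.trueParam = u := by rw [hw', add_sub_cancel_left]
    have h4 : (w - env.trueParam).ofLp - A⁻¹ *ᵥ z = (w - w').ofLp := by
      
      rw [hw', sub_add_eq_sub_sub]
      rfl
    rw [h3] at h2
    simp only [← hA, ← hz, ← hf, ← hnn] at h1 h2
    rw [hdom.quadratic_eq, h4] at h1
    rw [hdom.quadratic_eq, sub_self, zero_dotProduct, zero_sub] at h2
    rw [mul_sub]
    linarith
  have hnn0 (w : EuclideanSpace ℝ (Coord d b)) : f w' ≤ f w := by
    have := hdom.dotProduct_mulVec_nonneg (w - w').ofLp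
    rw [← hdiff] at this
    nlinarith
  have hselfdot (w : EuclideanSpace ℝ (Coord d b)) : w.ofLp ⬝ᵥ w.ofLp = ‖w‖ ^ 2 := by
    rw [EuclideanSpace.real_norm_sq_eq]
    exact Finset.sum_congr rfl fun c _ => (sq _).symm
  have hsm : smooth M (epochLen l) / 2 * n = n + 1 := by
    rw [smooth, reg, ← hnn]; field_simp
  have hf0 : n * (f 0 - f w') ≤ (n + 1) * ‖w'‖ ^ 2 := by
    rw [hdiff, zero_sub, ← norm_neg w', ← hselfdot]
    have := env.gramUpTo_le l (epochLen l) s (-w').ofLp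
    rw [add_comm] at this
    exact this
  have hagd := env.agd_ridgeLoss_le (data l s) k w' (hnn0 0)
  rw [← hf] at hagd
  have hopt : (env.flOutput (data l s) k - w').ofLp ⬝ᵥ A *ᵥ
      (env.flOutput (data l s) k - w').ofLp ≤ 64 / cρ ^ 2 * ‖w'‖ ^ 2 := by
    rw [← hdiff]
    have hk0 : 0 < ((k : ℝ) + 2) ^ 2 := by positivity
    calc n * (f (env.flOutput (data l s) k) - f w') ≤ n * (4 / ((k : ℝ) + 2) ^ 2 *
          (f 0 - f w' + smooth M (epochLen l) / 2 * ‖w'‖ ^ 2)) := by gcongr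
      _ = 4 / ((k : ℝ) + 2) ^ 2 * (n * (f 0 - f w') +
          (smooth M (epochLen l) / 2 * n) * ‖w'‖ ^ 2) := by ring
      _ ≤ 4 / ((k : ℝ) + 2) ^ 2 * ((n + 1) * ‖w'‖ ^ 2 + (n + 1) * ‖w'‖ ^ 2) := by
          rw [hsm]; gcongr
      _ ≤ 4 / ((k : ℝ) + 2) ^ 2 * (4 * n * ‖w'‖ ^ 2) := by
          gcongr
          nlinarith [sq_nonneg ‖w'‖]
      _ = 16 * n / ((k : ℝ) + 2) ^ 2 * ‖w'‖ ^ 2 := by ring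
      _ ≤ 64 / cρ ^ 2 * ‖w'‖ ^ 2 := by
          refine mul_le_mul_of_nonneg_right ?_ (sq_nonneg _)
          rw [div_le_div_iff₀ hk0 (by positivity)]
          linarith
  have hw'n : ‖w'‖ ^ 2 ≤ 2 * dTilde d b + 2 * Ψ := by
    have h1 : ‖u‖ ^ 2 ≤ Ψ := by rw [← hselfdot, ← hAu]; exact hdom.le _
    have h2 := env.norm_trueParam_sq_le
    have h3 : ‖w'‖ ≤ ‖env.trueParam‖ + ‖u‖ := norm_add_le _ _
    nlinarith [norm_nonneg w', sq_nonneg (‖env.trueParam‖ - ‖u‖), norm_nonneg u,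
      norm_nonneg env.trueParam]
  have hsplit : (env.flOutput (data l s) k - env.trueParam).ofLp =
      (env.flOutput (data l s) k - w').ofLp + u.ofLp := by
    rw [← WithLp.ofLp_add, hw']
    congr 1
    abel
  rw [hsplit]
  refine (hdom.quadForm_add_le _ _).trans ?_
  rw [hAu]
  have h5 : 64 / cρ ^ 2 * ‖w'‖ ^ 2 ≤ 64 / cρ ^ 2 * (2 * dTilde d b + 2 * Ψ) := by gcongr
  have h6 : (0 : ℝ) ≤ dTilde d b := Nat.cast_nonneg _
  calc _ ≤ 2 * (64 / cρ ^ 2 * (2 * dTilde d b + 2 * Ψ)) + 2 * Ψ := by linarith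
    _ ≤ _ := by
      have : 2 * (64 / cρ ^ 2 * (2 * dTilde d b + 2 * Ψ)) =
        256 / cρ ^ 2 * (Ψ + dTilde d b) := by ring
      rw [this, add_mul]
      linarith

end Env

/-! ### Prediction error of the computed parameter -/

namespace Env

variable {M K d : ℕ} {b : Fin M → ℕ} {X : Fin M → Type*} [∀ m, MeasurableSpace (X m)]

open Matrix

/-- The mean squared prediction error, in an independent time step of epoch `l` and summed over
the agents, of the parameter that is computed from the data of epoch `l`. -/
def predError (env : Env M K d b X) (sel : (Fin K → ℝ) → Fin K) (cγ cρ : ℝ) (l : ℕ)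
    (s : ℕ → Step K X) : ℝ :=
  (env.estimate cρ (l + 1) s - env.trueParam).ofLp ⬝ᵥ
    env.popGram sel (rate M K d b cγ l) (env.estimate cρ l s) *ᵥ
    (env.estimate cρ (l + 1) s - env.trueParam).ofLp

lemma dotProduct_chernoffUpTo_mulVec (env : Env M K d b X) (sel : (Fin K → ℝ) → Fin K)
    (cγ cρ : ℝ) (l k : ℕ) (s : ℕ → Step K X) (v : Coord d b → ℝ) :
    v ⬝ᵥ env.chernoffUpTo sel cγ cρ l k s *ᵥ v =
      (1 / 10) * (k * (v ⬝ᵥ env.popGram sel (rate M K d b cγ l) (env.estimate cρ l s) *ᵥ v)) -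
      (1 / 4) * (v ⬝ᵥ env.gramUpTo l k s *ᵥ v - v ⬝ᵥ v) := by
  rw [chernoffUpTo, dotProduct_sum_mulVec, gramUpTo, add_mulVec, dotProduct_add, one_mulVec,
    add_sub_cancel_left, dotProduct_sum_mulVec]
  simp only [sub_mulVec, smul_mulVec, dotProduct_sub, dotProduct_smul, smul_eq_mul,
    Finset.sum_sub_distrib, Finset.sum_const, Finset.card_range, nsmul_eq_mul, Finset.mul_sum]
  ring

lemma dotProduct_popGram_mulVec_le (env : Env M K d b X) {sel : (Fin K → ℝ) → Fin K}
    (hsel : Measurable sel) (hmax : ∀ (v : Fin K → ℝ) (a : Fin K), v a ≤ v (sel v)) {γ : ℝ}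
    (hγ : 0 ≤ γ) (w : EuclideanSpace ℝ (Coord d b)) (v : Coord d b → ℝ) :
    v ⬝ᵥ env.popGram sel γ w *ᵥ v ≤ M * (v ⬝ᵥ v) := by
  have hp (m : Fin M) : IsProbabilityMeasure (env.agentLaw sel γ w m) :=
    env.isProbabilityMeasure_agentLaw hsel hmax hγ w m
  rw [popGram, dotProduct_sum_mulVec]
  calc _ ≤ ∑ _m : Fin M, v ⬝ᵥ v := Finset.sum_le_sum fun m _ =>
        dotProduct_secondMoment_mulVec_le (env.measurable_outFeat m)
          (env.outFeat_dotProduct_self_le m) v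
    _ = _ := by simp

section run
variable {env : Env M K d b X} {sel : (Fin K → ℝ) → Fin K} (hsel : Measurable sel)
  (hmax : ∀ (v : Fin K → ℝ) (a : Fin K), v a ≤ v (sel v)) {cγ cρ : ℝ} (hγ : 0 < cγ)

include hsel hmax hγ

/-- The prediction error along a trajectory, in terms of the two supermartingales of the epoch.
If `tr exp` of the Chernoff exponent is moderate, then the observed Gram matrix dominates the
expected one up to a logarithm; otherwise the prediction error is bounded trivially, at the price
of a small multiple of this trace. -/
lemma predError_le (hρ : 0 < cρ) (hM : 1 ≤ M) (hd : 1 ≤ dTilde d b) {l : ℕ} (hl : 1 ≤ l)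
    (s : ℕ → Step K X) (hs : ∀ t m, |env.outNoise m (s t m)| ≤ 1) {N : ℝ}
    (hN : N = (M * epochLen l : ℕ) + dTilde d b) :
    epochLen l * env.predError sel cγ cρ l s ≤
      (30 * Real.log N + 3) * (2 + 256 / cρ ^ 2) *
        (env.noiseUpTo l (epochLen l) s ⬝ᵥ (env.gramUpTo l (epochLen l) s)⁻¹ *ᵥ
          env.noiseUpTo l (epochLen l) s + dTilde d b) +
      2 * (2 + 256 / cρ ^ 2) / N *
        (NormedSpace.exp (env.chernoffUpTo sel cγ cρ l (epochLen l) s)).trace := by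
  have hn1 : 1 ≤ M * epochLen l := Nat.mul_pos hM (one_le_epochLen hl)
  have hn1' : (1 : ℝ) ≤ (M * epochLen l : ℕ) := by exact_mod_cast hn1
  have hd1 : (1 : ℝ) ≤ dTilde d b := by exact_mod_cast hd
  have hNE : Nonempty (Coord d b) := Fintype.card_pos_iff.1 (by rw [card_coord]; omega)
  have hq := env.quadForm_estimate_sub_le hρ hM hl s
  have hΨ := env.noise_inv_gram_le (l := l) (by omega) s hs
  have hch := env.dotProduct_chernoffUpTo_mulVec sel cγ cρ l (epochLen l) s
    (env.estimate cρ (l + 1) s - env.trueParam).ofLp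
  have hpop := env.dotProduct_popGram_mulVec_le hsel hmax (rate_nonneg (M := M) (K := K)
    (d := d) (b := b) hγ l) (env.estimate cρ l s)
    (env.estimate cρ (l + 1) s - env.trueParam).ofLp
  rw [predError]
  set v := (env.estimate cρ (l + 1) s - env.trueParam).ofLp with hv
  set A := env.gramUpTo l (epochLen l) s with hA
  set z := env.noiseUpTo l (epochLen l) s with hz
  set H := env.chernoffUpTo sel cγ cρ l (epochLen l) s with hH
  set Q := v ⬝ᵥ env.popGram sel (rate M K d b cγ l) (env.estimate cρ l s) *ᵥ v with hQ
  set C := 2 + 256 / cρ ^ 2 with hC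
  have hC0 : 0 ≤ C := by positivity
  have hHt : Hᵀ = H := env.transpose_chernoffUpTo sel cγ cρ l _ s
  have hlog := dotProduct_mulVec_le_log_trace_exp hHt v
  have hZ : 0 < (NormedSpace.exp H).trace := trace_exp_pos hHt
  set Z := (NormedSpace.exp H).trace with hZd
  have hdom : DominatesOne A := env.dominatesOne_gramUpTo l _ s
  have hvA : v ⬝ᵥ v ≤ v ⬝ᵥ A *ᵥ v := hdom.le v
  have hvv : 0 ≤ v ⬝ᵥ v := Finset.sum_nonneg fun _ _ => mul_self_nonneg _
  set Ψ := z ⬝ᵥ A⁻¹ *ᵥ z with hΨd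
  have hΨ0 : 0 ≤ Ψ := hdom.dotProduct_inv_nonneg z
  have hN1 : 1 ≤ N := by rw [hN]; linarith
  have hlogN : 0 ≤ Real.log N := Real.log_nonneg hN1
  -- by Markov's inequality `Z > N ^ 3` has probability at most `1 / N ^ 2`, while the prediction
  -- error times the length of the epoch never exceeds a multiple of `N ^ 2`
  rcases le_total Z (N ^ 3) with hcase | hcase
  · have h1 : Real.log Z ≤ 3 * Real.log N := by
      have h := Real.log_le_log hZ hcase
      rwa [Real.log_pow, Nat.cast_ofNat] at h
    have h2 : Real.log Z * (v ⬝ᵥ v) ≤ 3 * Real.log N * (v ⬝ᵥ A *ᵥ v) :=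
      (mul_le_mul_of_nonneg_right h1 hvv).trans
        (mul_le_mul_of_nonneg_left hvA (by positivity))
    have h3 : (epochLen l : ℝ) * Q ≤ (30 * Real.log N + 3) * (v ⬝ᵥ A *ᵥ v) := by
      nlinarith
    have h4 : (30 * Real.log N + 3) * (v ⬝ᵥ A *ᵥ v) ≤
        (30 * Real.log N + 3) * (C * (Ψ + dTilde d b)) :=
      mul_le_mul_of_nonneg_left hq (by positivity)
    have h5 : 0 ≤ 2 * C / N * Z := by positivity
    linarith
  · have h1 : (epochLen l : ℝ) * Q ≤ (M * epochLen l : ℕ) * (v ⬝ᵥ A *ᵥ v) := by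
      calc (epochLen l : ℝ) * Q ≤ epochLen l * (M * (v ⬝ᵥ v)) := by gcongr
        _ = (M * epochLen l : ℕ) * (v ⬝ᵥ v) := by push_cast; ring
        _ ≤ _ := by gcongr
    have h2 : ((M * epochLen l : ℕ) : ℝ) * (v ⬝ᵥ A *ᵥ v) ≤ N * (C * (2 * N)) := by
      have hle : ((M * epochLen l : ℕ) : ℝ) ≤ N := by rw [hN]; linarith
      refine mul_le_mul hle (hq.trans ?_) (hvv.trans hvA) (by linarith)
      gcongr
      rw [hN]
      linarith
    have h3 : N * (C * (2 * N)) ≤ 2 * C / N * Z := by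
      calc N * (C * (2 * N)) = 2 * C / N * N ^ 3 := by field_simp
        _ ≤ _ := by gcongr
    have h4 : 0 ≤ (30 * Real.log N + 3) * C * (Ψ + dTilde d b) := by positivity
    linarith

/-- The expected prediction error after an epoch; multiplied by the length of the epoch, it is of
the order of the dimension. -/
lemma IsRun.lintegral_predError_le {Ω : Type*} [MeasurableSpace Ω] {P : Measure Ω}
    {s : ℕ → Ω → Step K X} [IsProbabilityMeasure P] (h : env.IsRun sel cγ cρ P s)
    (hρ : 0 < cρ) (hM : 1 ≤ M) (hd : 1 ≤ dTilde d b) {l : ℕ} (hl : 1 ≤ l) {Λ : ℝ} (hΛ : 1 ≤ Λ)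
    (h1 : Real.log (1 + (M * epochLen l : ℕ)) ≤ Λ)
    (h2 : Real.log ((M * epochLen l : ℕ) + dTilde d b) ≤ 2 * Λ) :
    ∫⁻ ω, ENNReal.ofReal (epochLen l * env.predError sel cγ cρ l fun i => s i ω) ∂P ≤
      ENNReal.ofReal (191 * (2 + 256 / cρ ^ 2) * dTilde d b * Λ ^ 2) := by
  have hd1 : (1 : ℝ) ≤ dTilde d b := by exact_mod_cast hd
  have hNE : Nonempty (Coord d b) := Fintype.card_pos_iff.1 (by rw [card_coord]; omega)
  set N : ℝ := (M * epochLen l : ℕ) + dTilde d b with hN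
  set C := 2 + 256 / cρ ^ 2 with hC
  have hC0 : 0 ≤ C := by positivity
  have hN1 : 1 ≤ N := by
    have : (0 : ℝ) ≤ (M * epochLen l : ℕ) := Nat.cast_nonneg _
    linarith
  have hlogN : 0 ≤ Real.log N := Real.log_nonneg hN1
  set D := dTilde d b * Real.log (1 + (M * epochLen l : ℕ)) with hD
  set a := (30 * Real.log N + 3) * C with ha
  have ha0 : 0 ≤ a := by positivity
  have hD0 : 0 ≤ D := mul_nonneg (by linarith) (Real.log_nonneg (by
    linarith [(Nat.cast_nonneg (M * epochLen l) : (0 : ℝ) ≤ _)]))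
  have hs : Measurable fun ω => fun i => s i ω := measurable_pi_lambda _ h.meas
  set Φ : Ω → ℝ := fun ω => ridgePotential D (env.gramUpTo l (epochLen l) fun i => s i ω)
    (env.noiseUpTo l (epochLen l) fun i => s i ω) with hΦ
  set Z : Ω → ℝ := fun ω =>
    (NormedSpace.exp (env.chernoffUpTo sel cγ cρ l (epochLen l) fun i => s i ω)).trace with hZ
  have hΦm : Measurable Φ := (measurable_ridgePotential D (env.measurable_gramUpTo l (epochLen l))
    (env.measurable_noiseUpTo l (epochLen l))).comp hs
  have hZm : Measurable Z := (measurable_of_continuous_matrix continuous_trace_exp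
    (env.measurable_chernoffUpTo hsel hmax hγ cρ l (epochLen l))).comp hs
  have hEΦ : ∫⁻ ω, ENNReal.ofReal (Φ ω) ∂P ≤ ENNReal.ofReal (dTilde d b + D) :=
    h.lintegral_ridgePotential_le hsel hmax hγ hl le_rfl le_rfl
  have hEZ : ∫⁻ ω, ENNReal.ofReal (Z ω) ∂P ≤ ENNReal.ofReal (dTilde d b) := by
    rw [ENNReal.ofReal_natCast]
    exact h.lintegral_trace_exp_chernoff_le hsel hmax hγ hl le_rfl
  calc ∫⁻ ω, ENNReal.ofReal (epochLen l * env.predError sel cγ cρ l fun i => s i ω) ∂P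
      ≤ ∫⁻ ω, (ENNReal.ofReal a * ENNReal.ofReal (Φ ω) + ENNReal.ofReal (a * dTilde d b) +
          ENNReal.ofReal (2 * C / N) * ENNReal.ofReal (Z ω)) ∂P := by
        refine lintegral_mono_ae ((h.ae_abs_outNoise_le hsel hmax hγ).mono fun ω hω => ?_)
        have hdom := env.dominatesOne_gramUpTo l (epochLen l) fun i => s i ω
        have hdet : Real.log (env.gramUpTo l (epochLen l) fun i => s i ω).det ≤ D := by
          rw [hD, ← card_coord (b := b)]
          exact hdom.log_det_le (env.gramUpTo_le l (epochLen l) _)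
        have hΦ0 := hdom.dotProduct_inv_nonneg (env.noiseUpTo l (epochLen l) fun i => s i ω)
        have key := predError_le hsel hmax hγ hρ hM hd hl (fun i => s i ω) hω hN (env := env)
        have hle : env.noiseUpTo l (epochLen l) (fun i => s i ω) ⬝ᵥ
            (env.gramUpTo l (epochLen l) fun i => s i ω)⁻¹ *ᵥ
              env.noiseUpTo l (epochLen l) (fun i => s i ω) ≤ Φ ω := by
          simp only [hΦ, ridgePotential]
          linarith
        have hΦ1 : 0 ≤ Φ ω := hΦ0.trans hle
        have hZ0 : 0 ≤ Z ω := (trace_exp_pos (env.transpose_chernoffUpTo sel cγ cρ l _ _)).le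
        rw [← ENNReal.ofReal_mul ha0, ← ENNReal.ofReal_mul (by positivity),
          ← ENNReal.ofReal_add (by positivity) (by positivity),
          ← ENNReal.ofReal_add (by positivity) (by positivity)]
        refine ENNReal.ofReal_le_ofReal (key.trans ?_)
        have := mul_le_mul_of_nonneg_left hle ha0
        rw [← ha, mul_add]
        linarith
    _ = ENNReal.ofReal a * ∫⁻ ω, ENNReal.ofReal (Φ ω) ∂P + ENNReal.ofReal (a * dTilde d b) +
          ENNReal.ofReal (2 * C / N) * ∫⁻ ω, ENNReal.ofReal (Z ω) ∂P := by
        rw [lintegral_add_right _ (hZm.ennreal_ofReal.const_mul _),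
          lintegral_add_right _ measurable_const, lintegral_const_mul _ hΦm.ennreal_ofReal,
          lintegral_const_mul _ hZm.ennreal_ofReal]
        simp
    _ ≤ ENNReal.ofReal a * ENNReal.ofReal (dTilde d b + D) + ENNReal.ofReal (a * dTilde d b) +
          ENNReal.ofReal (2 * C / N) * ENNReal.ofReal (dTilde d b) := by gcongr
    _ = ENNReal.ofReal (a * (dTilde d b + D) + a * dTilde d b + 2 * C / N * dTilde d b) := by
        rw [← ENNReal.ofReal_mul ha0, ← ENNReal.ofReal_mul (by positivity),
          ← ENNReal.ofReal_add (by positivity) (by positivity),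
          ← ENNReal.ofReal_add (by positivity) (by positivity)]
    _ ≤ _ := by
        refine ENNReal.ofReal_le_ofReal ?_
        have h3 : a ≤ 63 * C * Λ := by
          rw [ha]
          have : 30 * Real.log N + 3 ≤ 63 * Λ := by linarith
          calc _ ≤ 63 * Λ * C := by gcongr
            _ = _ := by ring
        have h4 : 2 * C / N * dTilde d b ≤ 2 * C * dTilde d b * Λ ^ 2 := by
          have h5 : 2 * C / N ≤ 2 * C := div_le_self (by positivity) hN1
          calc 2 * C / N * dTilde d b ≤ 2 * C * dTilde d b * 1 := by rw [mul_one]; gcongr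
            _ ≤ _ := by gcongr; exact one_le_pow₀ hΛ
        have h6 : dTilde d b + D + dTilde d b ≤ 3 * dTilde d b * Λ := by
          have : D ≤ dTilde d b * Λ := by rw [hD]; gcongr
          nlinarith
        calc a * (dTilde d b + D) + a * dTilde d b + 2 * C / N * dTilde d b
            = a * (dTilde d b + D + dTilde d b) + 2 * C / N * dTilde d b := by ring
          _ ≤ 63 * C * Λ * (3 * dTilde d b * Λ) + 2 * C * dTilde d b * Λ ^ 2 :=
              add_le_add (mul_le_mul h3 h6 (by positivity) (by positivity)) h4
          _ = _ := by ring

end run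

end Env

/-! ### The regret of one time step -/

lemma epochLen_mono {l l' : ℕ} (h : l ≤ l') : epochLen l ≤ epochLen l' := by
  induction l', h using Nat.le_induction with
  | base => exact le_rfl
  | succ j _ ih =>
    refine ih.trans ?_
    rcases j with _ | _ | j
    · simp [epochLen]
    · simp [epochLen, τ]
    · have h1 : 2 ^ (j + 1 + 1) = 2 * 2 ^ (j + 1) := by ring
      have h2 : 2 ^ (j + 1 + 1 + 1) = 4 * 2 ^ (j + 1) := by ring
      simp only [epochLen, τ, Nat.add_sub_cancel, Nat.succ_ne_zero, if_false, h1, h2]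
      omega

/-- The epoch before that of a time step is not much shorter than the time that has elapsed. -/
lemma lt_four_mul_epochLen {j t : ℕ} (hj : 1 ≤ j) (ht : t < τ (j + 1)) :
    t + 1 ≤ 4 * epochLen j := by
  obtain ⟨i, rfl⟩ : ∃ i, j = i + 1 := ⟨j - 1, by omega⟩
  have h1 : 2 ^ (i + 1) = 2 * 2 ^ i := by ring
  have h2 : 2 ^ (i + 1 + 1) = 4 * 2 ^ i := by ring
  simp only [epochLen, τ, Nat.add_sub_cancel, Nat.succ_ne_zero, if_false, h1, h2] at ht ⊢
  rcases i with _ | i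
  · simp at ht ⊢; omega
  · simp only [Nat.succ_ne_zero, if_false] at ht ⊢; omega

namespace Env

variable {M K d : ℕ} {b : Fin M → ℕ} {X : Fin M → Type*} [∀ m, MeasurableSpace (X m)]

open Matrix

/-- The regret of agent `m` for playing the action `a` in the context `x`. -/
def gap (env : Env M K d b X) (m : Fin M) (x : X m) (a : Fin K) : ℝ :=
  (⨆ a, env.mean m x a) - env.mean m x a

lemma gap_nonneg (env : Env M K d b X) (m : Fin M) (x : X m) (a : Fin K) : 0 ≤ env.gap m x a :=
  sub_nonneg.2 (le_ciSup (Finite.bddAbove_range _) a)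

lemma gap_le_one (env : Env M K d b X) (m : Fin M) (x : X m) (a : Fin K) :
    env.gap m x a ≤ 1 := by
  have : Nonempty (Fin K) := ⟨a⟩
  have h1 : ⨆ a, env.mean m x a ≤ 1 := ciSup_le fun a => (env.mean_mem m x a).2
  have h2 := (env.mean_mem m x a).1
  unfold gap
  linarith

lemma measurable_gap (env : Env M K d b X) (m : Fin M) (a : Fin K) :
    Measurable fun x => env.gap m x a :=
  (Measurable.iSup fun a => env.measurable_mean m a).sub (env.measurable_mean m a)

lemma rate_mono {cγ : ℝ} (hγ : 0 < cγ) {l l' : ℕ} (h : l ≤ l') :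
    rate M K d b cγ l ≤ rate M K d b cγ l' := by
  unfold rate
  have : epochLen (l - 1) ≤ epochLen (l' - 1) := epochLen_mono (by omega)
  gcongr

/-- The error in the comparison of true and estimated regret of epoch `j + 1`, in the context `x`
of agent `m`; everything is multiplied by the learning rate. -/
def gapError (env : Env M K d b X) (sel : (Fin K → ℝ) → Fin K) (cγ cρ : ℝ)
    (s : ℕ → Step K X) (m : Fin M) (x : X m) : ℕ → ℝ
  | 0 => 0
  | j + 1 => env.gapError sel cγ cρ s m x j / 2 + K / 2 + 8 * rate M K d b cγ (j + 2) ^ 2 *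
      ∑ a, env.policy sel (rate M K d b cγ (j + 1)) (env.estimate cρ (j + 1) s) m x a *
        (inner ℝ (env.estimate cρ (j + 2) s) (env.featTilde m x a) - env.mean m x a) ^ 2

section
variable (env : Env M K d b X) {sel : (Fin K → ℝ) → Fin K} (hsel : Measurable sel)
  (hmax : ∀ (v : Fin K → ℝ) (a : Fin K), v a ≤ v (sel v)) {cγ : ℝ} (hγ : 0 < cγ) (cρ : ℝ)
  (s : ℕ → Step K X)

include hmax hγ

lemma gapError_nonneg (m : Fin M) (x : X m) (j : ℕ) : 0 ≤ env.gapError sel cγ cρ s m x j := by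
  induction j with
  | zero => exact le_rfl
  | succ j ih =>
    have : 0 ≤ ∑ a, env.policy sel (rate M K d b cγ (j + 1)) (env.estimate cρ (j + 1) s) m x a *
        (inner ℝ (env.estimate cρ (j + 2) s) (env.featTilde m x a) - env.mean m x a) ^ 2 :=
      Finset.sum_nonneg fun a _ =>
        mul_nonneg (env.policy_nonneg hmax (rate_nonneg hγ _) _ m x a) (sq_nonneg _)
    rw [gapError]
    positivity

/-- In every epoch the true and the estimated regret are comparable up to `gapError`. -/
lemma gap_transfer (m : Fin M) (x : X m) (j : ℕ) (a : Fin K) :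
    rate M K d b cγ (j + 1) *
        (inner ℝ (env.estimate cρ (j + 1) s) (env.featTilde m x
          (sel fun a' => inner ℝ (env.estimate cρ (j + 1) s) (env.featTilde m x a'))) -
          inner ℝ (env.estimate cρ (j + 1) s) (env.featTilde m x a)) ≤
      2 * (rate M K d b cγ (j + 1) * env.gap m x a) + env.gapError sel cγ cρ s m x j ∧
    rate M K d b cγ (j + 1) * env.gap m x a ≤
      2 * (rate M K d b cγ (j + 1) *
        (inner ℝ (env.estimate cρ (j + 1) s) (env.featTilde m x
          (sel fun a' => inner ℝ (env.estimate cρ (j + 1) s) (env.featTilde m x a'))) -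
          inner ℝ (env.estimate cρ (j + 1) s) (env.featTilde m x a))) +
        env.gapError sel cγ cρ s m x j := by
  induction j generalizing a with
  | zero =>
    -- the learning rate of the first epoch is zero
    have h0 : rate M K d b cγ (0 + 1) = 0 := by simp [rate, epochLen]
    simp [h0, gapError]
  | succ j ih =>
    exact igw_transfer hmax (rate_nonneg hγ (j + 1)) (rate_mono hγ (by omega))
      (μ := fun a => env.mean m x a)
      (f := fun a => inner ℝ (env.estimate cρ (j + 1) s) (env.featTilde m x a))
      (fun a => inner ℝ (env.estimate cρ (j + 2) s) (env.featTilde m x a))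
      (env.gapError_nonneg hmax hγ cρ s m x j) (fun a => (ih a).1) a

include hsel

/-- In expectation over the context, the mean squared error in the recursion of `gapError` is the
prediction error. -/
lemma lintegral_gapError_succ_le (j : ℕ) :
    ∑ m, ∫⁻ x, ENNReal.ofReal (env.gapError sel cγ cρ s m x (j + 1)) ∂(env.ctx m) ≤
      ENNReal.ofReal (1 / 2) *
        ∑ m, ∫⁻ x, ENNReal.ofReal (env.gapError sel cγ cρ s m x j) ∂(env.ctx m) +
      ENNReal.ofReal (M * (K / 2)) + ENNReal.ofReal (8 * rate M K d b cγ (j + 2) ^ 2) *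
        ENNReal.ofReal (env.predError sel cγ cρ (j + 1) s) := by
  have hr := rate_nonneg (M := M) (K := K) (d := d) (b := b) hγ (j + 1)
  have hsq (m : Fin M) (x : X m) (a : Fin K) :
      (inner ℝ (env.estimate cρ (j + 2) s) (env.featTilde m x a) - env.mean m x a) ^ 2 =
        ((env.featTilde m x a).ofLp ⬝ᵥ
          (env.estimate cρ (j + 2) s - env.trueParam).ofLp) ^ 2 := by
    rw [← inner_trueParam, ← inner_sub_left, PiLp.inner_apply]
    rfl
  have hm (m : Fin M) : Measurable fun x =>
      ∑ a, env.policy sel (rate M K d b cγ (j + 1)) (env.estimate cρ (j + 1) s) m x a *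
        (inner ℝ (env.estimate cρ (j + 2) s) (env.featTilde m x a) - env.mean m x a) ^ 2 :=
    Finset.measurable_fun_sum _ fun a _ => (env.measurable_policy_right hsel _ _ m a).mul
      (((measurable_const.inner (env.measurable_featTilde m a)).sub
        (env.measurable_mean m a)).pow_const 2)
  rw [predError, env.dotProduct_popGram_mulVec hsel hmax hr, Finset.mul_sum, Finset.mul_sum]
  have hconst : ENNReal.ofReal (M * (K / 2)) = ∑ _m : Fin M, ENNReal.ofReal (K / 2) := by
    rw [ENNReal.ofReal_mul (Nat.cast_nonneg _)]
    simp
  rw [hconst, ← Finset.sum_add_distrib, ← Finset.sum_add_distrib]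
  refine Finset.sum_le_sum fun m _ => ?_
  simp only [← hsq]
  have hS (x : X m) : 0 ≤ ∑ a, env.policy sel (rate M K d b cγ (j + 1))
      (env.estimate cρ (j + 1) s) m x a *
        (inner ℝ (env.estimate cρ (j + 2) s) (env.featTilde m x a) - env.mean m x a) ^ 2 :=
    Finset.sum_nonneg fun a _ => mul_nonneg (env.policy_nonneg hmax hr _ m x a) (sq_nonneg _)
  rw [← lintegral_const_mul' _ _ ENNReal.ofReal_ne_top,
    ← lintegral_const_mul _ (hm m).ennreal_ofReal]
  have hc : ENNReal.ofReal (K / 2) = ∫⁻ _x, ENNReal.ofReal (K / 2) ∂(env.ctx m) := by simp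
  rw [hc, ← lintegral_add_right _ measurable_const,
    ← lintegral_add_right _ ((hm m).ennreal_ofReal.const_mul _)]
  refine lintegral_mono fun x => le_of_eq ?_
  have h0 := env.gapError_nonneg hmax hγ cρ s m x j
  rw [← ENNReal.ofReal_mul (by norm_num), ← ENNReal.ofReal_mul (by positivity),
    ← ENNReal.ofReal_add (by positivity) (by positivity),
    ← ENNReal.ofReal_add (by positivity) (mul_nonneg (by positivity) (hS x)), gapError]
  congr 1
  ring

/-- The expected regret of a time step of epoch `j + 1` given the past: by `gap_transfer` it is at
most twice the estimated regret, which is small by construction, plus `gapError`. -/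
lemma rate_mul_lintegral_gap_le (j : ℕ) :
    ENNReal.ofReal (rate M K d b cγ (j + 1)) *
        ∫⁻ o, ∑ m, ENNReal.ofReal (env.gap m (o m).1 (o m).2.2)
        ∂(Measure.pi fun m =>
          env.agentLaw sel (rate M K d b cγ (j + 1)) (env.estimate cρ (j + 1) s) m) ≤
      ENNReal.ofReal (2 * K * M) +
        ∑ m, ∫⁻ x, ENNReal.ofReal (env.gapError sel cγ cρ s m x j) ∂(env.ctx m) := by
  set γ := rate M K d b cγ (j + 1) with hγd
  set w := env.estimate cρ (j + 1) s with hw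
  have hr : 0 ≤ γ := rate_nonneg hγ (j + 1)
  have hp (m : Fin M) : IsProbabilityMeasure (env.agentLaw sel γ w m) :=
    env.isProbabilityMeasure_agentLaw hsel hmax hr w m
  have hgm (m : Fin M) : Measurable fun o : X m × (Fin K → ℝ) × Fin K =>
      ENNReal.ofReal (env.gap m o.1 o.2.2) :=
    (measurable_outcome (g := fun x _ a => env.gap m x a) fun a =>
      (env.measurable_gap m a).comp measurable_fst).ennreal_ofReal
  rw [lintegral_finsetSum
    (f := fun m (o : Step K X) => ENNReal.ofReal (env.gap m (o m).1 (o m).2.2))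
    _ fun m _ => (hgm m).comp (measurable_pi_apply m), Finset.mul_sum]
  have hconst : ENNReal.ofReal (2 * K * M) = ∑ _m : Fin M, ENNReal.ofReal (2 * K) := by
    rw [mul_comm, ENNReal.ofReal_mul (Nat.cast_nonneg _)]
    simp
  rw [hconst, ← Finset.sum_add_distrib]
  refine Finset.sum_le_sum fun m _ => ?_
  rw [(measurePreserving_eval (fun m => env.agentLaw sel γ w m) m).lintegral_comp (hgm m),
    env.lintegral_agentLaw_of_nonneg hsel hmax hr w m (env.measurable_gap m) (env.gap_nonneg m),
    ← lintegral_const_mul' _ _ ENNReal.ofReal_ne_top]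
  have hc : ENNReal.ofReal (2 * K) = ∫⁻ _x, ENNReal.ofReal (2 * K) ∂(env.ctx m) := by simp
  rw [hc, ← lintegral_add_left measurable_const]
  refine lintegral_mono fun x => ?_
  have h0 := env.gapError_nonneg hmax hγ cρ s m x j
  rw [← ENNReal.ofReal_mul hr, ← ENNReal.ofReal_add (by positivity) h0]
  refine ENNReal.ofReal_le_ofReal ?_
  have h1 := sum_igw_mul_gap_le hmax hr fun a => inner ℝ w (env.featTilde m x a)
  calc γ * ∑ a, env.policy sel γ w m x a * env.gap m x a
      = ∑ a, env.policy sel γ w m x a * (γ * env.gap m x a) := by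
        rw [Finset.mul_sum]
        exact Finset.sum_congr rfl fun a _ => by ring
    _ ≤ ∑ a, env.policy sel γ w m x a * (2 * (γ * (inner ℝ w (env.featTilde m x
          (sel fun a' => inner ℝ w (env.featTilde m x a'))) - inner ℝ w (env.featTilde m x a))) +
        env.gapError sel cγ cρ s m x j) :=
        Finset.sum_le_sum fun a _ => mul_le_mul_of_nonneg_left
          (env.gap_transfer hmax hγ cρ s m x j a).2 (env.policy_nonneg hmax hr w m x a)
    _ = 2 * ∑ a, env.policy sel γ w m x a * (γ * (inner ℝ w (env.featTilde m x
          (sel fun a' => inner ℝ w (env.featTilde m x a'))) - inner ℝ w (env.featTilde m x a))) +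
        (∑ a, env.policy sel γ w m x a) * env.gapError sel cγ cρ s m x j := by
        rw [Finset.mul_sum, Finset.sum_mul, ← Finset.sum_add_distrib]
        exact Finset.sum_congr rfl fun a _ => by ring
    _ ≤ _ := by
        rw [sum_policy, one_mul]
        unfold policy
        linarith

lemma measurable_predError (l : ℕ) : Measurable fun s => env.predError sel cγ cρ l s :=
  have hv : Measurable fun s : ℕ → Step K X =>
      (env.estimate cρ (l + 1) s - env.trueParam).ofLp :=
    (WithLp.measurable_ofLp 2 _).comp ((env.measurable_estimate cρ (l + 1)).sub_const _)
  measurable_dotProduct_mulVec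
    (A := fun s => env.popGram sel (rate M K d b cγ l) (env.estimate cρ l s)) (fun i j =>
      (env.measurable_popGram hsel hmax (rate_nonneg hγ l) i j).comp
        (env.measurable_estimate cρ l)) hv hv

end

end Env

/-! ### The expected regret -/

lemma sum_one_div_sqrt_le (T : ℕ) :
    ∑ t ∈ Finset.range T, 1 / √((t : ℝ) + 1) ≤ 2 * √(T : ℝ) := by
  induction T with
  | zero => simp
  | succ T ih =>
    rw [Finset.sum_range_succ]
    have h1 : 0 < √((T : ℝ) + 1) := Real.sqrt_pos.2 (by positivity)
    have h2 : √((T : ℝ) + 1) ^ 2 = T + 1 := Real.sq_sqrt (by positivity)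
    have h3 : √(T : ℝ) ^ 2 = T := Real.sq_sqrt (by positivity)
    have h4 : 1 / √((T : ℝ) + 1) ≤ 2 * (√((T : ℝ) + 1) - √(T : ℝ)) := by
      rw [div_le_iff₀ h1]
      nlinarith [sq_nonneg (√((T : ℝ) + 1) - √(T : ℝ))]
    push_cast
    linarith

namespace Env

variable {M K d : ℕ} {b : Fin M → ℕ} {X : Fin M → Type*} [∀ m, MeasurableSpace (X m)]

lemma pathRegret_nonneg (env : Env M K d b X) (T : ℕ) (u : ℕ → Step K X) :
    0 ≤ env.pathRegret T u :=
  Finset.sum_nonneg fun m _ => Finset.sum_nonneg fun _ _ => env.gap_nonneg m _ _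

lemma measurable_pathRegret (env : Env M K d b X) (T : ℕ) :
    Measurable fun u : ℕ → Step K X => env.pathRegret T u :=
  Finset.measurable_fun_sum _ fun m _ => Finset.measurable_fun_sum _ fun t _ =>
    (measurable_outcome (g := fun x _ a => env.gap m x a)
      fun a => (env.measurable_gap m a).comp measurable_fst).comp
        ((measurable_pi_apply m).comp (measurable_pi_apply t))

variable {env : Env M K d b X} {sel : (Fin K → ℝ) → Fin K} (hsel : Measurable sel)
  (hmax : ∀ (v : Fin K → ℝ) (a : Fin K), v a ≤ v (sel v)) {cγ cρ : ℝ} (hγ : 0 < cγ)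
  {Ω : Type*} [MeasurableSpace Ω] {P : Measure Ω} {s : ℕ → Ω → Step K X}
  [IsProbabilityMeasure P]

/-- The constant of the bound on the expectation of `gapError`, up to the logarithms; the factor
`1528 = 8 * 191` combines the recursion of `gapError` with the bound on the prediction error. -/
def gapConst (cγ cρ : ℝ) : ℝ := 3 + 2 * (1528 * cγ ^ 2 * (2 + 256 / cρ ^ 2))

lemma gapConst_pos (cγ cρ : ℝ) : 0 < gapConst cγ cρ := by unfold gapConst; positivity

include hsel hmax hγ

/-- The errors `gapError` stay bounded over the epochs, because each of them is half the previous
one plus a term of constant order. -/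
lemma IsRun.lintegral_gapError_le (h : env.IsRun sel cγ cρ P s) (hρ : 0 < cρ) (hM : 1 ≤ M)
    (hd : 1 ≤ dTilde d b) {J : ℕ} {Λ : ℝ} (hΛ : 1 ≤ Λ)
    (h1 : Real.log (1 + (M * τ J : ℕ)) ≤ Λ)
    (h2 : Real.log ((M * τ J : ℕ) + dTilde d b) ≤ 2 * Λ) (j : ℕ) (hj : j ≤ J) :
    ∫⁻ ω, ∑ m, ∫⁻ x, ENNReal.ofReal (env.gapError sel cγ cρ (fun i => s i ω) m x j)
        ∂(env.ctx m) ∂P ≤ ENNReal.ofReal (K * M * Λ ^ 2 * (gapConst cγ cρ - 2)) := by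
  induction j with
  | zero => simp [gapError]
  | succ j ih =>
    have hd1 : (1 : ℝ) ≤ dTilde d b := by exact_mod_cast hd
    have hs : Measurable fun ω => fun i => s i ω := measurable_pi_lambda _ h.meas
    have hlen : M * epochLen (j + 1) ≤ M * τ J := by
      have h3 := τ_pred_add_epochLen (j + 1)
      have h4 := τ_mono hj
      exact Nat.mul_le_mul_left _ (by omega)
    have hlen' : ((M * epochLen (j + 1) : ℕ) : ℝ) ≤ (M * τ J : ℕ) := by exact_mod_cast hlen
    have hp := h.lintegral_predError_le hsel hmax hγ hρ hM hd (l := j + 1) (by omega) hΛ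
      ((Real.log_le_log (by positivity) (by linarith)).trans h1)
      ((Real.log_le_log (by positivity) (by linarith)).trans h2)
    set c := 1528 * cγ ^ 2 * (2 + 256 / cρ ^ 2) with hc
    have hc0 : 0 ≤ c := by positivity
    have hgc : gapConst cγ cρ - 2 = 1 + 2 * c := by rw [gapConst, ← hc]; ring
    rw [hgc] at ih ⊢
    have hpm : Measurable fun ω =>
        ENNReal.ofReal (env.predError sel cγ cρ (j + 1) fun i => s i ω) :=
      ((env.measurable_predError hsel hmax hγ cρ (j + 1)).comp hs).ennreal_ofReal
    have hrate : rate M K d b cγ (j + 2) ^ 2 =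
        cγ ^ 2 * (K * M / dTilde d b) * epochLen (j + 1) := by
      rw [rate, mul_pow, Real.sq_sqrt (by positivity)]
      push_cast
      ring
    have hlast : ENNReal.ofReal (8 * rate M K d b cγ (j + 2) ^ 2) *
        ∫⁻ ω, ENNReal.ofReal (env.predError sel cγ cρ (j + 1) fun i => s i ω) ∂P ≤
        ENNReal.ofReal (c * K * M * Λ ^ 2) := by
      have e : 8 * rate M K d b cγ (j + 2) ^ 2 =
          8 * cγ ^ 2 * (K * M / dTilde d b) * epochLen (j + 1) := by rw [hrate]; ring
      rw [e, ENNReal.ofReal_mul (by positivity), mul_assoc,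
        ← lintegral_const_mul' _ _ ENNReal.ofReal_ne_top]
      simp only [← ENNReal.ofReal_mul (Nat.cast_nonneg (epochLen (j + 1)))]
      refine (mul_le_mul_right hp _).trans ?_
      rw [← ENNReal.ofReal_mul (by positivity)]
      refine ENNReal.ofReal_le_ofReal (le_of_eq ?_)
      rw [hc]
      field_simp
      ring
    calc _ ≤ ∫⁻ ω, (ENNReal.ofReal (1 / 2) *
          ∑ m, ∫⁻ x, ENNReal.ofReal (env.gapError sel cγ cρ (fun i => s i ω) m x j) ∂(env.ctx m) +
          ENNReal.ofReal (M * (K / 2)) + ENNReal.ofReal (8 * rate M K d b cγ (j + 2) ^ 2) *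
          ENNReal.ofReal (env.predError sel cγ cρ (j + 1) fun i => s i ω)) ∂P :=
          lintegral_mono fun ω => env.lintegral_gapError_succ_le hsel hmax hγ cρ _ j
      _ = ENNReal.ofReal (1 / 2) * ∫⁻ ω, ∑ m, ∫⁻ x,
            ENNReal.ofReal (env.gapError sel cγ cρ (fun i => s i ω) m x j) ∂(env.ctx m) ∂P +
          ENNReal.ofReal (M * (K / 2)) + ENNReal.ofReal (8 * rate M K d b cγ (j + 2) ^ 2) *
          ∫⁻ ω, ENNReal.ofReal (env.predError sel cγ cρ (j + 1) fun i => s i ω) ∂P := by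
          rw [lintegral_add_right _ (hpm.const_mul _), lintegral_add_right _ measurable_const,
            lintegral_const_mul' _ _ ENNReal.ofReal_ne_top,
            lintegral_const_mul' _ _ ENNReal.ofReal_ne_top, lintegral_const, measure_univ, mul_one]
      _ ≤ ENNReal.ofReal (1 / 2) * ENNReal.ofReal (K * M * Λ ^ 2 * (1 + 2 * c)) +
          ENNReal.ofReal (M * (K / 2)) + ENNReal.ofReal (c * K * M * Λ ^ 2) := by
          gcongr
          exact ih (by omega)
      _ = ENNReal.ofReal (1 / 2 * (K * M * Λ ^ 2 * (1 + 2 * c)) + M * (K / 2) +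
          c * K * M * Λ ^ 2) := by
          rw [← ENNReal.ofReal_mul (by positivity), ← ENNReal.ofReal_add (by positivity)
            (by positivity), ← ENNReal.ofReal_add (by positivity) (by positivity)]
      _ ≤ _ := by
          refine ENNReal.ofReal_le_ofReal ?_
          have hΛ2 : 1 ≤ Λ ^ 2 := one_le_pow₀ hΛ
          have : (M : ℝ) * (K / 2) * 1 ≤ M * (K / 2) * Λ ^ 2 := by gcongr
          linarith

/-- The expected regret of all agents in time step `t`, after the first epoch. -/
lemma IsRun.lintegral_gap_le (h : env.IsRun sel cγ cρ P s) (hρ : 0 < cρ) (hM : 1 ≤ M)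
    (hK : 1 ≤ K) (hd : 1 ≤ dTilde d b) {j t : ℕ} (hj : 1 ≤ j) (hjt : τ j ≤ t) (htj : t < τ (j + 1))
    {Λ : ℝ} (hΛ : 1 ≤ Λ) (h1 : Real.log (1 + (M * τ j : ℕ)) ≤ Λ)
    (h2 : Real.log ((M * τ j : ℕ) + dTilde d b) ≤ 2 * Λ) :
    ∫⁻ ω, ∑ m, ENNReal.ofReal (env.gap m (s t ω m).1 (s t ω m).2.2) ∂P ≤
      ENNReal.ofReal (2 * gapConst cγ cρ / cγ * Λ ^ 2 * √((M : ℝ) * K * dTilde d b) *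
        (1 / √((t : ℝ) + 1))) := by
  have hd1 : (1 : ℝ) ≤ dTilde d b := by exact_mod_cast hd
  have hM1 : (1 : ℝ) ≤ M := by exact_mod_cast hM
  have hK1 : (1 : ℝ) ≤ K := by exact_mod_cast hK
  have hgm : Measurable fun u : ℕ → Step K X =>
      ∑ m, ENNReal.ofReal (env.gap m (u t m).1 (u t m).2.2) :=
    Finset.measurable_fun_sum _ fun m _ => ((measurable_outcome (g := fun x _ a => env.gap m x a)
      fun a => (env.measurable_gap m a).comp measurable_fst).comp
        ((measurable_pi_apply m).comp (measurable_pi_apply t))).ennreal_ofReal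
  rw [h.lintegral_update t hgm fun u u' hu => by simp only [hu t le_rfl]]
  simp only [Function.update_self]
  set γ := rate M K d b cγ (j + 1) with hγd
  have hr : 0 ≤ γ := rate_nonneg hγ (j + 1)
  set R := ∫⁻ ω, ∫⁻ o, ∑ m, ENNReal.ofReal (env.gap m (o m).1 (o m).2.2)
    ∂(env.stepLaw sel cγ cρ t fun i => s i ω) ∂P with hR
  have hepoch (u : ℕ → Step K X) : env.stepLaw sel cγ cρ t u =
      Measure.pi fun m => env.agentLaw sel γ (env.estimate cρ (j + 1) u) m := by
    rw [stepLaw, epochOf_eq (by omega : 1 ≤ j + 1) hjt htj]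
  have hc := gapConst_pos cγ cρ
  have key : ENNReal.ofReal γ * R ≤ ENNReal.ofReal (K * M * Λ ^ 2 * gapConst cγ cρ) := by
    rw [hR, ← lintegral_const_mul' _ _ ENNReal.ofReal_ne_top]
    calc _ ≤ ∫⁻ ω, (ENNReal.ofReal (2 * K * M) +
          ∑ m, ∫⁻ x, ENNReal.ofReal (env.gapError sel cγ cρ (fun i => s i ω) m x j)
            ∂(env.ctx m)) ∂P := by
          refine lintegral_mono fun ω => ?_
          simp only [hepoch]
          exact env.rate_mul_lintegral_gap_le hsel hmax hγ cρ _ j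
      _ = ENNReal.ofReal (2 * K * M) + ∫⁻ ω, ∑ m, ∫⁻ x,
          ENNReal.ofReal (env.gapError sel cγ cρ (fun i => s i ω) m x j) ∂(env.ctx m) ∂P := by
          rw [lintegral_add_left measurable_const, lintegral_const, measure_univ, mul_one]
      _ ≤ ENNReal.ofReal (2 * K * M) +
          ENNReal.ofReal (K * M * Λ ^ 2 * (gapConst cγ cρ - 2)) := by
          gcongr
          exact h.lintegral_gapError_le hsel hmax hγ hρ hM hd hΛ h1 h2 j le_rfl
      _ = ENNReal.ofReal (2 * K * M + K * M * Λ ^ 2 * (gapConst cγ cρ - 2)) := by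
          refine (ENNReal.ofReal_add (by positivity) (mul_nonneg (by positivity) ?_)).symm
          unfold gapConst
          have : 0 ≤ 2 * (1528 * cγ ^ 2 * (2 + 256 / cρ ^ 2)) := by positivity
          linarith
      _ ≤ _ := by
          refine ENNReal.ofReal_le_ofReal ?_
          have hΛ2 : 1 ≤ Λ ^ 2 := one_le_pow₀ hΛ
          have : 2 * (K : ℝ) * M * 1 ≤ 2 * K * M * Λ ^ 2 := by gcongr
          linarith
  -- the learning rate from below
  have hlen : ((t : ℝ) + 1) / 4 ≤ epochLen j := by
    have := lt_four_mul_epochLen hj htj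
    have : (t : ℝ) + 1 ≤ 4 * epochLen j := by exact_mod_cast this
    linarith
  set q := √((M : ℝ) * K * dTilde d b) with hq
  set p := √((t : ℝ) + 1) with hp
  have hq0 : 0 < q := Real.sqrt_pos.2 (by positivity)
  have hp0 : 0 < p := Real.sqrt_pos.2 (by positivity)
  have hq2 : q ^ 2 = M * K * dTilde d b := Real.sq_sqrt (by positivity)
  have hp2 : p ^ 2 = t + 1 := Real.sq_sqrt (by positivity)
  have hγlow : cγ * (q * p / (2 * dTilde d b)) ≤ γ := by
    rw [hγd, rate]
    refine mul_le_mul_of_nonneg_left (Real.le_sqrt_of_sq_le ?_) hγ.le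
    rw [div_pow, mul_pow, hq2, hp2, Nat.add_sub_cancel]
    calc (M : ℝ) * K * dTilde d b * (t + 1) / (2 * dTilde d b) ^ 2
        = K * (M * (((t : ℝ) + 1) / 4)) / dTilde d b := by field_simp; ring
      _ ≤ _ := by push_cast; gcongr
  have hγ0 : 0 < γ := lt_of_lt_of_le (by positivity) hγlow
  have hRle : R ≤ ENNReal.ofReal (K * M * Λ ^ 2 * gapConst cγ cρ / γ) := by
    rw [ENNReal.ofReal_div_of_pos hγ0, ENNReal.le_div_iff_mul_le
      (Or.inl (ENNReal.ofReal_pos.2 hγ0).ne') (Or.inl ENNReal.ofReal_ne_top), mul_comm]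
    exact key
  refine hRle.trans (ENNReal.ofReal_le_ofReal ?_)
  rw [div_le_iff₀ hγ0]
  calc K * M * Λ ^ 2 * gapConst cγ cρ
      = 2 * gapConst cγ cρ / cγ * Λ ^ 2 * q * (1 / p) * (cγ * (q * p / (2 * dTilde d b))) := by
        have : 2 * gapConst cγ cρ / cγ * Λ ^ 2 * q * (1 / p) * (cγ * (q * p / (2 * dTilde d b))) =
          gapConst cγ cρ * Λ ^ 2 * q ^ 2 / dTilde d b := by field_simp
        rw [this, hq2]
        field_simp
    _ ≤ _ := by gcongr

/-- The expected regret, as an extended nonnegative number. -/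
lemma IsRun.lintegral_pathRegret_le (h : env.IsRun sel cγ cρ P s) (hρ : 0 < cρ) (hM : 1 ≤ M)
    (hK : 1 ≤ K) {T : ℕ} (hT : M ≤ K * dTilde d b * T) :
    ∫⁻ ω, ENNReal.ofReal (env.pathRegret T fun t => s t ω) ∂P ≤
      ENNReal.ofReal ((4 * gapConst cγ cρ / cγ + 2) *
        Real.log (2 + (M : ℝ) * K * dTilde d b * T) ^ 2 * √((M : ℝ) * K * dTilde d b * T)) := by
  have hpos : 0 < K * dTilde d b * T := by omega
  have hT1 : 1 ≤ T := Nat.pos_of_mul_pos_left hpos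
  have hd : 1 ≤ dTilde d b := Nat.pos_of_mul_pos_left (Nat.pos_of_mul_pos_right hpos)
  have hc := gapConst_pos cγ cρ
  have hd1 : (1 : ℝ) ≤ dTilde d b := by exact_mod_cast hd
  have hM1 : (1 : ℝ) ≤ M := by exact_mod_cast hM
  have hK1 : (1 : ℝ) ≤ K := by exact_mod_cast hK
  have hT1' : (1 : ℝ) ≤ T := by exact_mod_cast hT1
  set Y : ℝ := (M : ℝ) * K * dTilde d b * T with hY
  have hMT : (M : ℝ) * T ≤ Y := by
    have h1 : (1 : ℝ) ≤ K * dTilde d b := one_le_mul_of_one_le_of_one_le hK1 hd1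
    calc (M : ℝ) * T = M * T * 1 := (mul_one _).symm
      _ ≤ M * T * (K * dTilde d b) := by gcongr
      _ = Y := by rw [hY]; ring
  have hdY : (dTilde d b : ℝ) ≤ Y := by
    have h1 : (1 : ℝ) ≤ M * K * T :=
      one_le_mul_of_one_le_of_one_le (one_le_mul_of_one_le_of_one_le hM1 hK1) hT1'
    calc (dTilde d b : ℝ) = dTilde d b * 1 := (mul_one _).symm
      _ ≤ dTilde d b * (M * K * T) := by gcongr
      _ = Y := by rw [hY]; ring
  have hY1 : 1 ≤ Y := hd1.trans hdY
  set Λ := Real.log (2 + Y) with hΛd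
  have hΛ : 1 ≤ Λ := by
    rw [hΛd, Real.le_log_iff_exp_le (by positivity)]
    linarith [Real.exp_one_lt_d9]
  have hstep (t : ℕ) (ht : t < T) :
      ∫⁻ ω, ∑ m, ENNReal.ofReal (env.gap m (s t ω m).1 (s t ω m).2.2) ∂P ≤
        ENNReal.ofReal (2 * gapConst cγ cρ / cγ * Λ ^ 2 * √((M : ℝ) * K * dTilde d b) *
          (1 / √((t : ℝ) + 1))) + if t < 2 then ENNReal.ofReal M else 0 := by
    split_ifs with ht2
    -- in the first epoch the regret is bounded trivially
    · refine le_trans ?_ le_add_self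
      calc _ ≤ ∫⁻ _ω, ENNReal.ofReal M ∂P := by
            refine lintegral_mono fun ω => ?_
            calc _ ≤ ∑ _m : Fin M, ENNReal.ofReal 1 := Finset.sum_le_sum fun m _ =>
                  ENNReal.ofReal_le_ofReal (env.gap_le_one m _ _)
              _ = ENNReal.ofReal M := by simp
        _ = _ := by simp
    · rw [add_zero]
      obtain ⟨j, hj1, hjt, htj⟩ : ∃ j, 1 ≤ j ∧ τ j ≤ t ∧ t < τ (j + 1) := by
        have hj : 1 ≤ Nat.log 2 t := Nat.log_pos (by norm_num) (by omega)
        refine ⟨Nat.log 2 t, hj, ?_, ?_⟩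
        · rw [τ, if_neg (by omega)]
          exact Nat.pow_log_le_self 2 (by omega)
        · rw [τ, if_neg (by omega)]
          exact Nat.lt_pow_succ_log_self (by norm_num) t
      have hτ : ((M * τ j : ℕ) : ℝ) ≤ Y := by
        refine le_trans ?_ hMT
        have : τ j ≤ T := by omega
        push_cast
        gcongr
      have hτ0 : (0 : ℝ) ≤ (M * τ j : ℕ) := Nat.cast_nonneg _
      refine h.lintegral_gap_le hsel hmax hγ hρ hM hK hd hj1 hjt htj hΛ
        (Real.log_le_log (by linarith) (by linarith)) ?_
      calc Real.log ((M * τ j : ℕ) + dTilde d b) ≤ Real.log ((2 + Y) ^ 2) :=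
            Real.log_le_log (by linarith) (by nlinarith)
        _ = 2 * Λ := by rw [Real.log_pow, Nat.cast_ofNat]
  have hgm (t : ℕ) : Measurable fun ω =>
      ∑ m, ENNReal.ofReal (env.gap m (s t ω m).1 (s t ω m).2.2) :=
    Finset.measurable_fun_sum _ fun m _ => ((measurable_outcome (g := fun x _ a => env.gap m x a)
      fun a => (env.measurable_gap m a).comp measurable_fst).comp
        ((measurable_pi_apply m).comp (h.meas t))).ennreal_ofReal
  have hsplit (ω : Ω) : ENNReal.ofReal (env.pathRegret T fun t => s t ω) =
      ∑ t ∈ Finset.range T, ∑ m, ENNReal.ofReal (env.gap m (s t ω m).1 (s t ω m).2.2) := by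
    have e : env.pathRegret T (fun t => s t ω) =
        ∑ t ∈ Finset.range T, ∑ m, env.gap m (s t ω m).1 (s t ω m).2.2 := Finset.sum_comm
    rw [e, ENNReal.ofReal_sum_of_nonneg fun t _ =>
      Finset.sum_nonneg fun m _ => env.gap_nonneg m _ _]
    exact Finset.sum_congr rfl fun t _ =>
      ENNReal.ofReal_sum_of_nonneg fun m _ => env.gap_nonneg m _ _
  simp only [hsplit]
  rw [lintegral_finsetSum _ fun t _ => hgm t]
  set q := √((M : ℝ) * K * dTilde d b) with hq
  have hqT : q * √(T : ℝ) = √Y := by rw [hq, hY, Real.sqrt_mul (by positivity) (T : ℝ)]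
  have hMY : (M : ℝ) ≤ √Y := by
    refine Real.le_sqrt_of_sq_le ?_
    have h1 : (M : ℝ) ≤ K * dTilde d b * T := by exact_mod_cast hT
    calc (M : ℝ) ^ 2 = M * M := sq _
      _ ≤ M * (K * dTilde d b * T) := by gcongr
      _ = Y := by rw [hY]; ring
  have htwo : ∑ t ∈ Finset.range T, (if t < 2 then ENNReal.ofReal M else 0) ≤
      ENNReal.ofReal (2 * M) := by
    rw [← Finset.sum_filter, Finset.sum_const, nsmul_eq_mul, ENNReal.ofReal_mul (by norm_num)]
    gcongr
    have hsub : (Finset.range T).filter (· < 2) ⊆ Finset.range 2 := fun t ht => by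
      simp only [Finset.mem_filter] at ht
      exact Finset.mem_range.2 ht.2
    have hcard := Finset.card_le_card hsub
    rw [Finset.card_range] at hcard
    rw [ENNReal.ofReal_ofNat]
    exact_mod_cast hcard
  calc _ ≤ ∑ t ∈ Finset.range T, (ENNReal.ofReal (2 * gapConst cγ cρ / cγ * Λ ^ 2 * q *
          (1 / √((t : ℝ) + 1))) + if t < 2 then ENNReal.ofReal M else 0) :=
        Finset.sum_le_sum fun t ht => hstep t (Finset.mem_range.1 ht)
    _ ≤ ENNReal.ofReal (2 * gapConst cγ cρ / cγ * Λ ^ 2 * q * (2 * √(T : ℝ))) +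
        ENNReal.ofReal (2 * M) := by
        rw [Finset.sum_add_distrib, ← ENNReal.ofReal_sum_of_nonneg fun t _ => by positivity,
          ← Finset.mul_sum]
        gcongr
        exact sum_one_div_sqrt_le T
    _ = ENNReal.ofReal (2 * gapConst cγ cρ / cγ * Λ ^ 2 * q * (2 * √(T : ℝ)) + 2 * M) :=
        (ENNReal.ofReal_add (by positivity) (by positivity)).symm
    _ ≤ _ := by
        refine ENNReal.ofReal_le_ofReal ?_
        have hΛ2 : 1 ≤ Λ ^ 2 := one_le_pow₀ hΛ
        have h1 : 2 * (M : ℝ) ≤ 2 * (Λ ^ 2 * √Y) := by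
          have : 1 * √Y ≤ Λ ^ 2 * √Y := by gcongr
          linarith
        calc _ = 4 * gapConst cγ cρ / cγ * Λ ^ 2 * (q * √(T : ℝ)) + 2 * M := by ring
          _ ≤ 4 * gapConst cγ cρ / cγ * Λ ^ 2 * √Y + 2 * (Λ ^ 2 * √Y) := by rw [hqT]; gcongr
          _ = _ := by ring

end Env

end FedIGW

end

theorem mainTheorem7 (cγ cρ : ℝ) (hγ : 0 < cγ) (hρ : 0 < cρ) :
    ∃ (C : ℝ) (p : ℕ), 0 < C ∧
      ∀ (M K d : ℕ) (b : Fin M → ℕ), 1 ≤ M → 1 ≤ K →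
      ∀ (X : Fin M → Type*) [∀ m, MeasurableSpace (X m)] (env : FedIGW.Env M K d b X)
        (sel : (Fin K → ℝ) → Fin K), Measurable sel → (∀ (v : Fin K → ℝ) (a : Fin K), v a ≤ v (sel v)) →
        -- the distributed protocol computes the AGD iterates of the reformulated problem
        (∀ (E : ℕ) (S : FedIGW.Data K E X) (k : ℕ) (m : Fin M),
          (env.protocol S k).x m = FedIGW.Env.view m (env.flOutput S k)) ∧
        -- the regret
        (∀ {Ω : Type*} [MeasurableSpace Ω] (P : Measure Ω) [IsProbabilityMeasure P]
          (s : ℕ → Ω → FedIGW.Step K X), env.IsRun sel cγ cρ P s →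
          ∀ T : ℕ, Integrable (fun ω => env.pathRegret T fun t => s t ω) P ∧
            (M ≤ K * FedIGW.dTilde d b * T →
              ∫ ω, env.pathRegret T (fun t => s t ω) ∂P ≤
                C * Real.log (2 + (M : ℝ) * K * FedIGW.dTilde d b * T) ^ p *
                  √((M : ℝ) * K * FedIGW.dTilde d b * T))) ∧
        -- the communication
        (∀ (T : ℕ) (s : ℕ → FedIGW.Step K X),
          (env.totalSent cρ T s : ℝ) ≤
            C * d * Real.log ((max d 2 : ℕ) : ℝ) * √((M : ℝ) ^ 3 * T)) := by
  refine ⟨(4 * FedIGW.Env.gapConst cγ cρ / cγ + 2) + (8 * cρ + 16), 2, ?_, ?_⟩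
  · have := FedIGW.Env.gapConst_pos cγ cρ
    positivity
  intro M K d b hM hK X _ env sel hsel hmax
  have hc := FedIGW.Env.gapConst_pos cγ cρ
  refine ⟨fun E S k m => (env.protocol_eq_view S k m).1, ?_, fun T s => ?_⟩
  · intro Ω _ P _ s h T
    have hm : Measurable fun ω => env.pathRegret T fun t => s t ω :=
      (FedIGW.Env.measurable_pathRegret env T).comp (measurable_pi_lambda _ h.meas)
    have h0 (ω : Ω) := FedIGW.Env.pathRegret_nonneg env T fun t => s t ω
    refine ⟨Integrable.of_bound (C := M * T) hm.aestronglyMeasurable (.of_forall fun ω => ?_),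
      fun hT => ?_⟩
    · rw [Real.norm_of_nonneg (h0 ω)]
      calc _ ≤ ∑ _m : Fin M, ∑ _t ∈ Finset.range T, (1 : ℝ) :=
            Finset.sum_le_sum fun m _ => Finset.sum_le_sum fun t _ => env.gap_le_one m _ _
        _ = _ := by simp
    · rw [integral_eq_lintegral_of_nonneg_ae (.of_forall h0) hm.aestronglyMeasurable]
      refine (ENNReal.toReal_le_of_le_ofReal (by positivity)
        (h.lintegral_pathRegret_le hsel hmax hγ hρ hM hK hT)).trans ?_
      exact mul_le_mul_of_nonneg_right (mul_le_mul_of_nonneg_right (by linarith) (sq_nonneg _))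
        (Real.sqrt_nonneg _)
  · refine (env.totalSent_le hρ hM T s).trans ?_
    have h1 : 0 ≤ 4 * FedIGW.Env.gapConst cγ cρ / cγ + 2 := by positivity
    have h2 : 0 ≤ Real.log ((max d 2 : ℕ) : ℝ) := Real.log_natCast_nonneg _
    simp only [mul_assoc]
    exact mul_le_mul_of_nonneg_right (by linarith) (by positivity)
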